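/- Let $V$ be a real Euclidean vector space of dimension $2n+2$ with unit sphere $S^{2n+1}$, and let $\mathrm{Gr}_2^+(V)$ be the Grassmannian of oriented $2$-planes in $V$, with $T_P\mathrm{Gr}_2^+(V)=\mathrm{Lin}(P,V/P)$. A great circle fibration $\pi:S^{2n+1}\to X$ is a fibre bundle over a $2n$-dimensional manifold $X$ whose fibre over $x$ is the great circle cut out by an oriented $2$-plane $\iota(x)$ depending differentiably on $x$; its base is the submanifold $\iota(X)\subset\mathrm{Gr}_2^+(V)$, which we also denote by $X$, writing $P=\iota(x)$ for its points. Fix such a fibration, of class $C^\infty$. (1) There is a $C^1$-neighbourhood of $\iota$ such that for every $1\le k\le\infty$ and every $C^k$ map $f:X\to\mathrm{Gr}_2^+(V)$ in it, $f(X)$ is the base of a great circle fibration $S^{2n+1}\to X$ of class $C^k$ with fibres cut out by the planes $f(x)$. (2) For $P\in X$ and an oriented basis $e_0,e_1$ of $P$ there is $t\in\mathrm{End}(V/P)$ without real eigenvalues such that $T_PX=\{u\in\mathrm{Lin}(P,V/P): u(e_1)=t\,u(e_0)\}$. Let $J$ be the complex structure on $V/P$ which commutes with $t$ and for which all eigenvalues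 of $t$, as a complex linear map, have positive imaginary part. The basis can be chosen so that $s=(it+1)(t+i)^{-1}$ (with $i$ acting as $J$) has complex trace $0$; let $j$ be the complex structure on $P$ with $je_0=e_1$. Write $J_P$ for any pair $(j,J)$ so obtained. With respect to $J_P$, the projection of $\mathrm{Lin}(P,V/P)$ to the complex linear maps restricts to an isomorphism $T_PX\cong\Lambda^{1,0}P\otimes_{\mathbb C}V/P$, and the conjugate linear maps are mapped isomorphically onto the fibre of the normal bundle $\nu X=T\mathrm{Gr}_2^+(V)|_X/TX$: $$\nu_PX=\Lambda^{0,1}P\otimes_{\mathbb C}V/P .$$ (3) The normal bundle has real rank $2n$ over the $2n$-dimensional manifold $X$: realized as the orthogonal complement of $TX$ for the invariant Riemannian metric on $\mathrm{Gr}_2^+(V)$ (the Hilbert–Schmidt inner product on $\mathrm{Lin}(P,P^\perp)$), it has a smooth local frame of $2n$ sections near each point, so its sections are locally given by $2n$ arbitrary smooth real functions of $2n$ real variables. (4) The great circle fibrations near the given one are parametrized by the small smooth sections of $\nu X$. For a smooth section $\sigma$, with $\sigma(x)\in\mathrm{Lin}(P,P^\perp)$ normal to $T_PX$, let $X_\sigma$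 be the set of the graphs $\{p+\sigma(x)p: p\in P\}$, $P=\iota(x)$, $x\in X$. If $\sigma$ is $C^1$-small then $X_\sigma$ is the base of a smooth great circle fibration; this fibration is arbitrarily $C^1$-close to the given one if $\sigma$ is sufficiently $C^1$-small; among $C^1$-small sections, $X_\sigma$ determines $\sigma$; and for each $C^1$-neighbourhood of the zero section, every smooth great circle fibration sufficiently $C^1$-close to the given one has base $X_\sigma$ for a smooth section $\sigma$ in this neighbourhood. (Fibrations are compared as maps $S^{2n+1}\to\mathrm{Gr}_2^+(V)$.) In this sense the general great circle fibration depends on $2n$ real functions of $2n$ real variables. -/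

import Mathlib

open scoped Manifold ContDiff Topology

universe u v

noncomputable section

namespace GreatCircle

section Grassmannian

/-- A point of the Grassmannian of oriented `2`-planes of `V`: a `2`-dimensional linear subspace
together with an orientation of it. -/
structure OrientedPlane (V : Type v) [NormedAddCommGroup V] [InnerProductSpace ℝ V] where
  plane : Submodule ℝ V
  finrank_plane : Module.finrank ℝ plane = 2
  orientation : Orientation ℝ plane (Fin 2)

variable {V : Type v} [NormedAddCommGroup V] [InnerProductSpace ℝ V] [FiniteDimensional ℝ V]

/-- The operator of `V` which turns the oriented plane `P` by a right angle in the positive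
direction and vanishes on the orthogonal complement of `P`. The map `P ↦ rot P` identifies the
Grassmannian of oriented `2`-planes with a compact smooth submanifold of the vector space of
operators (the skew-adjoint operators `A` of rank `2` with `A ^ 3 = -A`). The smooth structure
of the Grassmannian and the `C¹` topology on maps into it are read off from this embedding. -/
def rot (P : OrientedPlane V) : V →L[ℝ] V :=
  haveI : Fact (Module.finrank ℝ P.plane = 2) := ⟨P.finrank_plane⟩
  P.plane.subtypeL ∘L
    (P.orientation.rightAngleRotation.toContinuousLinearEquiv : P.plane →L[ℝ] P.plane) ∘L
    P.plane.orthogonalProjectionOnto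

/-- The linear map `p ↦ p + (S p)^⊥` on the plane `P`, where `(S p)^⊥` is the component of `S p`
orthogonal to `P`. -/
def graphMap (P : OrientedPlane V) (S : V →L[ℝ] V) : P.plane →ₗ[ℝ] V :=
  P.plane.subtype +
    (P.planeᗮ.starProjection : V →ₗ[ℝ] V) ∘ₗ (S : V →ₗ[ℝ] V) ∘ₗ P.plane.subtype

theorem graphMap_injective (P : OrientedPlane V) (S : V →L[ℝ] V) :
    Function.Injective (graphMap P S) := by
  refine (injective_iff_map_eq_zero _).2 fun p hp => ?_
  have h1 : (p : V) + P.planeᗮ.starProjection (S p) = 0 := hp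
  have h2 : P.planeᗮ.starProjection (S p) ∈ P.planeᗮ := Submodule.starProjection_apply_mem _ _
  have h3 : inner ℝ (p : V) (P.planeᗮ.starProjection (S p)) = 0 :=
    (Submodule.mem_orthogonal _ _).1 h2 _ p.2
  have h4 : inner ℝ (p : V) (p : V) = 0 := by
    have h5 := congrArg (fun z => inner ℝ (p : V) z) h1
    simp only [inner_add_right, inner_zero_right] at h5
    linarith
  exact Subtype.ext (inner_self_eq_zero.1 h4)

/-- The oriented plane which is the graph over `P` of the linear map `P → Pᗮ` given by `S`,
oriented so that the projection to `P` preserves orientation. For `S` ranging over the linear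
maps `P → Pᗮ` (extended by `0` to `Pᗮ`), these are the affine coordinates of the Grassmannian
centred at `P`. -/
def graph (P : OrientedPlane V) (S : V →L[ℝ] V) : OrientedPlane V where
  plane := LinearMap.range (graphMap P S)
  finrank_plane := by
    rw [LinearMap.finrank_range_of_inj (graphMap_injective P S), P.finrank_plane]
  orientation := Orientation.map (Fin 2)
    (LinearEquiv.ofInjective (graphMap P S) (graphMap_injective P S)) P.orientation

end Grassmannian

section COne

variable {EM : Type*} [NormedAddCommGroup EM] [NormedSpace ℝ EM]
  {HM : Type*} [TopologicalSpace HM] (I : ModelWithCorners ℝ EM HM)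
  {M : Type*} [TopologicalSpace M] [ChartedSpace HM M] [IsManifold I 1 M]
  {E : Type*} [NormedAddCommGroup E] [NormedSpace ℝ E]

/-- The derivative of `f : M → E` along the tangent vector `ξ`. -/
def derivAlong (f : M → E) (ξ : TangentBundle I M) : E :=
  mfderiv I 𝓘(ℝ, E) f ξ.proj ξ.2

/-- `f` and `g` are `ε`-close, together with their differentials, on the set `K` of tangent
vectors. -/
def C1Close (K : Set (TangentBundle I M)) (ε : ℝ) (f g : M → E) : Prop :=
  ∀ ξ ∈ K, ‖g ξ.proj - f ξ.proj‖ < ε ∧ ‖derivAlong I g ξ - derivAlong I f ξ‖ < ε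

/-- The neighbourhoods of `f` in the `C¹` (compact-open) topology: uniform convergence of maps and
differentials on compact sets of tangent vectors. It is applied to `C¹` maps only. -/
def c1Nhds (f : M → E) : Filter (M → E) :=
  ⨅ (K : Set (TangentBundle I M)) (_ : IsCompact K) (ε : ℝ) (_ : 0 < ε),
    Filter.principal {g | C1Close I K ε f g}

end COne

section Fibration

variable (n : ℕ) {V : Type v} [NormedAddCommGroup V] [InnerProductSpace ℝ V]
  [FiniteDimensional ℝ V] [Fact (Module.finrank ℝ V = (2 * n + 1) + 1)]
  {X : Type u} [TopologicalSpace X] [ChartedSpace (EuclideanSpace ℝ (Fin (2 * n))) X]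

/-- `π : S^{2n+1} → X` is a great circle fibration of class `C^k` of the unit sphere of `V`, whose
fibre over `x` is the great circle cut out by the oriented plane `ι x`: the map `π` is a surjective
submersion (so, the sphere being compact, a fibre bundle), its fibres are those great circles, and
`ι` is of class `C^k`. The base, as a subset of the Grassmannian, is the range of `ι`. -/
structure IsGreatCircleFibration (k : WithTop ℕ∞) (π : Metric.sphere (0 : V) 1 → X)
    (ι : X → OrientedPlane V) : Prop where
  contMDiff_proj : ContMDiff (𝓡 (2 * n + 1)) (𝓡 (2 * n)) k π
  surjective : Function.Surjective π
  submersion : ∀ p, Function.Surjective (mfderiv (𝓡 (2 * n + 1)) (𝓡 (2 * n)) π p)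
  fiber : ∀ (p : Metric.sphere (0 : V) 1) (x : X), π p = x ↔ (p : V) ∈ (ι x).plane
  contMDiff_plane : ContMDiff (𝓡 (2 * n)) 𝓘(ℝ, V →L[ℝ] V) k (fun x => rot (ι x))

/-- The derivative at `x`, in the direction `ξ`, of the orthogonal projection to the plane
`ι x`. -/
def projDeriv (ι : X → OrientedPlane V) (x : X) :
    TangentSpace (𝓡 (2 * n)) x →L[ℝ] (V →L[ℝ] V) :=
  mfderiv (𝓡 (2 * n)) 𝓘(ℝ, V →L[ℝ] V) (fun y => (ι y).plane.starProjection) x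

/-- The differential of `ι : X → Gr` at `x`, under the identification `T_P Gr = Lin(P, V/P)` for
`P = ι x`. A moving plane `P(t)` has as velocity the linear map `P → V/P` which sends `p` to
`v'(0)` modulo `P`, for any moving vector `v(t) ∈ P(t)` with `v(0) = p`; here `v(t)` is the
orthogonal projection of `p` to `P(t)`. -/
def velocity (ι : X → OrientedPlane V) (x : X) :
    TangentSpace (𝓡 (2 * n)) x →ₗ[ℝ] ((ι x).plane →ₗ[ℝ] V ⧸ (ι x).plane) where
  toFun ξ := (ι x).plane.mkQ ∘ₗ (projDeriv n ι x ξ : V →ₗ[ℝ] V) ∘ₗ (ι x).plane.subtype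
  map_add' ξ η := by ext p; simp
  map_smul' c ξ := by ext p; simp

/-- The tangent space of the submanifold `ι : X → Gr` at `P = ι x`, inside `Lin(P, V/P)`. -/
def tangentPlane (ι : X → OrientedPlane V) (x : X) :
    Submodule ℝ ((ι x).plane →ₗ[ℝ] V ⧸ (ι x).plane) :=
  LinearMap.range (velocity n ι x)

/-- The fibre at `P = ι x` of the normal bundle of the submanifold `ι : X → Gr`: the quotient of
`T_P Gr = Lin(P, V/P)` by the tangent space of the submanifold. -/
abbrev NormalFiber (ι : X → OrientedPlane V) (x : X) : Type v :=
  ((ι x).plane →ₗ[ℝ] V ⧸ (ι x).plane) ⧸ tangentPlane n ι x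

/-- The normal space at `x` for the invariant Riemannian metric on the Grassmannian. A tangent
vector to the Grassmannian at `P = ι x` is represented by a linear map `P → Pᗮ`, extended by `0`
to `Pᗮ`, and the metric is the Hilbert-Schmidt inner product `tr (S† T)`. -/
def normalSpace (ι : X → OrientedPlane V) (x : X) : Submodule ℝ (V →L[ℝ] V) where
  carrier := {S | (∀ v ∈ (ι x).planeᗮ, S v = 0) ∧ (∀ v, S v ∈ (ι x).planeᗮ) ∧
    ∀ ξ : TangentSpace (𝓡 (2 * n)) x,
      LinearMap.trace ℝ V
        ((ContinuousLinearMap.adjoint S ∘L projDeriv n ι x ξ : V →L[ℝ] V) : V →ₗ[ℝ] V) = 0}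
  zero_mem' := by
    refine ⟨fun v _ => rfl, fun v => Submodule.zero_mem _, fun ξ => ?_⟩
    simp
  add_mem' := by
    rintro S T ⟨h1, h2, h3⟩ ⟨k1, k2, k3⟩
    refine ⟨fun v hv => ?_, fun v => Submodule.add_mem _ (h2 v) (k2 v), fun ξ => ?_⟩
    · simp [h1 v hv, k1 v hv]
    · rw [map_add, ContinuousLinearMap.add_comp, ContinuousLinearMap.toLinearMap_add, map_add,
        h3 ξ, k3 ξ, add_zero]
  smul_mem' := by
    rintro c S ⟨h1, h2, h3⟩
    refine ⟨fun v hv => ?_, fun v => Submodule.smul_mem _ c (h2 v), fun ξ => ?_⟩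
    · simp [h1 v hv]
    · have h : ContinuousLinearMap.adjoint (c • S) = c • ContinuousLinearMap.adjoint S := by
        simp
      rw [h, ContinuousLinearMap.smul_comp, ContinuousLinearMap.toLinearMap_smul, map_smul, h3 ξ,
        smul_zero]

/-- The class in the normal fibre `Lin(P, V/P) / T_P X` of a linear map `S : P → Pᗮ`. -/
def normalClass (ι : X → OrientedPlane V) (x : X) (S : V →L[ℝ] V) : NormalFiber n ι x :=
  (tangentPlane n ι x).mkQ ((ι x).plane.mkQ ∘ₗ (S : V →ₗ[ℝ] V) ∘ₗ (ι x).plane.subtype)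

/-- A smooth section of the normal bundle of `ι : X → Gr`, realized in the Riemannian normal
spaces. -/
def IsNormalSection (ι : X → OrientedPlane V) (σ : X → V →L[ℝ] V) : Prop :=
  ContMDiff (𝓡 (2 * n)) 𝓘(ℝ, V →L[ℝ] V) ∞ σ ∧ ∀ x, σ x ∈ normalSpace n ι x

end Fibration

section Osculating

variable {P : Type u} [AddCommGroup P] [Module ℝ P] {Q : Type v} [AddCommGroup Q] [Module ℝ Q]

/-- `J` is the complex structure `J_t` determined by the real linear map `t`: it commutes with `t`,
and the eigenvalues of `t` as a complex linear map of `(Q, J)`, that is, on the `i`-eigenspace of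
`J` in the complexification, have positive imaginary part. -/
structure IsComplexStructureOf (t J : Q →ₗ[ℝ] Q) : Prop where
  sq : J ∘ₗ J = -LinearMap.id
  comm : J ∘ₗ t = t ∘ₗ J
  pos : ∀ (a b : ℝ) (q : Q), q ≠ 0 → t q = a • q + b • J q → 0 < b

/-- The pair of complex structures `j` on the oriented plane `P` and `J` on `Q = V/P` which the
moving frame attaches to an elliptic subspace `U` of `Lin(P, Q)`. In an adapted oriented basis
`e₀, e₁` of `P`, with `j e₀ = e₁`, the subspace `U` is given by an equation `u e₁ = t (u e₀)`; the
complex structure on `Q` is `J = J_t`; and the basis is normalized so that the Cayley transform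
`s = (i t + 1) (t + i)⁻¹` of `t` (where `i` acts on `Q` as `J`) has complex trace zero. -/
def IsOsculating (o : Orientation ℝ P (Fin 2)) (U : Submodule ℝ (P →ₗ[ℝ] Q))
    (j : P →ₗ[ℝ] P) (J : Q →ₗ[ℝ] Q) : Prop :=
  ∃ (e : Module.Basis (Fin 2) ℝ P) (t s : Q →ₗ[ℝ] Q),
    e.orientation = o ∧ j (e 0) = e 1 ∧ j (e 1) = -e 0 ∧
    (∀ u : P →ₗ[ℝ] Q, u ∈ U ↔ u (e 1) = t (u (e 0))) ∧
    IsComplexStructureOf t J ∧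
    s ∘ₗ (t + J) = J ∘ₗ t + LinearMap.id ∧
    LinearMap.trace ℝ Q s = 0 ∧ LinearMap.trace ℝ Q (J ∘ₗ s) = 0

/-- `Λ^{1,0} P ⊗_ℂ Q`: the complex linear maps from `(P, j)` to `(Q, J)`. -/
def complexLinear (j : P →ₗ[ℝ] P) (J : Q →ₗ[ℝ] Q) : Submodule ℝ (P →ₗ[ℝ] Q) where
  carrier := {u | u ∘ₗ j = J ∘ₗ u}
  zero_mem' := by simp
  add_mem' := by
    rintro u v (hu : _ = _) (hv : _ = _)
    simp [LinearMap.add_comp, LinearMap.comp_add, hu, hv]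
  smul_mem' := by
    rintro c u (hu : _ = _)
    simp [LinearMap.smul_comp, LinearMap.comp_smul, hu]

/-- `Λ^{0,1} P ⊗_ℂ Q`: the conjugate linear maps from `(P, j)` to `(Q, J)`. -/
def conjLinear (j : P →ₗ[ℝ] P) (J : Q →ₗ[ℝ] Q) : Submodule ℝ (P →ₗ[ℝ] Q) where
  carrier := {u | u ∘ₗ j = -(J ∘ₗ u)}
  zero_mem' := by simp
  add_mem' := by
    rintro u v (hu : _ = _) (hv : _ = _)
    simp [LinearMap.add_comp, LinearMap.comp_add, hu, hv, add_comm]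
  smul_mem' := by
    rintro c u (hu : _ = _)
    simp [LinearMap.smul_comp, LinearMap.comp_smul, hu]

end Osculating

end GreatCircle

end

open GreatCircle

namespace GreatCircle

/-! ### Oriented planes as operators, and graph coordinates as formulas in them -/

section GrassmannianAlgebra

variable {V : Type v} [NormedAddCommGroup V] [InnerProductSpace ℝ V]

/-! The Grassmannian is treated inside the vector space of operators. With `A = rot P`, the
projection to `P` is `-A²`, so the graph coordinates centred at `P` become formulas `graphRot` and
`graphCoord` in operators, smooth on open sets and inverse to each other where the trace of `A' A`
is negative (`rot_graph`, `graphCoord_rot_graph`, `graph_graphCoord`). Smoothness and `C¹` estimates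
on the Grassmannian thereby reduce to calculus in a normed space.

For the linear algebra at a point, extend `π` radially to `V ∖ 0`. The projection of `v` to the
moving plane `ι y` is sent back to `y`, so the velocity of the planes lifts tangent vectors of `X`;
on the other hand the derivative of the extension kills the plane through `v`. Hence a nonzero
element of `T_P X` has no zero on `P ∖ 0` (`IsFibration.isElliptic`), and `T_P X` has an equation `u
e₁ = t (u e₀)` with no real eigenvalue of `t`. The structure `J` is a real polynomial in `t` given
by the Chinese remainder theorem (`exists_polynomial_sq_add_one`). The normalized basis is a
conformal barycentre of the spectrum, found by maximizing a function on a half plane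
(`Matrix.exists_trace_inv_eq`). Both isomorphisms with spaces of complex linear or conjugate linear
maps then amount to the invertibility of `t + J`.

Suppose a family of planes `f` is `C¹`-close to `ι`. Project each `v` to the plane `f (π v)`. This
map is homogeneous of degree one and `C¹`-close to the identity on the sphere, hence a Lipschitz
perturbation of the identity on all of `V` and a homeomorphism, smooth away from `0`. It carries
each `ι x` linearly onto `f x`, so transporting `π` by it yields a fibration with planes `f x`
(`IsFibration.exists_fibration`). This gives the openness statement, and also the fibrations
attached to small normal sections.

For the converse and for uniqueness one needs foot points: the `x` for which a nearby plane is the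
graph of a normal vector at `ι x`. The implicit function theorem applies because the derivative of
the defining equation in the direction of the base is minus the metric of `X`, which is definite;
compactness of `X` makes the result uniform (`IsFibration.exists_foot`). If `ι' : X' → Gr` is a
nearby fibration, taking foot points defines `ψ : X' → X`. That `ψ` is invertible is seen by
transporting `π'` to the planes `ι (ψ x')`: the new projection `q` satisfies `ψ ∘ q = π`, so it
descends to a smooth inverse of `ψ`. The graph coordinates of the planes of `X'` over their foot
points are then the required section (`IsFibration.exists_normalSection`). -/

theorem areaForm_pos_of_orientation_eq {E : Type*} [NormedAddCommGroup E] [InnerProductSpace ℝ E]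
    [Fact (Module.finrank ℝ E = 2)] (o : Orientation ℝ E (Fin 2))
    (b : Module.Basis (Fin 2) ℝ E) (hb : b.orientation = o) : 0 < o.areaForm (b 0) (b 1) := by
  have hE : Module.finrank ℝ E = 2 := Fact.out
  have h1 := o.volumeForm_robust (o.finOrthonormalBasis two_pos hE)
    (o.finOrthonormalBasis_orientation two_pos hE)
  have h2 : (o.finOrthonormalBasis two_pos hE).toBasis.orientation = b.orientation := by
    rw [hb]; exact o.finOrthonormalBasis_orientation two_pos hE
  rw [Module.Basis.orientation_eq_iff_det_pos] at h2
  have h3 : ![b 0, b 1] = b := by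
    ext i
    fin_cases i <;> rfl
  rw [o.areaForm_to_volumeForm, h1, h3]
  exact h2

/-- The square of the area of the parallelogram spanned by `a` and `c`. -/
noncomputable def gram (a c : V) : ℝ := ‖a‖ ^ 2 * ‖c‖ ^ 2 - (inner ℝ a c) ^ 2

theorem gram_eq_areaForm_sq {E : Type*} [NormedAddCommGroup E] [InnerProductSpace ℝ E]
    [Fact (Module.finrank ℝ E = 2)] (o : Orientation ℝ E (Fin 2)) (a c : E) :
    gram a c = o.areaForm a c ^ 2 := by
  have := o.inner_sq_add_areaForm_sq a c
  simp only [gram]; linarith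

/-- An arbitrary oriented basis is needed because an orthonormal basis of `P` is carried to a basis
of a graph that need not be orthonormal; dividing by the area compensates for this. The two sides
are compared through their inner products with the basis vectors. -/
theorem rightAngleRotation_eq_of_basis {E : Type*} [NormedAddCommGroup E] [InnerProductSpace ℝ E]
    [Fact (Module.finrank ℝ E = 2)] (o : Orientation ℝ E (Fin 2))
    (b : Module.Basis (Fin 2) ℝ E) (hb : b.orientation = o) (x : E) :
    o.rightAngleRotation x = (√(gram (b 0) (b 1)))⁻¹ •
      ((inner ℝ (b 0) x : ℝ) • b 1 - (inner ℝ (b 1) x : ℝ) • b 0) := by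
  set m := o.areaForm (b 0) (b 1) with hm
  have hpos : 0 < m := areaForm_pos_of_orientation_eq o b hb
  rw [gram_eq_areaForm_sq o, Real.sqrt_sq hpos.le]
  have key : innerₗ E ∘ₗ (o.rightAngleRotation.toLinearEquiv : E →ₗ[ℝ] E) =
      innerₗ E ∘ₗ
        (m⁻¹ • ((innerₗ E (b 0)).smulRight (b 1) - (innerₗ E (b 1)).smulRight (b 0))) := by
    have hm2 : ‖b 0‖ ^ 2 * ‖b 1‖ ^ 2 - (inner ℝ (b 0) (b 1)) ^ 2 = m ^ 2 :=
      gram_eq_areaForm_sq o (b 0) (b 1)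
    have hsw : o.areaForm (b 1) (b 0) = -m := o.areaForm_swap _ _
    have hc : inner ℝ (b 1) (b 0) = inner ℝ (b 0) (b 1) := real_inner_comm _ _
    refine b.ext fun i => b.ext fun k => ?_
    fin_cases i <;> fin_cases k <;>
      simp [innerₗ_apply_apply, hsw, hc, ← hm] <;>
      field_simp <;> first | linarith | (right; ring)
  refine ext_inner_right ℝ fun w => ?_
  simpa [innerₗ_apply_apply, inner_smul_left, inner_sub_left] using
    LinearMap.congr_fun (LinearMap.congr_fun key x) w

variable [FiniteDimensional ℝ V]

theorem rot_apply_inner (P : OrientedPlane V) (b : Module.Basis (Fin 2) ℝ P.plane)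
    (hb : b.orientation = P.orientation) (w : V) :
    rot P w = (√(gram (b 0 : V) (b 1)))⁻¹ •
      ((inner ℝ (b 0 : V) w : ℝ) • (b 1 : V) - (inner ℝ (b 1 : V) w : ℝ) • (b 0 : V)) := by
  have : Fact (Module.finrank ℝ P.plane = 2) := ⟨P.finrank_plane⟩
  have h1 : rot P w = (P.orientation.rightAngleRotation (P.plane.orthogonalProjectionOnto w) : V) :=
    rfl
  have h2 : ∀ a : P.plane, inner ℝ a (P.plane.orthogonalProjectionOnto w) = inner ℝ (a : V) w :=
    fun a => Submodule.inner_orthogonalProjectionOnto_eq_of_mem_left _ _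
  rw [h1, rightAngleRotation_eq_of_basis _ b hb, h2, h2]
  simp [gram]

theorem rot_apply_coe (P : OrientedPlane V) [Fact (Module.finrank ℝ P.plane = 2)] (x : P.plane) :
    rot P x = (P.orientation.rightAngleRotation x : V) := by
  have h1 : rot P x = (P.orientation.rightAngleRotation (P.plane.orthogonalProjectionOnto x) : V) :=
    rfl
  rw [h1, Submodule.orthogonalProjectionOnto_mem_subspace_eq_self]

theorem rot_apply_mem (P : OrientedPlane V) (w : V) : rot P w ∈ P.plane :=
  Submodule.coe_mem _

theorem rot_starProjection (P : OrientedPlane V) (w : V) :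
    rot P (P.plane.starProjection w) = rot P w := by
  have : Fact (Module.finrank ℝ P.plane = 2) := ⟨P.finrank_plane⟩
  exact rot_apply_coe P (P.plane.orthogonalProjectionOnto w)

theorem rot_rot (P : OrientedPlane V) (w : V) : rot P (rot P w) = -P.plane.starProjection w := by
  have : Fact (Module.finrank ℝ P.plane = 2) := ⟨P.finrank_plane⟩
  have h := rot_apply_coe P (P.orientation.rightAngleRotation (P.plane.orthogonalProjectionOnto w))
  rw [P.orientation.rightAngleRotation_rightAngleRotation] at h
  exact h

/-- The orthogonal projection to the plane `P`, as a function of `A = rot P`. -/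
noncomputable def planeProj (A : V →L[ℝ] V) : V →L[ℝ] V := -(A * A)

theorem planeProj_rot (P : OrientedPlane V) : planeProj (rot P) = P.plane.starProjection := by
  ext w
  simp [planeProj, rot_rot]

theorem star_rot (P : OrientedPlane V) : star (rot P) = -rot P := by
  have : Fact (Module.finrank ℝ P.plane = 2) := ⟨P.finrank_plane⟩
  set b := P.orientation.finOrthonormalBasis two_pos P.finrank_plane
  have hb := rot_apply_inner P b.toBasis (P.orientation.finOrthonormalBasis_orientation _ _)
  rw [ContinuousLinearMap.star_eq_adjoint, eq_comm, ContinuousLinearMap.eq_adjoint_iff]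
  intro x y
  rw [neg_apply, hb x, hb y]
  simp only [inner_neg_left, inner_smul_left, inner_smul_right, inner_sub_left, inner_sub_right,
    real_inner_comm x, RCLike.conj_to_real]
  ring

theorem rot_mul_starProjection (P : OrientedPlane V) :
    rot P * P.plane.starProjection = rot P := by
  ext w
  exact rot_starProjection P w

theorem starProjection_mul_rot (P : OrientedPlane V) :
    P.plane.starProjection * rot P = rot P := by
  ext w
  exact Submodule.starProjection_eq_self_iff.2 (rot_apply_mem P w)

theorem star_starProjection (K : Submodule ℝ V) : star K.starProjection = K.starProjection :=
  (isSelfAdjoint_starProjection K).star_eq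

theorem starProjection_mul_self (K : Submodule ℝ V) :
    K.starProjection * K.starProjection = K.starProjection :=
  K.isIdempotentElem_starProjection

/-- The trace, as a continuous linear functional. -/
noncomputable def opTrace : (V →L[ℝ] V) →L[ℝ] ℝ :=
  LinearMap.toContinuousLinearMap (LinearMap.trace ℝ V ∘ₗ ContinuousLinearMap.coeLM ℝ)

theorem opTrace_apply (T : V →L[ℝ] V) : opTrace T = LinearMap.trace ℝ V (T : V →ₗ[ℝ] V) := rfl

theorem opTrace_mul_comm (S T : V →L[ℝ] V) : opTrace (S * T) = opTrace (T * S) :=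
  LinearMap.trace_mul_comm ℝ (S : V →ₗ[ℝ] V) (T : V →ₗ[ℝ] V)

theorem opTrace_star_mul_self (T : V →L[ℝ] V) :
    opTrace (star T * T) = ∑ i, ‖T (stdOrthonormalBasis ℝ V i)‖ ^ 2 := by
  rw [opTrace_apply, LinearMap.trace_eq_sum_inner _ (stdOrthonormalBasis ℝ V)]
  refine Finset.sum_congr rfl fun i _ => ?_
  rw [← real_inner_self_eq_norm_sq, ← ContinuousLinearMap.adjoint_inner_right,
    ContinuousLinearMap.star_eq_adjoint]
  rfl

theorem eq_zero_of_opTrace_star_mul_self {T : V →L[ℝ] V} (h : opTrace (star T * T) = 0) :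
    T = 0 := by
  rw [opTrace_star_mul_self, Finset.sum_eq_zero_iff_of_nonneg fun i _ => by positivity] at h
  have : (T : V →ₗ[ℝ] V) = 0 := (stdOrthonormalBasis ℝ V).toBasis.ext fun i => by
    simpa using h i (Finset.mem_univ i)
  ext v
  exact LinearMap.congr_fun this v

theorem opTrace_starProjection (P : OrientedPlane V) : opTrace P.plane.starProjection = 2 := by
  have h : LinearMap.IsProj P.plane (P.plane.starProjection : V →ₗ[ℝ] V) :=
    ⟨fun x => Submodule.starProjection_apply_mem _ _,
      fun x hx => Submodule.starProjection_eq_self_iff.2 hx⟩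
  rw [opTrace_apply, h.trace, P.finrank_plane]
  norm_num

theorem opTrace_rot_mul_rot (P : OrientedPlane V) : opTrace (rot P * rot P) = -2 := by
  have h := opTrace_starProjection P
  rw [← planeProj_rot, planeProj, map_neg] at h
  linarith

/-- The plane is the range of `-A²`, and reversing its orientation changes the sign of the nonzero
operator `A`. -/
theorem rot_injective : Function.Injective (rot : OrientedPlane V → V →L[ℝ] V) := by
  rintro P Q h
  have h1 : P.plane = Q.plane := by
    have : P.plane.starProjection = Q.plane.starProjection := by
      rw [← planeProj_rot, ← planeProj_rot, h]
    rw [← P.plane.range_starProjection, this, Q.plane.range_starProjection]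
  obtain ⟨K, hK, o⟩ := P
  obtain ⟨K', hK', o'⟩ := Q
  obtain rfl : K = K' := h1
  have : Fact (Module.finrank ℝ K = 2) := ⟨hK⟩
  rcases o.eq_or_eq_neg o' (by simp [hK]) with h2 | h2
  · rw [h2]
  · exfalso
    subst h2
    obtain ⟨x, hx⟩ : ∃ x : K, x ≠ 0 := by
      have : Nontrivial K := Module.nontrivial_of_finrank_pos (R := ℝ) (by omega)
      exact exists_ne 0
    have h3 : rot ⟨K, hK, -o'⟩ x = rot ⟨K, hK, o'⟩ x := by rw [h]
    rw [rot_apply_coe ⟨K, hK, -o'⟩ x, rot_apply_coe ⟨K, hK, o'⟩ x] at h3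
    have h4 := Subtype.ext h3
    simp only [Orientation.rightAngleRotation_neg_orientation] at h4
    have h5 : o'.rightAngleRotation x = 0 := by
      have h6 : (2 : ℝ) • o'.rightAngleRotation x = 0 := by
        rw [two_smul]; nth_rewrite 1 [← h4]; simp
      simpa using h6
    exact hx (by simpa using h5)

/-- A skew-adjoint operator living on the oriented plane `P` is a multiple of `rot P`. -/
theorem exists_eq_smul_rot (P : OrientedPlane V) (M : V →L[ℝ] V) (h1 : star M = -M)
    (h2 : M * P.plane.starProjection = M) : ∃ c : ℝ, M = c • rot P := by
  have : Fact (Module.finrank ℝ P.plane = 2) := ⟨P.finrank_plane⟩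
  set b := P.orientation.finOrthonormalBasis two_pos P.finrank_plane
  have hb := rot_apply_inner P b.toBasis (P.orientation.finOrthonormalBasis_orientation _ _)
  have hskew : ∀ x y, inner ℝ (M x) y = -inner ℝ x (M y) := fun x y => by
    rw [← ContinuousLinearMap.adjoint_inner_right, ← ContinuousLinearMap.star_eq_adjoint, h1]
    simp
  have hproj : ∀ x, M (P.plane.starProjection x) = M x := fun x => by
    conv_rhs => rw [← h2]
    rfl
  have hexp : ∀ x, P.plane.starProjection x =
      (inner ℝ (b 0 : V) x : ℝ) • (b 0 : V) + (inner ℝ (b 1 : V) x : ℝ) • (b 1 : V) := fun x => by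
    have := b.sum_repr (P.plane.orthogonalProjectionOnto x)
    rw [Fin.sum_univ_two, b.repr_apply_apply, b.repr_apply_apply,
      Submodule.inner_orthogonalProjectionOnto_eq_of_mem_left,
      Submodule.inner_orthogonalProjectionOnto_eq_of_mem_left] at this
    exact (congrArg (Subtype.val) this).symm
  have hg : gram (b 0 : V) (b 1) = 1 := by
    have h3 : ‖(b 0 : V)‖ = 1 := b.orthonormal.1 0
    have h4 : ‖(b 1 : V)‖ = 1 := b.orthonormal.1 1
    have h5 : inner ℝ (b 0 : V) (b 1 : V) = 0 := b.orthonormal.2 (by decide)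
    simp [gram, h3, h4, h5]
  have hself : ∀ x, inner ℝ x (M x) = 0 := fun x => by
    have := hskew x x
    rw [real_inner_comm] at this
    linarith
  refine ⟨inner ℝ (b 1 : V) (M (b 0)), ?_⟩
  ext x
  -- Taking adjoints in `M p = M` and using skewness shows that `M` also takes values in `P`.
  have hM : ∀ z, M z = P.plane.starProjection (M z) := fun z => by
    have h6 : star (M * P.plane.starProjection) = star M := by rw [h2]
    rw [star_mul, star_starProjection, h1, mul_neg, neg_inj] at h6
    exact (DFunLike.congr_fun h6 z).symm
  rw [← hproj x, hM, hexp (M _), hexp x]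
  simp only [map_add, map_smul, inner_add_right, inner_smul_right, hself,
    smul_apply, hb, OrthonormalBasis.coe_toBasis, hg]
  have h7 := hskew (b 0) (b 1)
  have h8 : inner ℝ (b 0 : V) (M (b 1)) = -inner ℝ (b 1 : V) (M (b 0)) := by
    rw [real_inner_comm (M (b 0 : V))]; linarith
  rw [h8]
  simp only [Real.sqrt_one, inv_one, one_smul]
  module

/-- The operator `B = p + (1 - p) S p`, where `p` is the orthogonal projection to the plane `P`
and `A = rot P`; its restriction to `P` parametrizes the graph of `S`. -/
noncomputable def graphOp (A S : V →L[ℝ] V) : V →L[ℝ] V :=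
  planeProj A + (1 - planeProj A) * S * planeProj A

/-- An operator which is a positive multiple of `rot (graph P S)` for `A = rot P`. -/
noncomputable def graphSkew (A S : V →L[ℝ] V) : V →L[ℝ] V :=
  graphOp A S * A * star (graphOp A S)

/-- `rot (graph P S)` in terms of `A = rot P` and `S`. -/
noncomputable def graphRot (A S : V →L[ℝ] V) : V →L[ℝ] V :=
  (√(-(1 / 2) * opTrace (graphSkew A S * graphSkew A S)))⁻¹ • graphSkew A S

/-- The affine coordinate with centre `P` of the plane `P'`, in terms of `A = rot P` and
`A' = rot P'`. -/
noncomputable def graphCoord (A A' : V →L[ℝ] V) : V →L[ℝ] V :=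
  (2 / opTrace (A' * A)) • ((1 - planeProj A) * A' * A)

theorem graphMap_apply (P : OrientedPlane V) (S : V →L[ℝ] V) (x : P.plane) :
    graphMap P S x = graphOp (rot P) S x := by
  have hx : P.plane.starProjection (x : V) = x := Submodule.starProjection_eq_self_iff.2 x.2
  simp only [graphOp, planeProj_rot, graphMap]
  simp [hx, Submodule.starProjection_orthogonal']

/-- In an oriented orthonormal basis of `P`, `rot P` is `w ↦ ⟨e₀, w⟩ e₁ - ⟨e₁, w⟩ e₀`. Forming `B A
B†` with `B = graphOp A S` replaces each `eᵢ` by `B eᵢ`, and these form an oriented basis of the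
graph; `m` is the area they span. -/
theorem exists_rot_graph (P : OrientedPlane V) (S : V →L[ℝ] V) :
    ∃ m : ℝ, 0 < m ∧ rot (graph P S) = m⁻¹ • graphSkew (rot P) S := by
  have : Fact (Module.finrank ℝ P.plane = 2) := ⟨P.finrank_plane⟩
  set b := P.orientation.finOrthonormalBasis two_pos P.finrank_plane
  have hbo : b.toBasis.orientation = P.orientation :=
    P.orientation.finOrthonormalBasis_orientation _ _
  have hb := rot_apply_inner P b.toBasis hbo
  have hg : gram (b 0 : V) (b 1) = 1 := by
    have h3 : ‖(b 0 : V)‖ = 1 := b.orthonormal.1 0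
    have h4 : ‖(b 1 : V)‖ = 1 := b.orthonormal.1 1
    have h5 : inner ℝ (b 0 : V) (b 1 : V) = 0 := b.orthonormal.2 (by decide)
    simp [gram, h3, h4, h5]
  set L := LinearEquiv.ofInjective (graphMap P S) (graphMap_injective P S)
  let b' : Module.Basis (Fin 2) ℝ (graph P S).plane := b.toBasis.map L
  have hb'o : b'.orientation = (graph P S).orientation := by
    refine (Module.Basis.orientation_map b.toBasis L).trans ?_
    rw [hbo]
    rfl
  have hb' := rot_apply_inner (graph P S) b' hb'o
  have hb'v : ∀ i, (b' i : V) = graphOp (rot P) S (b i) := fun i => by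
    rw [← graphMap_apply]
    show ((L (b.toBasis i) : _) : V) = _
    rw [LinearEquiv.ofInjective_apply, OrthonormalBasis.coe_toBasis]
  have : Fact (Module.finrank ℝ (graph P S).plane = 2) := ⟨(graph P S).finrank_plane⟩
  have hpos : 0 < gram (b' 0 : V) (b' 1 : V) := by
    have h6 := areaForm_pos_of_orientation_eq _ b' hb'o
    have h7 := gram_eq_areaForm_sq (graph P S).orientation (b' 0) (b' 1)
    have h8 : gram (b' 0 : V) (b' 1 : V) = gram (b' 0) (b' 1) := rfl
    rw [h8, h7]
    positivity
  refine ⟨√(gram (b' 0 : V) (b' 1)), Real.sqrt_pos.2 hpos, ?_⟩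
  ext w
  have hadj : ∀ x, inner ℝ x (star (graphOp (rot P) S) w) = inner ℝ (graphOp (rot P) S x) w :=
    fun x => by
      rw [ContinuousLinearMap.star_eq_adjoint, ContinuousLinearMap.adjoint_inner_right]
  have h9 : graphSkew (rot P) S w =
      graphOp (rot P) S (rot P (star (graphOp (rot P) S) w)) := rfl
  rw [smul_apply, h9, hb', hb]
  simp only [OrthonormalBasis.coe_toBasis, hg, hadj, ← hb'v, map_sub, map_smul]
  simp

/-- Since `(rot Q)²` has trace `-2` for every oriented plane `Q`, the area factor can be read off
from the trace of the square of `graphSkew`. -/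
theorem rot_graph (P : OrientedPlane V) (S : V →L[ℝ] V) :
    rot (graph P S) = graphRot (rot P) S := by
  obtain ⟨m, hm, h⟩ := exists_rot_graph P S
  have h1 := opTrace_rot_mul_rot (graph P S)
  have h2 : -(1 / 2) * opTrace (graphSkew (rot P) S * graphSkew (rot P) S) = m ^ 2 := by
    rw [h] at h1
    simp only [smul_mul_smul_comm, map_smul, smul_eq_mul] at h1
    field_simp at h1
    linarith
  rw [graphRot, h2, Real.sqrt_sq hm.le, h]

theorem starProjection_mul_one_sub (K : Submodule ℝ V) :
    K.starProjection * (1 - K.starProjection) = 0 := by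
  rw [mul_sub, mul_one, starProjection_mul_self, sub_self]

theorem one_sub_mul_starProjection (K : Submodule ℝ V) :
    (1 - K.starProjection) * K.starProjection = 0 := by
  rw [sub_mul, one_mul, starProjection_mul_self, sub_self]

theorem star_graphOp_mul_rot (P : OrientedPlane V) (S : V →L[ℝ] V) :
    star (graphOp (rot P) S) * rot P = rot P := by
  have h1 : (1 - P.plane.starProjection) * rot P = 0 := by
    rw [sub_mul, one_mul, starProjection_mul_rot, sub_self]
  simp only [graphOp, planeProj_rot, star_add, star_mul, star_sub, star_one, star_starProjection]
  rw [add_mul, starProjection_mul_rot, mul_assoc, mul_assoc, h1, mul_zero, mul_zero, add_zero]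

theorem graphSkew_mul_rot (P : OrientedPlane V) (S : V →L[ℝ] V) :
    graphSkew (rot P) S * rot P = -graphOp (rot P) S := by
  rw [graphSkew, mul_assoc, star_graphOp_mul_rot, mul_assoc,
    show rot P * rot P = -P.plane.starProjection by rw [← planeProj_rot, planeProj, neg_neg],
    mul_neg, graphOp, planeProj_rot, add_mul, mul_assoc _ _ P.plane.starProjection,
    starProjection_mul_self]

theorem opTrace_graphOp (P : OrientedPlane V) (S : V →L[ℝ] V) :
    opTrace (graphOp (rot P) S) = 2 := by
  rw [graphOp, map_add, planeProj_rot, opTrace_starProjection, opTrace_mul_comm, ← mul_assoc,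
    starProjection_mul_one_sub, zero_mul, map_zero, add_zero]

/-- The sign separates a plane from the same plane with opposite orientation. Together with
`graph_graphCoord`, it describes the image of the affine chart as an open condition on operators. -/
theorem opTrace_rot_graph_neg (P : OrientedPlane V) (S : V →L[ℝ] V) :
    opTrace (rot (graph P S) * rot P) < 0 := by
  obtain ⟨m, hm, h⟩ := exists_rot_graph P S
  rw [h, smul_mul_assoc, graphSkew_mul_rot, map_smul, map_neg, opTrace_graphOp, smul_eq_mul]
  have := inv_pos.2 hm
  linarith

/-- For `B = graphOp A S` one has `B† A = A` and `A² = -p`, so `A' A = -B / m`. As `B` has trace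
`2`, the scalar in `graphCoord` cancels the unknown `m`. -/
theorem graphCoord_rot_graph (P : OrientedPlane V) (S : V →L[ℝ] V) :
    graphCoord (rot P) (rot (graph P S)) =
      (1 - P.plane.starProjection) * S * P.plane.starProjection := by
  obtain ⟨m, hm, h⟩ := exists_rot_graph P S
  rw [graphCoord, h, mul_assoc, smul_mul_assoc, graphSkew_mul_rot, map_smul, map_neg,
    opTrace_graphOp, smul_eq_mul, mul_smul_comm, smul_smul,
    show (2 / (m⁻¹ * -2) * m⁻¹ : ℝ) = -1 by field_simp, graphOp, planeProj_rot, mul_neg,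
    mul_add, one_sub_mul_starProjection, zero_add, ← mul_assoc, ← mul_assoc,
    show (1 - P.plane.starProjection) * (1 - P.plane.starProjection) = 1 - P.plane.starProjection by
      rw [sub_mul, one_mul, starProjection_mul_one_sub, sub_zero]]
  simp

/-- The operator `p A' p` is skew on `P`, hence a multiple of `A`, and the trace shows that the
factor is nonzero. So the multiple `(2 / c) A' A` has `P`-component `p`: it is the graph operator of
`S`, and it takes values in `P'`. -/
theorem graph_graphCoord (P P' : OrientedPlane V) (h : opTrace (rot P' * rot P) < 0) :
    graph P (graphCoord (rot P) (rot P')) = P' := by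
  set p := P.plane.starProjection with hp
  set A := rot P with hA
  set A' := rot P' with hA'
  set c := opTrace (A' * A) with hc
  set S := graphCoord A A' with hS
  have hpA : p * A = A := starProjection_mul_rot P
  have hAp : A * p = A := rot_mul_starProjection P
  have hAA : A * A = -p := by rw [hp, ← planeProj_rot, planeProj, neg_neg]
  have hB : graphOp A S = (2 / c) • (A' * A) := by
    obtain ⟨d, hd⟩ := exists_eq_smul_rot P (p * A' * p) (by
      simp only [star_mul, hp, star_starProjection, hA', star_rot, mul_neg, neg_mul, mul_assoc])
      (by rw [← hp, mul_assoc, starProjection_mul_self])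
    have hd2 : c = -2 * d := by
      have h1 : opTrace (p * A' * p * A) = c := by
        rw [mul_assoc, hpA, mul_assoc, opTrace_mul_comm, mul_assoc, hAp]
      rw [← h1, hd, smul_mul_assoc, map_smul, hA, opTrace_rot_mul_rot, smul_eq_mul]
      ring
    have h2 : p * A' * A = -d • p := by
      nth_rewrite 1 [← hpA]
      rw [← mul_assoc, hd, smul_mul_assoc, ← hA, hAA, smul_neg, neg_smul]
    have hSp : (1 - p) * S * p = S := by
      rw [hS, graphCoord, hA, planeProj_rot, ← hp, ← hA, mul_smul_comm, smul_mul_assoc, mul_assoc,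
        mul_assoc, mul_assoc, hAp, ← mul_assoc (1 - p) (1 - p), mul_assoc (1 - p) A']
      congr 2
      rw [sub_mul 1 p, one_mul, hp, starProjection_mul_one_sub, sub_zero]
    have hdc : d ≠ 0 := by rintro rfl; simp at hd2; linarith
    rw [graphOp, hA, planeProj_rot, ← hp, hSp, hS, graphCoord, hA, planeProj_rot, ← hp, ← hA,
      mul_assoc, sub_mul, one_mul, ← mul_assoc, h2, ← hc, hd2, smul_sub, smul_smul,
      show (2 / (-2 * d) * -d : ℝ) = 1 by field_simp]
    simp
  have hle : (graph P S).plane ≤ P'.plane := by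
    rintro _ ⟨x, rfl⟩
    rw [graphMap_apply, ← hA, hB]
    exact P'.plane.smul_mem _ (rot_apply_mem P' _)
  have heq : (graph P S).plane = P'.plane :=
    Submodule.eq_of_le_of_finrank_eq hle (by rw [OrientedPlane.finrank_plane,
      OrientedPlane.finrank_plane])
  apply rot_injective
  obtain ⟨d, hd⟩ := exists_eq_smul_rot P' (rot (graph P S)) (star_rot _) (by
    rw [← heq, rot_mul_starProjection])
  have h1 := opTrace_rot_graph_neg P S
  have h2 := opTrace_rot_mul_rot (graph P S)
  rw [hd, smul_mul_smul_comm, map_smul, opTrace_rot_mul_rot, smul_eq_mul] at h2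
  rw [hd, smul_mul_assoc, map_smul, smul_eq_mul] at h1
  -- The trace of the square gives `d² = 1`; since both traces against `rot P` are negative, `d` is
  -- positive.
  have h3 : d = 1 := by nlinarith
  rw [hd, h3, one_smul]

theorem graphCoord_rot_self (P : OrientedPlane V) : graphCoord (rot P) (rot P) = 0 := by
  rw [graphCoord, planeProj_rot, sub_mul, one_mul, starProjection_mul_rot, sub_self, zero_mul,
    smul_zero]

theorem graphRot_zero (P : OrientedPlane V) : graphRot (rot P) 0 = rot P := by
  have h : graphSkew (rot P) 0 = rot P := by
    rw [graphSkew, graphOp, mul_zero, zero_mul, add_zero, planeProj_rot, star_starProjection,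
      starProjection_mul_rot, rot_mul_starProjection]
  rw [graphRot, h, opTrace_rot_mul_rot]
  norm_num

end GrassmannianAlgebra
end GreatCircle

namespace GreatCircle

/-! ### The complex structure and the conformal barycentre of an endomorphism -/

section ComplexStructure

open Polynomial in
-- Without real roots, the complexified polynomial splits into coprime factors `Mp`, `Mn` carrying
-- the roots in the upper and in the lower half plane, with multiplicity. The polynomial `r` is
-- congruent to `i` modulo `Mp` and to `-i` modulo `Mn`; complex conjugation exchanges these two
-- conditions, which permits real coefficients.
theorem exists_polynomial_sq_add_one (M : ℝ[X]) (hM : M ≠ 0) (hr : ∀ a : ℝ, ¬ M.IsRoot a) :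
    ∃ r : ℝ[X], M ∣ r ^ 2 + 1 ∧
      ∀ z : ℂ, aeval z M = 0 → aeval z r = Complex.I → 0 < z.im := by
  classical
  set Mc : ℂ[X] := M.map (algebraMap ℝ ℂ) with hMc
  have hMc0 : Mc ≠ 0 := by
    rwa [hMc, Ne, Polynomial.map_eq_zero]
  set R := Mc.roots with hR
  set Mp : ℂ[X] := ((R.filter fun z => 0 < z.im).map fun z => X - C z).prod with hMp
  set Mn : ℂ[X] := ((R.filter fun z => ¬ 0 < z.im).map fun z => X - C z).prod with hMn
  have hfac : Mc = C Mc.leadingCoeff * (Mp * Mn) := by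
    rw [hMp, hMn, ← Multiset.prod_add, ← Multiset.map_add, Multiset.filter_add_not]
    exact (IsAlgClosed.splits Mc).eq_prod_roots
  have hlead : IsUnit (C Mc.leadingCoeff) :=
    isUnit_C.2 (isUnit_iff_ne_zero.2 (leadingCoeff_ne_zero.2 hMc0))
  have hroot : ∀ z ∈ R, z.im ≠ 0 := by
    intro z hz him
    have h1 : Mc.IsRoot z := isRoot_of_mem_roots hz
    have h2 : z = algebraMap ℝ ℂ z.re := by
      apply Complex.ext <;> simp [him]
    rw [h2, hMc, IsRoot, eval_map_algebraMap, aeval_algebraMap_apply] at h1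
    exact hr z.re (by simpa using h1)
  have hp0 : ∀ z, eval z Mp = 0 → 0 < z.im := by
    intro z hz
    rw [hMp, eval_multiset_prod, Multiset.prod_eq_zero_iff] at hz
    simp only [Multiset.map_map, Multiset.mem_map, Multiset.mem_filter, Function.comp] at hz
    obtain ⟨w, ⟨_, hw⟩, h⟩ := hz
    simp only [eval_sub, eval_X, eval_C, sub_eq_zero] at h
    rwa [h]
  have hn0 : ∀ z, eval z Mn = 0 → z.im < 0 := by
    intro z hz
    rw [hMn, eval_multiset_prod, Multiset.prod_eq_zero_iff] at hz
    simp only [Multiset.map_map, Multiset.mem_map, Multiset.mem_filter, Function.comp] at hz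
    obtain ⟨w, ⟨hw1, hw⟩, h⟩ := hz
    simp only [eval_sub, eval_X, eval_C, sub_eq_zero] at h
    rw [h]
    exact lt_of_le_of_ne (not_lt.1 hw) (hroot w hw1)
  have hcop : ∀ p q : ℂ[X], (∀ z, eval z p = 0 → eval z q ≠ 0) → IsCoprime p q := by
    intro p q h
    rw [Polynomial.isCoprime_iff_aeval_ne_zero_of_isAlgClosed ℂ ℂ]
    intro z
    by_cases hz : eval z p = 0
    · right; simpa using h z hz
    · left; simpa using hz
  set σ : ℂ[X] →+* ℂ[X] := mapRingHom (starRingEnd ℂ) with hσ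
  have hσσ : ∀ p, σ (σ p) = p := fun p => by
    simp only [hσ, coe_mapRingHom, Polynomial.map_map]
    have : (starRingEnd ℂ).comp (starRingEnd ℂ) = RingHom.id ℂ := by ext z; simp
    rw [this, Polynomial.map_id]
  have hσe : ∀ z p, eval z (σ p) = starRingEnd ℂ (eval (starRingEnd ℂ z) p) := fun z p => by
    simp only [hσ, coe_mapRingHom]
    rw [eval_map, ← eval₂_hom]
    simp
  have hσM : σ Mc = Mc := by
    simp only [hσ, coe_mapRingHom, hMc, Polynomial.map_map]
    congr 1
    ext z
    simp
  have hσp : σ Mp ∣ Mn := by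
    have h1 : IsCoprime (σ Mp) Mp := hcop _ _ fun z hz hz' => by
      rw [hσe, map_eq_zero] at hz
      have := hp0 _ hz
      have := hp0 _ hz'
      simp at *; linarith
    have h2 : σ Mp ∣ Mp * Mn := by
      have h3 : σ Mp ∣ σ Mc := map_dvd σ (by rw [hfac]; exact (dvd_mul_right _ _).mul_left _)
      rw [hσM, hfac] at h3
      exact (hlead.dvd_mul_left).1 h3
    exact h1.dvd_of_dvd_mul_left h2
  have hσn : σ Mn ∣ Mp := by
    have h1 : IsCoprime (σ Mn) Mn := hcop _ _ fun z hz hz' => by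
      rw [hσe, map_eq_zero] at hz
      have := hn0 _ hz
      have := hn0 _ hz'
      simp at *; linarith
    have h2 : σ Mn ∣ Mp * Mn := by
      have h3 : σ Mn ∣ σ Mc := map_dvd σ (by rw [hfac]; exact (dvd_mul_left _ _).mul_left _)
      rw [hσM, hfac] at h3
      exact (hlead.dvd_mul_left).1 h3
    exact h1.dvd_of_dvd_mul_right h2
  have hpσ : Mp ∣ σ Mn := by simpa [hσσ] using map_dvd σ hσp
  have hnσ : Mn ∣ σ Mp := by simpa [hσσ] using map_dvd σ hσn
  obtain ⟨a, b, hab⟩ : IsCoprime Mp Mn := hcop _ _ fun z hz hz' => by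
    have := hp0 _ hz
    have := hn0 _ hz'
    linarith
  -- The Chinese remainder solution, from the Bézout relation `a Mp + b Mn = 1`.
  set r0 : ℂ[X] := C Complex.I * (b * Mn - a * Mp) with hr0
  have h1 : Mp ∣ r0 - C Complex.I := ⟨-2 * C Complex.I * a, by
    have : r0 - C Complex.I = r0 - C Complex.I * (a * Mp + b * Mn) := by rw [hab, mul_one]
    rw [this, hr0]; ring⟩
  have h2 : Mn ∣ r0 + C Complex.I := ⟨2 * C Complex.I * b, by
    have : r0 + C Complex.I = r0 + C Complex.I * (a * Mp + b * Mn) := by rw [hab, mul_one]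
    rw [this, hr0]; ring⟩
  have hσI : σ (C Complex.I) = -C Complex.I := by simp [hσ]
  have h3 : Mp ∣ σ r0 - C Complex.I := by
    have := map_dvd σ h2
    rw [map_add, hσI, ← sub_eq_add_neg] at this
    exact hpσ.trans this
  have h4 : Mn ∣ σ r0 + C Complex.I := by
    have := map_dvd σ h1
    rw [map_sub, hσI, sub_neg_eq_add] at this
    exact hnσ.trans this
  -- The conjugate of `r0` solves the same congruences, so the average of the two is a real
  -- solution.
  obtain ⟨r, hr1⟩ : ∃ r : ℝ[X], r.map (algebraMap ℝ ℂ) = C (1 / 2) * (r0 + σ r0) := by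
    have : C (1 / 2) * (r0 + σ r0) ∈ lifts (algebraMap ℝ ℂ) := by
      rw [lifts_iff_coeff_lifts]
      intro k
      refine ⟨(r0.coeff k).re, ?_⟩
      simp only [hσ, coe_mapRingHom, coeff_C_mul, coeff_add, coeff_map]
      rw [Complex.add_conj]
      simp
    simpa [lifts] using this
  have h5 : Mp ∣ r.map (algebraMap ℝ ℂ) - C Complex.I := by
    have : r.map (algebraMap ℝ ℂ) - C Complex.I =
        C (1 / 2) * ((r0 - C Complex.I) + (σ r0 - C Complex.I)) := by
      rw [hr1]
      have : (C Complex.I : ℂ[X]) = C (1 / 2) * (C Complex.I + C Complex.I) := by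
        rw [← C_add, ← C_mul]; congr 1; ring
      nth_rewrite 1 [this]
      ring
    rw [this]
    exact (dvd_add h1 h3).mul_left _
  have h6 : Mn ∣ r.map (algebraMap ℝ ℂ) + C Complex.I := by
    have : r.map (algebraMap ℝ ℂ) + C Complex.I =
        C (1 / 2) * ((r0 + C Complex.I) + (σ r0 + C Complex.I)) := by
      rw [hr1]
      have : (C Complex.I : ℂ[X]) = C (1 / 2) * (C Complex.I + C Complex.I) := by
        rw [← C_add, ← C_mul]; congr 1; ring
      nth_rewrite 1 [this]
      ring
    rw [this]
    exact (dvd_add h2 h4).mul_left _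
  refine ⟨r, ?_, fun z hz hrz => ?_⟩
  · have h7 : Mc ∣ (r ^ 2 + 1).map (algebraMap ℝ ℂ) := by
      have h8 : (r ^ 2 + 1).map (algebraMap ℝ ℂ) =
          (r.map (algebraMap ℝ ℂ) - C Complex.I) * (r.map (algebraMap ℝ ℂ) + C Complex.I) := by
        have h9 : (C Complex.I : ℂ[X]) * C Complex.I = -1 := by
          rw [← C_mul, Complex.I_mul_I]; simp
        rw [Polynomial.map_add, Polynomial.map_pow, Polynomial.map_one]
        linear_combination h9
      rw [h8, hfac]
      exact (hlead.mul_left_dvd).2 (mul_dvd_mul h5 h6)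
    exact (Polynomial.map_dvd_map' _).1 h7
  · by_contra hz0
    have h7 : eval z Mc = 0 := by rwa [hMc, eval_map_algebraMap]
    rw [hfac, eval_mul, eval_mul, eval_C] at h7
    have h8 : eval z Mn = 0 := by
      rcases mul_eq_zero.1 h7 with h | h
      · exact absurd h (leadingCoeff_ne_zero.2 hMc0)
      · exact (mul_eq_zero.1 h).resolve_left fun h => hz0 (hp0 z h)
    obtain ⟨q, hq⟩ := h6
    have h9 := congrArg (eval z) hq
    rw [eval_mul, h8, zero_mul, eval_add, eval_map_algebraMap, hrz, eval_C] at h9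
    have h10 := congrArg Complex.im h9
    simp at h10

variable {Q : Type*} [AddCommGroup Q] [Module ℝ Q]

open Polynomial in
-- On the `J`-complex line through `q`, `t` is multiplication by `z`, so a polynomial in `t` acts
-- there by its value at `z`.
theorem aeval_apply_of_eigenvector {t J : Q →ₗ[ℝ] Q} (hJ : J ∘ₗ J = -LinearMap.id)
    (hJt : J ∘ₗ t = t ∘ₗ J) {z : ℂ} {q : Q} (h : t q = z.re • q + z.im • J q) (p : ℝ[X]) :
    aeval t p q = (aeval z p).re • q + (aeval z p).im • J q := by
  have hJJ : ∀ x, J (J x) = -x := fun x => LinearMap.congr_fun hJ x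
  have hJt' : ∀ x, t (J x) = J (t x) := fun x => (LinearMap.congr_fun hJt x).symm
  induction p using Polynomial.induction_on with
  | C a => simp [Algebra.algebraMap_eq_smul_one]
  | add p r hp hr => simp only [map_add, LinearMap.add_apply, hp, hr, Complex.add_re,
      Complex.add_im]; module
  | monomial k a ih =>
    have h1 : (C a * X ^ (k + 1) : ℝ[X]) = X * (C a * X ^ k) := by ring
    rw [h1, map_mul (aeval t), map_mul (aeval z), aeval_X, aeval_X, Module.End.mul_apply, ih,
      map_add, map_smul, map_smul, hJt', h, Complex.mul_re, Complex.mul_im, map_add, map_smul,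
      map_smul, hJJ]
    module

variable [FiniteDimensional ℝ Q]

/-- Apply the polynomial for the minimal polynomial of `t` to `t` itself. An eigenvalue `z` of `t`
relative to `J` is a root of the minimal polynomial, and comparing `J = r(t)` with multiplication by
`i` gives `r(z) = i`, so `z` lies in the upper half plane. -/
theorem exists_isComplexStructureOf (t : Q →ₗ[ℝ] Q) (ht : ∀ (a : ℝ) (q : Q), t q = a • q → q = 0) :
    ∃ J, IsComplexStructureOf t J := by
  have hint : IsIntegral ℝ t := Algebra.IsIntegral.isIntegral t
  obtain ⟨r, hr1, hr2⟩ := exists_polynomial_sq_add_one (minpoly ℝ t) (minpoly.ne_zero hint) (by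
    intro a ha
    obtain ⟨q, hq⟩ := (Module.End.hasEigenvalue_of_isRoot ha).exists_hasEigenvector
    exact hq.2 (ht a q hq.apply_eq_smul))
  set J : Q →ₗ[ℝ] Q := Polynomial.aeval t r with hJ
  have hsq : J ∘ₗ J = -LinearMap.id := by
    obtain ⟨w, hw⟩ := hr1
    have h1 : Polynomial.aeval t (r ^ 2 + 1) = 0 := by rw [hw, map_mul, minpoly.aeval, zero_mul]
    rw [map_add, map_pow, map_one, ← hJ] at h1
    exact eq_neg_of_add_eq_zero_left (by rw [← h1, sq]; rfl)
  have hcomm : J ∘ₗ t = t ∘ₗ J := by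
    have h1 := congrArg (Polynomial.aeval t) (mul_comm r Polynomial.X)
    rwa [map_mul, map_mul, Polynomial.aeval_X] at h1
  refine ⟨J, hsq, hcomm, fun a b q hq h => ?_⟩
  have hJJ : ∀ x, J (J x) = -x := fun x => LinearMap.congr_fun hsq x
  have hind : ∀ c d : ℝ, c • q + d • J q = 0 → c = 0 ∧ d = 0 := by
    intro c d hcd
    have h1 : (c ^ 2 + d ^ 2) • q = 0 := by
      have h2 := congrArg J hcd
      rw [map_add, map_smul, map_smul, hJJ, map_zero] at h2
      calc (c ^ 2 + d ^ 2) • q = c • (c • q + d • J q) - d • (c • J q + d • -q) := by module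
        _ = 0 := by rw [hcd, h2]; simp
    have h2 : c ^ 2 + d ^ 2 = 0 := (smul_eq_zero.1 h1).resolve_right hq
    constructor <;> nlinarith [sq_nonneg c, sq_nonneg d]
  have key := aeval_apply_of_eigenvector (z := ⟨a, b⟩) hsq hcomm h
  refine hr2 ⟨a, b⟩ ?_ ?_
  · have h1 := key (minpoly ℝ t)
    rw [minpoly.aeval, LinearMap.zero_apply] at h1
    exact Complex.ext (hind _ _ h1.symm).1 (hind _ _ h1.symm).2
  · have h1 := key r
    rw [← hJ] at h1
    set y := Polynomial.aeval (⟨a, b⟩ : ℂ) r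
    have h2 : y.re • q + (y.im - 1) • J q = 0 := by
      rw [sub_smul, one_smul, ← add_sub_assoc, ← h1, sub_self]
    obtain ⟨h3, h4⟩ := hind _ _ h2
    exact Complex.ext (by simpa using h3) (by simp; linarith)

/-- The inner product `G = 1 + Jᵀ J` is invariant under `J`, so `Jᵀ = -G J G⁻¹` and the trace equals
its own negative. -/
theorem _root_.Matrix.trace_eq_zero_of_mul_self_eq_neg_one {d : ℕ}
    {J : Matrix (Fin d) (Fin d) ℝ} (h : J * J = -1) : J.trace = 0 := by
  open Matrix in
  have hG : IsUnit (1 + Jᵀ * J).det := by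
    have h1 : (1 + Jᵀ * J).PosDef :=
      Matrix.PosDef.one.add_posSemidef (by
        simpa using Matrix.posSemidef_conjTranspose_mul_self J)
    exact isUnit_iff_ne_zero.2 h1.det_pos.ne'
  have hT : Jᵀ * Jᵀ = -1 := by
    rw [← Matrix.transpose_mul, h]; simp
  have h2 : Jᵀ * (1 + Jᵀ * J) = -((1 + Jᵀ * J) * J) := by
    rw [mul_add, add_mul, ← mul_assoc, hT, mul_assoc, h]
    simp
  have h3 : Jᵀ = -((1 + Jᵀ * J) * J * (1 + Jᵀ * J)⁻¹) := by
    rw [← Matrix.neg_mul, ← h2, Matrix.mul_nonsing_inv_cancel_right _ _ hG]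
  have h4 : J.trace = -J.trace := by
    conv_lhs => rw [← Matrix.trace_transpose, h3, Matrix.trace_neg, Matrix.trace_mul_comm,
      ← mul_assoc, Matrix.nonsing_inv_mul _ hG, one_mul]
  linarith

theorem _root_.Matrix.hasDerivAt_det_add_smul {d : ℕ} {A : Matrix (Fin d) (Fin d) ℝ}
    (hA : A.det ≠ 0) (H : Matrix (Fin d) (Fin d) ℝ) :
    HasDerivAt (fun ε : ℝ => (A + ε • H).det) (A.det * (A⁻¹ * H).trace) 0 := by
  have h1 : ∀ ε : ℝ, (A + ε • H).det = A.det * (1 + (A⁻¹ * H).trace * ε +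
      (Matrix.det (1 + (Polynomial.X : Polynomial ℝ) •
        (A⁻¹ * H).map Polynomial.C)).divX.divX.eval ε * ε ^ 2) := fun ε => by
    rw [← Matrix.det_one_add_smul, ← Matrix.det_mul, mul_add, mul_one, Matrix.mul_smul, ← mul_assoc,
      Matrix.mul_nonsing_inv _ (isUnit_iff_ne_zero.2 hA), one_mul]
  rw [funext h1]
  set p := (Matrix.det (1 + (Polynomial.X : Polynomial ℝ) •
        (A⁻¹ * H).map Polynomial.C)).divX.divX
  have h2 := ((((hasDerivAt_id (0 : ℝ)).const_mul (A⁻¹ * H).trace).const_add 1).add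
    ((p.hasDerivAt 0).mul ((hasDerivAt_id (0 : ℝ)).pow 2))).const_mul A.det
  have h3 : A.det * ((A⁻¹ * H).trace * 1 + (Polynomial.eval 0 (Polynomial.derivative p) *
      (id ^ 2 : ℝ → ℝ) 0 + Polynomial.eval 0 p * (((2 : ℕ) : ℝ) * id 0 ^ (2 - 1) * 1))) =
      A.det * (A⁻¹ * H).trace := by simp
  rw [h3] at h2
  exact h2

/-- The conformal barycentre of the eigenvalues of `T`, as a critical point of
`(a, b) ↦ det (T - a + b J) ^ 2 / b ^ d`. -/
theorem _root_.Matrix.exists_trace_inv_eq {d : ℕ} (hd : d ≠ 0) (T J : Matrix (Fin d) (Fin d) ℝ)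
    (h : ∀ w a b : ℝ, 0 ≤ w → 0 ≤ b → w ^ 2 + a ^ 2 + b ^ 2 ≠ 0 → (w • T - a • 1 + b • J).det ≠ 0) :
    ∃ a b : ℝ, 0 < b ∧ (T - a • 1 + b • J)⁻¹.trace = 0 ∧
      ((T - a • 1 + b • J)⁻¹ * J).trace = d / (2 * b) := by
  set D : ℝ × ℝ × ℝ → ℝ := fun x =>
    (x.1 • T - x.2.1 • (1 : Matrix (Fin d) (Fin d) ℝ) + x.2.2 • J).det
    with hD
  -- Homogenizing `(a, b)` to `(w, a, b)` compactifies the half plane `b > 0`: it becomes the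
  -- interior of a quarter sphere, and the hypothesis excludes zeros of `D` on the boundary as well.
  set K : Set (ℝ × ℝ × ℝ) := {x | 0 ≤ x.1 ∧ 0 ≤ x.2.2 ∧ x.1 ^ 2 + x.2.1 ^ 2 + x.2.2 ^ 2 = 1} with hK
  have hDc : Continuous D := by
    refine Continuous.matrix_det ?_
    fun_prop
  have hDh : ∀ (c : ℝ) x, D (c • x) = c ^ d * D x := fun c x => by
    have : D (c • x) =
        (c • (x.1 • T - x.2.1 • (1 : Matrix (Fin d) (Fin d) ℝ) + x.2.2 • J)).det := by
      simp only [hD]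
      congr 1
      simp only [Prod.smul_fst, Prod.smul_snd, smul_eq_mul]
      module
    rw [this, Matrix.det_smul, Fintype.card_fin]
  have hKD : ∀ x ∈ K, D x ≠ 0 := fun x hx => h _ _ _ hx.1 hx.2.1 (by rw [hx.2.2]; norm_num)
  have hKc : IsCompact K := by
    refine Metric.isCompact_of_isClosed_isBounded ?_ ?_
    · have h1 : IsClosed {x : ℝ × ℝ × ℝ | 0 ≤ x.1} := isClosed_le (by fun_prop) (by fun_prop)
      have h2 : IsClosed {x : ℝ × ℝ × ℝ | 0 ≤ x.2.2} := isClosed_le (by fun_prop) (by fun_prop)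
      have h3 : IsClosed {x : ℝ × ℝ × ℝ | x.1 ^ 2 + x.2.1 ^ 2 + x.2.2 ^ 2 = 1} :=
        isClosed_eq (by fun_prop) (by fun_prop)
      exact h1.inter (h2.inter h3)
    · refine (Metric.isBounded_closedBall (x := (0 : ℝ × ℝ × ℝ)) (r := 1)).subset fun x hx => ?_
      obtain ⟨h1, h2, h3⟩ := hx
      rw [mem_closedBall_zero_iff, Prod.norm_def, Prod.norm_def]
      simp only [Real.norm_eq_abs, sup_le_iff]
      refine ⟨?_, ?_, ?_⟩ <;> rw [← sq_le_one_iff_abs_le_one] <;> nlinarith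
  -- Homogeneous of degree zero, equal to `b ^ d / det ^ 2` at `w = 1`. It vanishes for `w b = 0`
  -- because `d ≠ 0`, so its maximum is attained in the interior.
  set f : ℝ × ℝ × ℝ → ℝ := fun x => (x.1 * x.2.2) ^ d / D x ^ 2 with hf
  have hfc : ContinuousOn f K := by
    refine ContinuousOn.div (by fun_prop) (by fun_prop) fun x hx => pow_ne_zero 2 (hKD x hx)
  have hfh : ∀ c : ℝ, 0 < c → ∀ x, f (c • x) = f x := fun c hc x => by
    simp only [hf, hDh, Prod.smul_fst, Prod.smul_snd, smul_eq_mul]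
    rw [show (c * x.1 * (c * x.2.2)) ^ d = (c ^ d) ^ 2 * (x.1 * x.2.2) ^ d by ring,
      mul_pow (c ^ d)]
    exact mul_div_mul_left _ _ (by positivity)
  have hscale : ∀ a b : ℝ, 0 < b → ∃ c : ℝ, 0 < c ∧ c • ((1, a, b) : ℝ × ℝ × ℝ) ∈ K := by
    intro a b hb
    refine ⟨(√(1 + a ^ 2 + b ^ 2))⁻¹, by positivity, ?_, ?_, ?_⟩
    · simp
    · simp only [Prod.smul_snd, smul_eq_mul]; positivity
    · simp only [Prod.smul_fst, Prod.smul_snd, smul_eq_mul, mul_pow, inv_pow]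
      rw [Real.sq_sqrt (by positivity)]
      field_simp
  obtain ⟨c1, hc1, hc1K⟩ := hscale 0 1 one_pos
  obtain ⟨⟨w, a', b'⟩, hxK, hmax⟩ := hKc.exists_isMaxOn ⟨_, hc1K⟩ hfc
  have hmax' : ∀ a b : ℝ, 0 < b → f (1, a, b) ≤ f (w, a', b') := fun a b hb => by
    obtain ⟨c, hc, hcK⟩ := hscale a b hb
    rw [← hfh c hc]
    exact hmax hcK
  have hpos : ∀ a b : ℝ, 0 < b → D (1, a, b) ≠ 0 := fun a b hb =>
    h 1 a b zero_le_one hb.le (by positivity)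
  have hfpos : 0 < f (w, a', b') := by
    refine lt_of_lt_of_le ?_ (hmax' 0 1 one_pos)
    have := hpos 0 1 one_pos
    simp only [hf]
    positivity
  have hwb : w * b' ≠ 0 := fun h0 => by
    simp only [hf, h0, zero_pow hd, zero_div, lt_irrefl] at hfpos
  have hw : 0 < w := lt_of_le_of_ne hxK.1 (by rintro rfl; simp at hwb)
  have hb' : 0 < b' := lt_of_le_of_ne hxK.2.1 (by rintro h0; apply hwb; rw [← h0]; simp)
  set a := a' / w
  set b := b' / w
  have hb : 0 < b := div_pos hb' hw
  have hfab : f (w, a', b') = f (1, a, b) := by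
    rw [← hfh w hw (1, a, b)]
    congr 1
    simp only [a, b, Prod.smul_mk, smul_eq_mul]
    field_simp
  rw [hfab] at hmax'
  have hD0 := hpos a b hb
  have hD0' : D (1, a, b) = (T - a • 1 + b • J).det := by simp [hD]
  set A := T - a • (1 : Matrix (Fin d) (Fin d) ℝ) + b • J with hA
  -- The maximum with denominators cleared. Stationarity in `a` will give the first trace condition,
  -- stationarity in `b` the second.
  have hineq : ∀ a1 b1 : ℝ, 0 < b1 → b1 ^ d * A.det ^ 2 ≤ b ^ d * D (1, a1, b1) ^ 2 := by
    intro a1 b1 hb1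
    have h1 := hmax' a1 b1 hb1
    have h2 := hpos a1 b1 hb1
    simp only [hf, one_mul] at h1
    rw [div_le_div_iff₀ (by positivity) (by positivity), hD0'] at h1
    exact h1
  rw [hD0'] at hD0
  refine ⟨a, b, hb, ?_, ?_⟩
  · have h1 := (Matrix.hasDerivAt_det_add_smul hD0 (-1)).pow 2
    have h2 : IsLocalMin (fun ε : ℝ => (A + ε • (-1 : Matrix (Fin d) (Fin d) ℝ)).det ^ 2) 0 := by
      refine Filter.Eventually.of_forall fun ε => ?_
      have h3 := hineq (a + ε) b hb
      have h4 : D (1, a + ε, b) = (A + ε • (-1 : Matrix (Fin d) (Fin d) ℝ)).det := by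
        simp only [hD, hA]
        congr 1
        module
      rw [h4] at h3
      have h5 : 0 < b ^ d := by positivity
      simpa using le_of_mul_le_mul_left h3 h5
    have h3 := h2.hasDerivAt_eq_zero h1
    simpa [hD0] using h3
  · have h1 := (((Matrix.hasDerivAt_det_add_smul hD0 J).pow 2).const_mul (b ^ d)).sub
      ((((hasDerivAt_id (0 : ℝ)).const_add b).pow d).mul_const (A.det ^ 2))
    have h2 : IsLocalMin
        (fun ε : ℝ => b ^ d * (A + ε • J).det ^ 2 - (b + ε) ^ d * A.det ^ 2) 0 := by
      have h6 : ∀ᶠ ε in 𝓝 (0 : ℝ), 0 < b + ε := by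
        have : Filter.Tendsto (fun ε : ℝ => b + ε) (𝓝 0) (𝓝 (b + 0)) :=
          (continuous_const.add continuous_id).tendsto 0
        rw [add_zero] at this
        exact this.eventually (lt_mem_nhds hb)
      filter_upwards [h6] with ε hε
      have h3 := hineq a (b + ε) hε
      have h4 : D (1, a, b + ε) = (A + ε • J).det := by
        simp only [hD, hA]
        congr 1
        module
      rw [h4] at h3
      simp only [zero_smul, add_zero, sub_self]
      linarith
    have h3 := h2.hasDerivAt_eq_zero h1
    simp only [zero_smul, add_zero, id, mul_one] at h3
    obtain ⟨k, rfl⟩ := Nat.exists_eq_succ_of_ne_zero hd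
    simp only [Nat.succ_eq_add_one, Nat.add_sub_cancel] at h3
    have h5 : (b ^ k * A.det ^ 2) * (2 * b * (A⁻¹ * J).trace - (k + 1 : ℕ)) = 0 := by
      rw [← h3]; push_cast; ring
    have h6 : (b ^ k * A.det ^ 2) ≠ 0 := by positivity
    have h7 := (mul_eq_zero.1 h5).resolve_left h6
    rw [eq_div_iff (by positivity)]
    linarith

end ComplexStructure
end GreatCircle

namespace GreatCircle

/-! ### Elliptic subspaces of `Lin(P, Q)` and their adapted complex structures -/

section Osculation

variable {P : Type*} [AddCommGroup P] [Module ℝ P]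
variable {Q : Type*} [AddCommGroup Q] [Module ℝ Q]

namespace IsComplexStructureOf

variable {t J : Q →ₗ[ℝ] Q} (h : IsComplexStructureOf t J)
include h

theorem apply_apply (q : Q) : J (J q) = -q := LinearMap.congr_fun h.sq q

/-- For `w > 0`, a nonzero solution would be an eigenvector of `t` with imaginary part `-b / w ≤ 0`;
for `w = 0`, the operator `-a + b J` is invertible. -/
theorem eq_zero_of_smul {w a b : ℝ} (hw : 0 ≤ w) (hb : 0 ≤ b) (h0 : w ^ 2 + a ^ 2 + b ^ 2 ≠ 0)
    {q : Q} (hq : w • t q - a • q + b • J q = 0) : q = 0 := by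
  by_contra hq0
  rcases hw.eq_or_lt with rfl | hw
  · have h1 : (a ^ 2 + b ^ 2) • q = 0 := by
      have h2 := congrArg J hq
      simp only [zero_smul, zero_sub, map_add, map_neg, map_smul, map_zero, h.apply_apply] at h2 hq
      calc (a ^ 2 + b ^ 2) • q = -(a • (-(a • q) + b • J q)) - b • (-(a • J q) + b • -q) := by
            module
        _ = 0 := by rw [h2, hq]; simp
    have := (smul_eq_zero.1 h1).resolve_right hq0
    apply h0; linarith
  · have h1 : t q = (a / w) • q + (-(b / w)) • J q := by
      have h2 : t q = w⁻¹ • (w • t q) := by rw [smul_smul, inv_mul_cancel₀ hw.ne', one_smul]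
      have h3 : w • t q = a • q - b • J q := by
        rw [← sub_eq_zero, ← hq]; abel
      rw [h2, h3, div_eq_inv_mul, div_eq_inv_mul]
      module
    have h2 := h.pos _ _ q hq0 h1
    have : 0 ≤ b / w := by positivity
    linarith

theorem affine {a b : ℝ} (hb : 0 < b) :
    IsComplexStructureOf (b⁻¹ • (t - a • LinearMap.id)) J where
  sq := h.sq
  comm := by
    rw [LinearMap.comp_smul, LinearMap.smul_comp, LinearMap.comp_sub, LinearMap.sub_comp, h.comm,
      LinearMap.comp_smul, LinearMap.smul_comp, LinearMap.comp_id, LinearMap.id_comp]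
  pos c d q hq hc := by
    have h1 : t q = (b * c + a) • q + (b * d) • J q := by
      have h2 : t q = b • (b⁻¹ • (t - a • LinearMap.id) : Q →ₗ[ℝ] Q) q + a • q := by
        simp [smul_smul, mul_inv_cancel₀ hb.ne']
      rw [h2, hc]
      module
    exact pos_of_mul_pos_right (h.pos _ _ q hq h1) hb.le

/-- In complex terms, `-i` is not an eigenvalue of `t`. Both isomorphisms attached to an osculating
pair rest on this. -/
theorem injective_add : Function.Injective (t + J) := by
  refine (injective_iff_map_eq_zero (t + J)).2 fun q hq => ?_
  refine h.eq_zero_of_smul (w := 1) (a := 0) (b := 1) zero_le_one zero_le_one (by norm_num) ?_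
  simpa using hq

variable [FiniteDimensional ℝ Q]

theorem surjective_add : Function.Surjective (t + J) :=
  LinearMap.injective_iff_surjective.1 h.injective_add

theorem trace_eq_zero : LinearMap.trace ℝ Q J = 0 := by
  set b := Module.finBasis ℝ Q
  rw [LinearMap.trace_eq_matrix_trace ℝ b]
  apply Matrix.trace_eq_zero_of_mul_self_eq_neg_one
  rw [← LinearMap.toMatrix_comp, h.sq, map_neg, LinearMap.toMatrix_id]

/-- The normalization of an adapted basis of the plane, in terms of the endomorphism `t`. -/
theorem exists_normalization : ∃ (a b : ℝ) (s : Q →ₗ[ℝ] Q), 0 < b ∧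
    s ∘ₗ (b⁻¹ • (t - a • LinearMap.id) + J) =
      J ∘ₗ (b⁻¹ • (t - a • LinearMap.id)) + LinearMap.id ∧
    LinearMap.trace ℝ Q s = 0 ∧ LinearMap.trace ℝ Q (J ∘ₗ s) = 0 := by
  by_cases hd : Module.finrank ℝ Q = 0
  · have : Subsingleton Q := Module.finrank_zero_iff.1 hd
    refine ⟨0, 1, 0, one_pos, ?_, by simp, by simp⟩
    ext q
    exact Subsingleton.elim _ _
  set e := Module.finBasis ℝ Q
  set T := LinearMap.toMatrix e e t with hT
  set M := LinearMap.toMatrix e e J with hM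
  have hmat : ∀ w a b : ℝ, w • T - a • 1 + b • M =
      LinearMap.toMatrix e e (w • t - a • LinearMap.id + b • J) := fun w a b => by
    simp [hT, hM]
  obtain ⟨a, b, hb, h1, h2⟩ := Matrix.exists_trace_inv_eq hd T M (fun w a b hw hb h0 => by
    rw [hmat, LinearMap.det_toMatrix]
    have hinj : Function.Injective (w • t - a • LinearMap.id + b • J : Q →ₗ[ℝ] Q) :=
      (injective_iff_map_eq_zero _).2 fun q hq => h.eq_zero_of_smul hw hb h0 hq
    intro hdet
    exact (LinearMap.bot_lt_ker_of_det_eq_zero hdet).ne' (LinearMap.ker_eq_bot.2 hinj))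
  set A := T - a • (1 : Matrix _ _ ℝ) + b • M with hA
  set t' := b⁻¹ • (t - a • LinearMap.id) with ht'
  have hA' : A = LinearMap.toMatrix e e (b • (t' + J)) := by
    have h3 := hmat 1 a b
    rw [one_smul, ← hA] at h3
    rw [h3, ht', smul_add, smul_smul, mul_inv_cancel₀ hb.ne', one_smul, one_smul]
  set E : Q ≃ₗ[ℝ] Q := LinearEquiv.ofBijective (t' + J)
    ⟨(h.affine hb).injective_add, (h.affine hb).surjective_add⟩ with hE
  set B : Q →ₗ[ℝ] Q := E.symm.toLinearMap with hB
  have hBE : B ∘ₗ (t' + J) = LinearMap.id := by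
    ext q
    exact E.symm_apply_apply q
  have hBA : A⁻¹ = LinearMap.toMatrix e e (b⁻¹ • B) := by
    apply Matrix.inv_eq_left_inv
    rw [hA', ← LinearMap.toMatrix_comp, LinearMap.smul_comp, LinearMap.comp_smul, hBE, smul_smul,
      inv_mul_cancel₀ hb.ne', one_smul, LinearMap.toMatrix_id]
  have htrB : LinearMap.trace ℝ Q B = 0 := by
    have h3 : LinearMap.trace ℝ Q (b⁻¹ • B) = 0 := by
      rw [LinearMap.trace_eq_matrix_trace ℝ e, ← hBA, h1]
    rw [map_smul, smul_eq_mul] at h3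
    exact (mul_eq_zero.1 h3).resolve_left (inv_ne_zero hb.ne')
  have htrBJ : LinearMap.trace ℝ Q (J ∘ₗ B) = Module.finrank ℝ Q / 2 := by
    have h3 : LinearMap.trace ℝ Q ((b⁻¹ • B) ∘ₗ J) = Module.finrank ℝ Q / (2 * b) := by
      rw [LinearMap.trace_eq_matrix_trace ℝ e, LinearMap.toMatrix_comp e e e, ← hBA, h2]
    rw [LinearMap.smul_comp, map_smul, smul_eq_mul, LinearMap.trace_comp_comm'] at h3
    field_simp at h3
    linarith
  -- With `B` the inverse of `t' + J`, the identity `J t' + 1 = J (t' + J) + 2` gives `s = J + 2 B`.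
  -- The two traces of `s` then vanish because `B` has trace `0` and `J B` has trace half the real
  -- dimension.
  refine ⟨a, b, J + (2 : ℝ) • B, hb, ?_, ?_, ?_⟩
  · rw [LinearMap.add_comp, LinearMap.smul_comp, hBE, LinearMap.comp_add, h.sq, two_smul]
    abel
  · rw [map_add, map_smul, htrB, h.trace_eq_zero, smul_zero, add_zero]
  · rw [LinearMap.comp_add, h.sq, LinearMap.comp_smul, map_add, map_smul, htrBJ, map_neg,
      LinearMap.trace_id, smul_eq_mul]
    ring

end IsComplexStructureOf

/-- A subspace `U` of `Lin(P, Q)` such that evaluation at every nonzero vector of the plane `P` is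
an isomorphism `U ≅ Q`. -/
structure IsElliptic (U : Submodule ℝ (P →ₗ[ℝ] Q)) : Prop where
  eq_zero : ∀ u ∈ U, ∀ p : P, p ≠ 0 → u p = 0 → u = 0
  finrank_eq : Module.finrank ℝ U = Module.finrank ℝ Q

variable [FiniteDimensional ℝ Q]

/-- Evaluation at `e₀` identifies `U` with `Q`, and `t` is evaluation at `e₁` under this
identification. A real eigenvector with eigenvalue `a` would be an element of `U` vanishing at `e₁ -
a e₀`. -/
theorem IsElliptic.exists_endomorphism {U : Submodule ℝ (P →ₗ[ℝ] Q)} (hU : IsElliptic U)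
    (e : Module.Basis (Fin 2) ℝ P) : ∃ t : Q →ₗ[ℝ] Q,
      (∀ u : P →ₗ[ℝ] Q, u ∈ U ↔ u (e 1) = t (u (e 0))) ∧
      ∀ (a : ℝ) (q : Q), t q = a • q → q = 0 := by
  let ev : P → U →ₗ[ℝ] Q := fun p => LinearMap.applyₗ p ∘ₗ U.subtype
  have hinj : Function.Injective (ev (e 0)) :=
    (injective_iff_map_eq_zero _).2 fun u hu =>
      Subtype.ext (hU.eq_zero u u.2 (e 0) (e.ne_zero 0) hu)
  set E : U ≃ₗ[ℝ] Q := LinearEquiv.ofInjectiveOfFinrankEq _ hinj hU.finrank_eq with hE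
  have hEa : ∀ u : U, E u = (u : P →ₗ[ℝ] Q) (e 0) := fun u => rfl
  have hEs : ∀ q, (E.symm q : P →ₗ[ℝ] Q) (e 0) = q := fun q => by
    rw [← hEa, E.apply_symm_apply]
  refine ⟨ev (e 1) ∘ₗ E.symm, fun u => ⟨fun hu => ?_, fun hu => ?_⟩, fun a q hq => ?_⟩
  · have h1 : E.symm (u (e 0)) = ⟨u, hu⟩ := by
      rw [LinearEquiv.symm_apply_eq]; rfl
    show _ = (E.symm (u (e 0)) : P →ₗ[ℝ] Q) (e 1)
    rw [h1]
  · have h1 : u = (E.symm (u (e 0)) : P →ₗ[ℝ] Q) := by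
      refine e.ext fun i => ?_
      fin_cases i
      · exact (hEs _).symm
      · exact hu
    rw [h1]
    exact (E.symm (u (e 0))).2
  · have h1 : (E.symm q : P →ₗ[ℝ] Q) (e 1 - a • e 0) = 0 := by
      rw [map_sub, map_smul, hEs]
      exact sub_eq_zero.2 hq
    have h2 : e 1 - a • e 0 ≠ 0 := by
      intro h0
      have h3 := congrArg (fun x => e.repr x 1) h0
      simp at h3
    have h3 := hU.eq_zero _ (E.symm q).2 _ h2 h1
    rw [← hEs q, h3, LinearMap.zero_apply]

/-- This change of basis replaces `t` by `b⁻¹ (t - a)`, which is the freedom used for the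
normalization. -/
theorem exists_basis_affine (e : Module.Basis (Fin 2) ℝ P) (a : ℝ) {b : ℝ} (hb : 0 < b) :
    ∃ e' : Module.Basis (Fin 2) ℝ P, e'.orientation = e.orientation ∧ e' 0 = e 0 ∧
      e' 1 = b⁻¹ • (e 1 - a • e 0) := by
  have hdet : e.det ![e 0, b⁻¹ • (e 1 - a • e 0)] = b⁻¹ := by
    rw [Module.Basis.det_apply, Matrix.det_fin_two]
    simp [Module.Basis.toMatrix_apply]
  obtain ⟨h1, h2⟩ := (Module.Basis.is_basis_iff_det e).2
    (by rw [hdet]; exact (inv_ne_zero hb.ne').isUnit)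
  refine ⟨Module.Basis.mk h1 h2.ge, ?_, by simp, by simp⟩
  rw [eq_comm, Module.Basis.orientation_eq_iff_det_pos, Module.Basis.coe_mk, hdet]
  positivity

theorem IsElliptic.exists_isOsculating (hP : Module.finrank ℝ P = 2)
    {U : Submodule ℝ (P →ₗ[ℝ] Q)} (hU : IsElliptic U) (o : Orientation ℝ P (Fin 2)) :
    ∃ j J, IsOsculating o U j J := by
  have : FiniteDimensional ℝ P := Module.finite_of_finrank_pos (by omega)
  have hP' : Fintype.card (Fin 2) = Module.finrank ℝ P := by simp [hP]
  obtain ⟨e, he⟩ : ∃ e : Module.Basis (Fin 2) ℝ P, e.orientation = o :=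
    ⟨_, o.someBasis_orientation hP'⟩
  obtain ⟨t, ht, ht0⟩ := hU.exists_endomorphism e
  obtain ⟨J, hJ⟩ := exists_isComplexStructureOf t ht0
  obtain ⟨a, b, s, hb, h1, h2, h3⟩ := hJ.exists_normalization
  obtain ⟨e', he', he0, he1⟩ := exists_basis_affine e a hb
  refine ⟨e'.constr ℝ ![e' 1, -e' 0], J, e', _, s, he'.trans he, by simp, by simp, fun u => ?_,
    hJ.affine hb, h1, h2, h3⟩
  rw [ht, he0, he1, map_smul, map_sub, map_smul, LinearMap.smul_apply, LinearMap.sub_apply,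
    LinearMap.smul_apply, LinearMap.id_apply]
  exact ⟨fun h => by rw [h], fun h => by
    simpa using smul_right_injective Q (inv_ne_zero hb.ne') h⟩

variable {o : Orientation ℝ P (Fin 2)} {U : Submodule ℝ (P →ₗ[ℝ] Q)}
  {j : P →ₗ[ℝ] P} {J : Q →ₗ[ℝ] Q}

/-- At `e₀` the complex linear part of `u ∈ U` has the value `-½ J (t + J) (u e₀)`. Elements of `U`
and complex linear maps are both determined by their values at `e₀`, so the claim is the
invertibility of `t + J`. -/
theorem IsOsculating.bijOn_complexLinear (h : IsOsculating o U j J) :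
    Set.BijOn (fun u => (1 / 2 : ℝ) • (u - J ∘ₗ u ∘ₗ j)) U (complexLinear j J) := by
  obtain ⟨e, t, s, he, hj0, hj1, hU, hJ, -, -, -⟩ := h
  have hjj : ∀ x, j (j x) = -x := fun x => by
    have : j ∘ₗ j = -LinearMap.id := e.ext fun i => by
      fin_cases i <;> simp [hj0, hj1]
    exact LinearMap.congr_fun this x
  have hval : ∀ u ∈ U, ((1 / 2 : ℝ) • (u - J ∘ₗ u ∘ₗ j)) (e 0) =
      -((1 / 2 : ℝ) • J ((t + J) (u (e 0)))) := fun u hu => by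
    simp only [LinearMap.smul_apply, LinearMap.sub_apply, LinearMap.comp_apply, hj0, (hU u).1 hu,
      LinearMap.add_apply, map_add, hJ.apply_apply]
    module
  have hJinj : ∀ x y, J x = J y → x = y := fun x y hxy => by
    have := congrArg J hxy
    rwa [hJ.apply_apply, hJ.apply_apply, neg_inj] at this
  refine ⟨fun u _ => ?_, fun u hu v hv huv => ?_, fun v hv => ?_⟩
  · show ((1 / 2 : ℝ) • (u - J ∘ₗ u ∘ₗ j)) ∘ₗ j = J ∘ₗ ((1 / 2 : ℝ) • (u - J ∘ₗ u ∘ₗ j))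
    ext x
    simp only [LinearMap.smul_apply, LinearMap.sub_apply, LinearMap.comp_apply, hjj, map_sub,
      map_smul, map_neg, hJ.apply_apply]
    module
  · have h1 := LinearMap.congr_fun huv (e 0)
    simp only at h1
    rw [hval u hu, hval v hv, neg_inj] at h1
    have h2 : u (e 0) = v (e 0) :=
      hJ.injective_add (hJinj _ _ (smul_right_injective Q (by norm_num : (1 / 2 : ℝ) ≠ 0) h1))
    refine e.ext fun i => ?_
    fin_cases i
    · exact h2
    · show u (e 1) = v (e 1)
      rw [(hU u).1 hu, (hU v).1 hv, h2]
  · obtain ⟨q, hq⟩ := hJ.surjective_add ((2 : ℝ) • J (v (e 0)))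
    refine ⟨e.constr ℝ ![q, t q], (hU _).2 (by simp), ?_⟩
    have hu : e.constr ℝ ![q, t q] ∈ U := (hU _).2 (by simp)
    have h0 : ((1 / 2 : ℝ) • (e.constr ℝ ![q, t q] - J ∘ₗ (e.constr ℝ ![q, t q]) ∘ₗ j)) (e 0) =
        v (e 0) := by
      rw [hval _ hu]
      have : (e.constr ℝ ![q, t q]) (e 0) = q := by simp
      rw [this, hq, map_smul, hJ.apply_apply]
      module
    refine e.ext fun i => ?_
    fin_cases i
    · exact h0
    · have h3 : v (e 1) = J (v (e 0)) := by
        rw [← hj0]; exact LinearMap.congr_fun hv (e 0)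
      have hq0 : (e.constr ℝ ![q, t q]) (e 0) = q := by simp
      have hq1 : (e.constr ℝ ![q, t q]) (e 1) = t q := by simp
      show ((1 / 2 : ℝ) • (e.constr ℝ ![q, t q] - J ∘ₗ (e.constr ℝ ![q, t q]) ∘ₗ j)) (e 1) =
        v (e 1)
      rw [h3, ← h0]
      simp only [LinearMap.smul_apply, LinearMap.sub_apply, LinearMap.comp_apply, hj0, hj1,
        map_neg, hq0, hq1, map_smul, map_sub, hJ.apply_apply]
      module

/-- A conjugate linear `u` has `u e₁ = -J (u e₀)`, so it lies in `U` exactly when `(t + J) (u e₀) =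
0`. For surjectivity, the conjugate linear representative of a class is found by solving one
equation for `t + J`. -/
theorem IsOsculating.bijective_conjLinear (h : IsOsculating o U j J) :
    Function.Bijective (fun u : conjLinear j J => U.mkQ u) := by
  obtain ⟨e, t, s, he, hj0, hj1, hU, hJ, -, -, -⟩ := h
  have hconj : ∀ u ∈ conjLinear j J, u (e 1) = -J (u (e 0)) := fun u hu => by
    rw [← hj0]; exact LinearMap.congr_fun hu (e 0)
  constructor
  · intro u v huv
    have h1 : (u - v : P →ₗ[ℝ] Q) ∈ U := (Submodule.Quotient.eq U).1 huv
    have h2 := hconj _ (Submodule.sub_mem _ u.2 v.2)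
    rw [hU, h2] at h1
    have h3 : (t + J) ((u - v : P →ₗ[ℝ] Q) (e 0)) = (t + J) 0 := by
      rw [LinearMap.add_apply, ← h1, neg_add_cancel, map_zero]
    have h4 := hJ.injective_add h3
    refine Subtype.ext (sub_eq_zero.1 (e.ext fun i => ?_))
    fin_cases i
    · exact h4
    · show (u - v : P →ₗ[ℝ] Q) (e 1) = 0
      rw [h2, h4, map_zero, neg_zero]
  · intro y
    obtain ⟨u, rfl⟩ := U.mkQ_surjective y
    obtain ⟨q, hq⟩ := hJ.surjective_add (t (u (e 0)) - u (e 1))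
    have hv : e.constr ℝ ![q, -J q] ∈ conjLinear j J := by
      show (e.constr ℝ ![q, -J q]) ∘ₗ j = -(J ∘ₗ (e.constr ℝ ![q, -J q]))
      refine e.ext fun i => ?_
      fin_cases i
      · simp [hj0]
      · simp [hj1, hJ.apply_apply]
    refine ⟨⟨_, hv⟩, (Submodule.Quotient.eq U).2 ((hU _).2 ?_)⟩
    have h1 : t q + J q = t (u (e 0)) - u (e 1) := hq
    simp only [LinearMap.sub_apply, Module.Basis.constr_basis, Matrix.cons_val_zero,
      Matrix.cons_val_one, map_sub]
    rw [← sub_eq_zero]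
    calc -J q - u (e 1) - (t q - t (u (e 0))) = (t (u (e 0)) - u (e 1)) - (t q + J q) := by abel
      _ = 0 := by rw [h1, sub_self]

end Osculation
end GreatCircle

set_option linter.unusedSectionVars false

namespace GreatCircle

/-! ### Radial projection to the unit sphere -/

section Radial

variable {V : Type v} [NormedAddCommGroup V] [InnerProductSpace ℝ V] [Nontrivial V]

open Classical in
/-- The point of the unit sphere in the direction of `v`. -/
noncomputable def unitVec (v : V) : Metric.sphere (0 : V) 1 :=
  if h : v = 0 then
    ⟨_, ((NormedSpace.sphere_nonempty (x := (0 : V)) (r := 1)).2 zero_le_one).some_mem⟩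
  else ⟨‖v‖⁻¹ • v, by
    rw [mem_sphere_zero_iff_norm, norm_smul, norm_inv, norm_norm,
      inv_mul_cancel₀ (norm_ne_zero_iff.2 h)]⟩

theorem coe_unitVec {v : V} (h : v ≠ 0) : (unitVec v : V) = ‖v‖⁻¹ • v := by
  rw [unitVec, dif_neg h]

theorem unitVec_coe (p : Metric.sphere (0 : V) 1) : unitVec (p : V) = p := by
  have h : ‖(p : V)‖ = 1 := mem_sphere_zero_iff_norm.1 p.2
  have h0 : (p : V) ≠ 0 := norm_ne_zero_iff.1 (by rw [h]; exact one_ne_zero)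
  exact Subtype.ext (by rw [coe_unitVec h0, h, inv_one, one_smul])

theorem unitVec_smul {c : ℝ} (hc : 0 < c) {v : V} (h : v ≠ 0) : unitVec (c • v) = unitVec v := by
  refine Subtype.ext ?_
  rw [coe_unitVec h, coe_unitVec (smul_ne_zero hc.ne' h), norm_smul, Real.norm_of_nonneg hc.le,
    smul_smul]
  congr 1
  field_simp

theorem unitVec_mem {K : Submodule ℝ V} {v : V} (h : v ≠ 0) : (unitVec v : V) ∈ K ↔ v ∈ K := by
  rw [coe_unitVec h]
  exact K.smul_mem_iff (inv_ne_zero (norm_ne_zero_iff.2 h))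

theorem sphere_coe_ne_zero (p : Metric.sphere (0 : V) 1) : (p : V) ≠ 0 :=
  ne_zero_of_mem_unit_sphere p

theorem contMDiffAt_unitVec {m : ℕ} [Fact (Module.finrank ℝ V = m + 1)] {k : WithTop ℕ∞}
    {v : V} (h : v ≠ 0) : ContMDiffAt 𝓘(ℝ, V) (𝓡 m) k unitVec v := by
  let U : TopologicalSpace.Opens V := ⟨{0}ᶜ, isOpen_compl_singleton⟩
  have h1 : ContMDiff 𝓘(ℝ, V) 𝓘(ℝ, V) k (fun u : U => ‖(u : V)‖⁻¹ • (u : V)) := by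
    intro u
    have hu : (u : V) ≠ 0 := u.2
    have h2 : ContDiffAt ℝ k (fun w : V => ‖w‖⁻¹ • w) (u : V) :=
      ((contDiffAt_norm ℝ hu).inv (norm_ne_zero_iff.2 hu)).smul contDiffAt_id
    exact (contMDiffAt_subtype_iff (U := U) (f := fun w : V => ‖w‖⁻¹ • w)).2 h2.contMDiffAt
  have h3 := h1.codRestrict_sphere (n := m) (fun u => by
    have hu : (u : V) ≠ 0 := u.2
    rw [← coe_unitVec hu]
    exact (unitVec (u : V)).2)
  have h4 : ContMDiff 𝓘(ℝ, V) (𝓡 m) k (fun u : U => unitVec (u : V)) := by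
    refine h3.congr fun u => ?_
    have hu : (u : V) ≠ 0 := u.2
    exact Subtype.ext (coe_unitVec hu)
  exact (contMDiffAt_subtype_iff (U := U) (x := ⟨v, h⟩)).1 (h4 ⟨v, h⟩)

end Radial

/-! ### Derivatives on a manifold read in a chart -/

section Chart

variable {m : ℕ} {X : Type u} [TopologicalSpace X] [ChartedSpace (EuclideanSpace ℝ (Fin m)) X]
  {E : Type*} [NormedAddCommGroup E] [NormedSpace ℝ E]

theorem mfderiv_eq_fderiv_chart {f : X → E} {x : X}
    (hf : MDifferentiableAt (𝓡 m) 𝓘(ℝ, E) f x) :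
    mfderiv (𝓡 m) 𝓘(ℝ, E) f x =
      fderiv ℝ (f ∘ (extChartAt (𝓡 m) x).symm) (extChartAt (𝓡 m) x x) := by
  have h : Set.range (𝓡 m) = Set.univ := ModelWithCorners.Boundaryless.range_eq_univ
  have h1 := hf.mfderiv
  rw [h, fderivWithin_univ] at h1
  exact h1

theorem differentiableAt_comp_chart {f : X → E} {x : X}
    (hf : MDifferentiableAt (𝓡 m) 𝓘(ℝ, E) f x) :
    DifferentiableAt ℝ (f ∘ (extChartAt (𝓡 m) x).symm) (extChartAt (𝓡 m) x x) := by
  have h : Set.range (𝓡 m) = Set.univ := ModelWithCorners.Boundaryless.range_eq_univ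
  have h1 := hf.differentiableWithinAt_writtenInExtChartAt
  rw [h, differentiableWithinAt_univ] at h1
  exact h1

end Chart

/-! ### The radial extension of a great circle fibration and its derivative -/

section Basic

variable {n : ℕ} {V : Type v} [NormedAddCommGroup V] [InnerProductSpace ℝ V]
  [FiniteDimensional ℝ V] [Fact (Module.finrank ℝ V = (2 * n + 1) + 1)]
  {X : Type u} [TopologicalSpace X] [ChartedSpace (EuclideanSpace ℝ (Fin (2 * n))) X]
  {π : Metric.sphere (0 : V) 1 → X} {ι : X → OrientedPlane V} {k : WithTop ℕ∞}

theorem contMDiff_starProjection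
    (h : ContMDiff (𝓡 (2 * n)) 𝓘(ℝ, V →L[ℝ] V) k (fun x => rot (ι x))) :
    ContMDiff (𝓡 (2 * n)) 𝓘(ℝ, V →L[ℝ] V) k (fun x => (ι x).plane.starProjection) := by
  have h1 : ContDiff ℝ k (planeProj : (V →L[ℝ] V) → V →L[ℝ] V) := (contDiff_id.mul contDiff_id).neg
  have h2 := h1.contMDiff.comp h
  simpa only [Function.comp_def, planeProj_rot] using h2

/-- The fibres of `π` are the great circles cut out by the planes `ι x`. -/
def IsFibredBy (π : Metric.sphere (0 : V) 1 → X) (ι : X → OrientedPlane V) : Prop :=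
  ∀ (p : Metric.sphere (0 : V) 1) (x : X), π p = x ↔ (p : V) ∈ (ι x).plane

theorem OrientedPlane.exists_ne_zero (P : OrientedPlane V) : ∃ v ∈ P.plane, v ≠ 0 := by
  have : Nontrivial P.plane := Module.nontrivial_of_finrank_pos (R := ℝ) (by
    rw [P.finrank_plane]; norm_num)
  obtain ⟨x, hx⟩ := exists_ne (0 : P.plane)
  exact ⟨x, x.2, fun h => hx (Subtype.ext h)⟩

theorem mfderiv_starProjection_apply (hι : MDifferentiable (𝓡 (2 * n)) 𝓘(ℝ, V →L[ℝ] V)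
      (fun x => (ι x).plane.starProjection)) (v : V) (x : X) (ξ : TangentSpace (𝓡 (2 * n)) x) :
    mfderiv (𝓡 (2 * n)) 𝓘(ℝ, V) (fun y => (ι y).plane.starProjection v) x ξ =
      projDeriv n ι x ξ v := by
  let L : (V →L[ℝ] V) →L[ℝ] V := ContinuousLinearMap.apply ℝ V v
  have h1 := (L.hasMFDerivAt (x := (ι x).plane.starProjection)).comp x (hι x).hasMFDerivAt
  exact DFunLike.congr_fun h1.mfderiv ξ

variable [Nontrivial V]

theorem contMDiffAt_radial (h : ContMDiff (𝓡 (2 * n + 1)) (𝓡 (2 * n)) k π) {v : V} (hv : v ≠ 0) :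
    ContMDiffAt 𝓘(ℝ, V) (𝓡 (2 * n)) k (fun w => π (unitVec w)) v :=
  (h (unitVec v)).comp v (contMDiffAt_unitVec hv)

theorem IsFibredBy.radial_eq_iff (h : IsFibredBy π ι) {v : V} (hv : v ≠ 0) {x : X} :
    π (unitVec v) = x ↔ v ∈ (ι x).plane := by
  rw [h, unitVec_mem hv]

theorem IsFibredBy.injective (h : IsFibredBy π ι) : Function.Injective ι := by
  intro x y hxy
  obtain ⟨v, hv, hv0⟩ := (ι x).exists_ne_zero
  exact ((h.radial_eq_iff hv0).2 hv).symm.trans ((h.radial_eq_iff hv0).2 (hxy ▸ hv))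

/-- Projecting `v` to the moving plane yields a local section through `v` of the radial extension of
`π`. -/
theorem IsFibredBy.eventually_radial_starProjection (h : IsFibredBy π ι)
    (hι : Continuous (fun x => (ι x).plane.starProjection)) {v : V} (hv : v ≠ 0) {x : X}
    (hvx : v ∈ (ι x).plane) :
    ∀ᶠ y in 𝓝 x, (ι y).plane.starProjection v ≠ 0 ∧
      π (unitVec ((ι y).plane.starProjection v)) = y := by
  have h1 : Continuous fun y => (ι y).plane.starProjection v := hι.clm_apply continuous_const
  have h2 : (ι x).plane.starProjection v ≠ 0 := by
    rwa [Submodule.starProjection_eq_self_iff.2 hvx]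
  filter_upwards [h1.continuousAt.eventually_ne h2] with y hy
  exact ⟨hy, (h.radial_eq_iff hy).2 (Submodule.starProjection_apply_mem _ _)⟩

/-- The velocity of the planes lifts a tangent vector of the base to the sphere. -/
theorem IsFibredBy.mfderiv_radial_projDeriv (h : IsFibredBy π ι) (hk : 1 ≤ k)
    (hπ : ContMDiff (𝓡 (2 * n + 1)) (𝓡 (2 * n)) k π)
    (hι : ContMDiff (𝓡 (2 * n)) 𝓘(ℝ, V →L[ℝ] V) k (fun x => rot (ι x)))
    {v : V} (hv : v ≠ 0) {x : X} (hvx : v ∈ (ι x).plane) (ξ : TangentSpace (𝓡 (2 * n)) x) :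
    mfderiv 𝓘(ℝ, V) (𝓡 (2 * n)) (fun w => π (unitVec w)) v (projDeriv n ι x ξ v) =
      (ξ : EuclideanSpace ℝ (Fin (2 * n))) := by
  have hk0 : k ≠ 0 := fun h0 => by rw [h0] at hk; exact absurd hk (by decide)
  have hι' := contMDiff_starProjection hι
  have hs : MDifferentiableAt (𝓡 (2 * n)) 𝓘(ℝ, V) (fun y => (ι y).plane.starProjection v) x := by
    let L : (V →L[ℝ] V) →L[ℝ] V := ContinuousLinearMap.apply ℝ V v
    exact (L.hasMFDerivAt.comp x (hι'.mdifferentiable hk0 x).hasMFDerivAt).mdifferentiableAt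
  have hsx : (ι x).plane.starProjection v = v := Submodule.starProjection_eq_self_iff.2 hvx
  have hr : MDifferentiableAt 𝓘(ℝ, V) (𝓡 (2 * n)) (fun w => π (unitVec w))
      ((ι x).plane.starProjection v) := by
    rw [hsx]
    exact (contMDiffAt_radial hπ hv).mdifferentiableAt hk0
  have h1 := hr.hasMFDerivAt.comp x hs.hasMFDerivAt
  have h2 : HasMFDerivAt (𝓡 (2 * n)) (𝓡 (2 * n)) (fun y : X => y) x
      (ContinuousLinearMap.id ℝ (TangentSpace (𝓡 (2 * n)) x)) := hasMFDerivAt_id x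
  have h3 : ((fun w => π (unitVec w)) ∘ fun y => (ι y).plane.starProjection v) =ᶠ[𝓝 x]
      fun y => y := by
    filter_upwards [h.eventually_radial_starProjection hι'.continuous hv hvx] with y hy
    exact hy.2
  have h4 := h3.mfderiv_eq.symm.trans h1.mfderiv
  rw [h2.mfderiv] at h4
  have h5 := DFunLike.congr_fun h4 ξ
  rw [← mfderiv_starProjection_apply (hι'.mdifferentiable hk0)]
  -- The chain rule puts the derivative at the projection of `v`, which equals `v` only
  -- propositionally, so it has to be transported.
  have h6 : ∀ w, w = v → mfderiv 𝓘(ℝ, V) (𝓡 (2 * n)) (fun w => π (unitVec w)) w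
      (mfderiv (𝓡 (2 * n)) 𝓘(ℝ, V) (fun y => (ι y).plane.starProjection v) x ξ) =
      (mfderiv 𝓘(ℝ, V) (𝓡 (2 * n)) (fun w => π (unitVec w)) v
      (mfderiv (𝓡 (2 * n)) 𝓘(ℝ, V) (fun y => (ι y).plane.starProjection v) x ξ) :
        EuclideanSpace ℝ (Fin (2 * n))) := by
    rintro w rfl; rfl
  exact (h6 _ hsx).symm.trans h5.symm

/-- The line `v + ε w` stays in one plane, on which the radial extension is constant. -/
theorem IsFibredBy.mfderiv_radial_eq_zero (h : IsFibredBy π ι)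
    {v : V} (hv : v ≠ 0) (hr : MDifferentiableAt 𝓘(ℝ, V) (𝓡 (2 * n)) (fun w => π (unitVec w)) v)
    {x : X} (hvx : v ∈ (ι x).plane) {w : V} (hw : w ∈ (ι x).plane) :
    mfderiv 𝓘(ℝ, V) (𝓡 (2 * n)) (fun w => π (unitVec w)) v w = 0 := by
  obtain ⟨L, h1, hL⟩ : ∃ L : ℝ →L[ℝ] V, HasFDerivAt (fun ε : ℝ => v + ε • w) L 0 ∧ L 1 = w :=
    ⟨_, ((hasFDerivAt_id (𝕜 := ℝ) (0 : ℝ)).smul_const w).const_add v, by simp⟩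
  have hr' : MDifferentiableAt 𝓘(ℝ, V) (𝓡 (2 * n)) (fun w => π (unitVec w)) (v + (0 : ℝ) • w) := by
    rwa [zero_smul, add_zero]
  have h2 := hr'.hasMFDerivAt.comp (0 : ℝ) h1.hasMFDerivAt
  have h3 : ((fun w => π (unitVec w)) ∘ fun ε : ℝ => v + ε • w) =ᶠ[𝓝 0] fun _ => x := by
    have h4 : Continuous fun ε : ℝ => v + ε • w := by fun_prop
    have h5 : v + (0 : ℝ) • w ≠ 0 := by simpa using hv
    filter_upwards [h4.continuousAt.eventually_ne h5] with ε hε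
    exact (h.radial_eq_iff hε).2 ((ι x).plane.add_mem hvx ((ι x).plane.smul_mem _ hw))
  have h6 := h3.mfderiv_eq.symm.trans h2.mfderiv
  rw [mfderiv_const] at h6
  have h7 := DFunLike.congr_fun h6 (1 : ℝ)
  have h8 : ∀ z, z = v → (mfderiv 𝓘(ℝ, V) (𝓡 (2 * n)) (fun w => π (unitVec w)) z w :
      EuclideanSpace ℝ (Fin (2 * n))) =
      mfderiv 𝓘(ℝ, V) (𝓡 (2 * n)) (fun w => π (unitVec w)) v w := by
    rintro z rfl; rfl
  refine (h8 (v + (0 : ℝ) • w) (by simp)).symm.trans ?_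
  refine Eq.trans ?_ h7.symm
  show _ = mfderiv 𝓘(ℝ, V) (𝓡 (2 * n)) (fun w => π (unitVec w)) (v + (0 : ℝ) • w)
    (L 1)
  rw [hL]

end Basic
end GreatCircle

namespace GreatCircle

/-! ### Tangent and normal spaces of the base -/

section Normal

variable {n : ℕ} {V : Type v} [NormedAddCommGroup V] [InnerProductSpace ℝ V]
  [FiniteDimensional ℝ V] [Fact (Module.finrank ℝ V = (2 * n + 1) + 1)]
  {X : Type u} [TopologicalSpace X] [ChartedSpace (EuclideanSpace ℝ (Fin (2 * n))) X]
  {π : Metric.sphere (0 : V) 1 → X} {ι : X → OrientedPlane V} {k : WithTop ℕ∞}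

theorem nontrivial_of_finrank_eq {m : ℕ} (h : Module.finrank ℝ V = m + 1) : Nontrivial V :=
  Module.nontrivial_of_finrank_pos (R := ℝ) (by omega)

section Derivative

variable (hι : MDifferentiable (𝓡 (2 * n)) 𝓘(ℝ, V →L[ℝ] V) (fun x => (ι x).plane.starProjection))
  (x : X) (ξ : TangentSpace (𝓡 (2 * n)) x)
include hι

theorem projDeriv_eq_fderiv :
    projDeriv n ι x = fderiv ℝ ((fun x => (ι x).plane.starProjection) ∘
      (extChartAt (𝓡 (2 * n)) x).symm) (extChartAt (𝓡 (2 * n)) x x) :=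
  mfderiv_eq_fderiv_chart (hι x)

/-- The derivative of `p² = p`. It implies that the derivative of the projection maps `P` into `Pᗮ`.
-/
theorem projDeriv_eq_add : projDeriv n ι x ξ =
    projDeriv n ι x ξ * (ι x).plane.starProjection +
      (ι x).plane.starProjection * projDeriv n ι x ξ := by
  rw [projDeriv_eq_fderiv hι]
  have h1 := differentiableAt_comp_chart (hι x)
  set q := (fun x => (ι x).plane.starProjection) ∘ (extChartAt (𝓡 (2 * n)) x).symm with hq
  have h2 : q * q = q := funext fun y => starProjection_mul_self _
  have h3 : q (extChartAt (𝓡 (2 * n)) x x) = (ι x).plane.starProjection := by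
    simp [hq]
  have h4 := fderiv_mul' h1 h1
  rw [h2, h3] at h4
  have h5 := DFunLike.congr_fun h4 ξ
  rw [add_comm]
  exact h5

theorem projDeriv_mul_starProjection : projDeriv n ι x ξ * (ι x).plane.starProjection =
    (1 - (ι x).plane.starProjection) * projDeriv n ι x ξ := by
  rw [sub_mul, one_mul, eq_sub_iff_add_eq, ← projDeriv_eq_add hι]

theorem starProjection_mul_projDeriv_mul : (ι x).plane.starProjection * (projDeriv n ι x ξ *
    (ι x).plane.starProjection) = 0 := by
  rw [projDeriv_mul_starProjection hι, ← mul_assoc, starProjection_mul_one_sub, zero_mul]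

/-- Since `(D p)† = p D†` and the trace is cyclic, pairing with `D` sees only `D p`. This makes the
pairing on tangent vectors positive definite. -/
theorem opTrace_star_projDeriv_mul :
    opTrace (star (projDeriv n ι x ξ * (ι x).plane.starProjection) * projDeriv n ι x ξ) =
      opTrace (star (projDeriv n ι x ξ * (ι x).plane.starProjection) *
        (projDeriv n ι x ξ * (ι x).plane.starProjection)) := by
  rw [star_mul, star_starProjection, ← mul_assoc (_ * _), opTrace_mul_comm (_ * _ * _),
    ← mul_assoc, ← mul_assoc, starProjection_mul_self]

theorem velocity_apply (p : (ι x).plane) :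
    velocity n ι x ξ p = (ι x).plane.mkQ (projDeriv n ι x ξ p) := rfl

theorem projDeriv_mem (p : (ι x).plane) (h : velocity n ι x ξ p = 0) :
    projDeriv n ι x ξ p ∈ (ι x).plane := by
  rwa [velocity_apply hι, Submodule.mkQ_apply, Submodule.Quotient.mk_eq_zero] at h

end Derivative

/-- A family of oriented planes which is a fibration of the sphere by great circles, with all maps
of class `C¹` at least. -/
structure IsFibration (n : ℕ) {V : Type v} [NormedAddCommGroup V] [InnerProductSpace ℝ V]
    [FiniteDimensional ℝ V] [Fact (Module.finrank ℝ V = (2 * n + 1) + 1)]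
    {X : Type u} [TopologicalSpace X] [ChartedSpace (EuclideanSpace ℝ (Fin (2 * n))) X]
    (k : WithTop ℕ∞) (π : Metric.sphere (0 : V) 1 → X) (ι : X → OrientedPlane V) :
    Prop where
  one_le : 1 ≤ k
  fibred : IsFibredBy π ι
  contMDiff_proj : ContMDiff (𝓡 (2 * n + 1)) (𝓡 (2 * n)) k π
  contMDiff_rot : ContMDiff (𝓡 (2 * n)) 𝓘(ℝ, V →L[ℝ] V) k (fun x => rot (ι x))

theorem IsGreatCircleFibration.isFibration (hk : 1 ≤ k)
    (h : IsGreatCircleFibration n k π ι) : IsFibration n k π ι where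
  one_le := hk
  fibred := h.fiber
  contMDiff_proj := h.contMDiff_proj
  contMDiff_rot := h.contMDiff_plane

namespace IsFibration

variable (h : IsFibration n k π ι)
include h

theorem ne_zero : k ≠ 0 := fun h0 => by
  have := h.one_le
  rw [h0] at this
  exact absurd this (by decide)

theorem contMDiff_starProj :
    ContMDiff (𝓡 (2 * n)) 𝓘(ℝ, V →L[ℝ] V) k (fun x => (ι x).plane.starProjection) :=
  contMDiff_starProjection h.contMDiff_rot

theorem mdifferentiable_starProj : MDifferentiable (𝓡 (2 * n)) 𝓘(ℝ, V →L[ℝ] V)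
    (fun x => (ι x).plane.starProjection) :=
  h.contMDiff_starProj.mdifferentiable h.ne_zero

theorem mfderiv_radial_projDeriv [Nontrivial V] {v : V} (hv : v ≠ 0) {x : X}
    (hvx : v ∈ (ι x).plane) (ξ : TangentSpace (𝓡 (2 * n)) x) :
    mfderiv 𝓘(ℝ, V) (𝓡 (2 * n)) (fun w => π (unitVec w)) v (projDeriv n ι x ξ v) =
      (ξ : EuclideanSpace ℝ (Fin (2 * n))) :=
  h.fibred.mfderiv_radial_projDeriv h.one_le h.contMDiff_proj h.contMDiff_rot hv hvx ξ

theorem mdifferentiableAt_radial [Nontrivial V] {v : V} (hv : v ≠ 0) :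
    MDifferentiableAt 𝓘(ℝ, V) (𝓡 (2 * n)) (fun w => π (unitVec w)) v :=
  (contMDiffAt_radial h.contMDiff_proj hv).mdifferentiableAt h.ne_zero

/-- If the velocity vanishes at `p`, the lift of `ξ` to `p` lies in the plane itself, where the
derivative of the radial extension is zero; but that derivative sends the lift to `ξ`. -/
theorem eq_zero_of_velocity_eq_zero {x : X} {ξ : TangentSpace (𝓡 (2 * n)) x} {p : (ι x).plane}
    (hp : p ≠ 0) (hξ : velocity n ι x ξ p = 0) : ξ = 0 := by
  have : Nontrivial V := nontrivial_of_finrank_eq (Fact.out : Module.finrank ℝ V = (2 * n + 1) + 1)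
  have hp' : (p : V) ≠ 0 := fun h0 => hp (Subtype.ext h0)
  have h1 := h.mfderiv_radial_projDeriv hp' p.2 ξ
  rw [h.fibred.mfderiv_radial_eq_zero hp' (h.mdifferentiableAt_radial hp') p.2
    (projDeriv_mem h.mdifferentiable_starProj x ξ p hξ)] at h1
  exact h1.symm

theorem exists_plane_ne_zero (x : X) : ∃ p : (ι x).plane, p ≠ 0 := by
  obtain ⟨v, hv, hv0⟩ := (ι x).exists_ne_zero
  exact ⟨⟨v, hv⟩, fun h0 => hv0 (congrArg Subtype.val h0)⟩

theorem eq_zero_of_projDeriv_mul {x : X} {ξ : TangentSpace (𝓡 (2 * n)) x}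
    (hξ : projDeriv n ι x ξ * (ι x).plane.starProjection = 0) : ξ = 0 := by
  obtain ⟨p, hp⟩ := h.exists_plane_ne_zero x
  refine h.eq_zero_of_velocity_eq_zero hp ?_
  have h1 := DFunLike.congr_fun hξ (p : V)
  rw [mul_apply_eq_comp, Submodule.starProjection_eq_self_iff.2 p.2] at h1
  rw [velocity_apply h.mdifferentiable_starProj, h1]
  simp

theorem eq_zero_of_opTrace_projDeriv {x : X} {ξ : TangentSpace (𝓡 (2 * n)) x}
    (hξ : opTrace (star (projDeriv n ι x ξ * (ι x).plane.starProjection) *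
      projDeriv n ι x ξ) = 0) : ξ = 0 := by
  rw [opTrace_star_projDeriv_mul h.mdifferentiable_starProj] at hξ
  exact h.eq_zero_of_projDeriv_mul (eq_zero_of_opTrace_star_mul_self hξ)

theorem velocity_injective (x : X) : Function.Injective (velocity n ι x) := by
  obtain ⟨p, hp⟩ := h.exists_plane_ne_zero x
  exact (injective_iff_map_eq_zero _).2 fun ξ hξ =>
    h.eq_zero_of_velocity_eq_zero hp (by rw [hξ, LinearMap.zero_apply])

theorem finrank_tangentPlane (x : X) : Module.finrank ℝ (tangentPlane n ι x) = 2 * n := by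
  rw [tangentPlane, LinearMap.finrank_range_of_inj (h.velocity_injective x)]
  exact finrank_euclideanSpace_fin

theorem finrank_quotient (x : X) : Module.finrank ℝ (V ⧸ (ι x).plane) = 2 * n := by
  have h1 := (ι x).plane.finrank_quotient_add_finrank
  rw [(ι x).finrank_plane, (Fact.out : Module.finrank ℝ V = (2 * n + 1) + 1)] at h1
  omega

theorem isElliptic (x : X) : IsElliptic (tangentPlane n ι x) where
  eq_zero := by
    rintro _ ⟨ξ, rfl⟩ p hp hξ
    rw [h.eq_zero_of_velocity_eq_zero hp hξ, map_zero]
  finrank_eq := by rw [h.finrank_tangentPlane, h.finrank_quotient]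

theorem finrank_normalFiber (x : X) : Module.finrank ℝ (NormalFiber n ι x) = 2 * n := by
  have h1 := (tangentPlane n ι x).finrank_quotient_add_finrank
  rw [h.finrank_tangentPlane, Module.finrank_linearMap, (ι x).finrank_plane,
    h.finrank_quotient] at h1
  have h2 : Module.finrank ℝ (NormalFiber n ι x) =
    Module.finrank ℝ (((ι x).plane →ₗ[ℝ] V ⧸ (ι x).plane) ⧸ tangentPlane n ι x) := rfl
  omega

/-- Riesz representation for the metric induced on `X`, whose value at `(ξ, ξ)` is the squared
Hilbert–Schmidt norm of `D p`. -/
theorem exists_projDeriv_eq (x : X) (L : TangentSpace (𝓡 (2 * n)) x →ₗ[ℝ] ℝ) :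
    ∃ ξ : TangentSpace (𝓡 (2 * n)) x, ∀ η : TangentSpace (𝓡 (2 * n)) x,
      opTrace (star (projDeriv n ι x ξ * (ι x).plane.starProjection) * projDeriv n ι x η) =
        L η := by
  let E := EuclideanSpace ℝ (Fin (2 * n))
  let D : E →ₗ[ℝ] V →L[ℝ] V := (projDeriv n ι x).toLinearMap
  let p := (ι x).plane.starProjection
  let G : E →ₗ[ℝ] E →ₗ[ℝ] ℝ := LinearMap.mk₂ ℝ (fun ξ η => opTrace (star (D ξ * p) * D η))
    (by intro a b c; simp [add_mul]) (by intro c a b; simp)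
    (by intro a b c; simp [mul_add]) (by intro c a b; simp)
  have hG : Function.Injective G := (injective_iff_map_eq_zero G).2 fun ξ hξ =>
    h.eq_zero_of_opTrace_projDeriv (LinearMap.congr_fun hξ ξ)
  have hGs : Function.Surjective G :=
    (LinearMap.injective_iff_surjective_of_finrank_eq_finrank
      (by rw [Module.finrank_linearMap, Module.finrank_self, mul_one])).1 hG
  obtain ⟨ξ, hξ⟩ := hGs (L : E →ₗ[ℝ] ℝ)
  exact ⟨ξ, fun η => LinearMap.congr_fun hξ η⟩

end IsFibration

/-- Written as equations between operators, membership becomes the vanishing of a linear map with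
coefficients depending on `p` and its derivative. -/
theorem mem_normalSpace_iff {x : X} {S : V →L[ℝ] V} : S ∈ normalSpace n ι x ↔
    (1 - (ι x).plane.starProjection) * S * (ι x).plane.starProjection = S ∧
      ∀ ξ : TangentSpace (𝓡 (2 * n)) x, opTrace (star S * projDeriv n ι x ξ) = 0 := by
  set p := (ι x).plane.starProjection with hp
  have h1 : S ∈ normalSpace n ι x ↔ ((∀ v ∈ (ι x).planeᗮ, S v = 0) ∧ ∀ v, S v ∈ (ι x).planeᗮ) ∧
      ∀ ξ : TangentSpace (𝓡 (2 * n)) x, opTrace (star S * projDeriv n ι x ξ) = 0 := by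
    rw [and_assoc]; rfl
  rw [h1]
  refine and_congr_left fun _ => ⟨fun ⟨h2, h3⟩ => ?_, fun h2 => ?_⟩
  · ext v
    have h4 : p (S (p v)) = 0 := by
      have := h3 (p v)
      rwa [← Submodule.ker_starProjection] at this
    have h5 : S (v - p v) = 0 := h2 _ (Submodule.sub_starProjection_mem_orthogonal v)
    rw [map_sub, sub_eq_zero] at h5
    show S (p v) - p (S (p v)) = S v
    rw [h4, sub_zero, h5]
  · constructor
    · intro v hv
      have h3 : p v = 0 := by rwa [← Submodule.ker_starProjection] at hv
      rw [← h2, mul_apply_eq_comp, h3, map_zero]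
    · intro v
      rw [← h2, ← Submodule.ker_starProjection]
      show p (((1 - p) * S * p) v) = 0
      rw [← mul_apply_eq_comp, ← mul_assoc, ← mul_assoc, starProjection_mul_one_sub]
      simp

namespace IsFibration

variable (h : IsFibration n k π ι)
include h

theorem projDeriv_mul_eq (x : X) (ξ : TangentSpace (𝓡 (2 * n)) x) :
    (1 - (ι x).plane.starProjection) * (projDeriv n ι x ξ * (ι x).plane.starProjection) *
      (ι x).plane.starProjection = projDeriv n ι x ξ * (ι x).plane.starProjection := by
  rw [mul_assoc, mul_assoc, starProjection_mul_self, sub_mul, one_mul,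
    starProjection_mul_projDeriv_mul h.mdifferentiable_starProj, sub_zero]

/-- Two normal vectors with the same class differ by some `D p`, which is orthogonal to itself and
hence zero. A representative of a given class becomes normal after subtracting its orthogonal
projection to the tangent space. -/
theorem bijOn_normalClass (x : X) :
    Set.BijOn (normalClass n ι x) (normalSpace n ι x) Set.univ := by
  set p := (ι x).plane.starProjection with hp
  refine ⟨fun _ _ => Set.mem_univ _, fun S hS T hT hST => ?_, fun y _ => ?_⟩
  · have h1 := (Submodule.Quotient.eq _).1 hST
    obtain ⟨ξ, hξ⟩ := h1
    have hR := Submodule.sub_mem _ hS hT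
    set R := S - T with hRdef
    rw [mem_normalSpace_iff] at hR
    have h2 : R = projDeriv n ι x ξ * p := by
      rw [← hR.1, ← h.projDeriv_mul_eq]
      ext v
      have h3 := LinearMap.congr_fun hξ ((ι x).plane.orthogonalProjectionOnto v)
      have h4 : (ι x).plane.mkQ (projDeriv n ι x ξ (p v)) = (ι x).plane.mkQ (R (p v)) := by
        refine h3.trans ?_
        simp only [LinearMap.sub_apply, LinearMap.comp_apply, ← map_sub]
        rfl
      rw [← sub_eq_zero, ← map_sub, Submodule.mkQ_apply, Submodule.Quotient.mk_eq_zero,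
        ← Submodule.starProjection_eq_self_iff] at h4
      have h5 : p (p v) = p v := DFunLike.congr_fun (starProjection_mul_self (ι x).plane) v
      show R (p v) - p (R (p v)) = projDeriv n ι x ξ (p (p v)) - p (projDeriv n ι x ξ (p (p v)))
      rw [h5]
      rw [map_sub] at h4
      rw [← sub_eq_zero]
      have h6 := sub_eq_zero.2 h4
      rw [← h6]
      abel
    have h3 := hR.2 ξ
    rw [h2] at h3
    have h4 := h.eq_zero_of_opTrace_projDeriv h3
    rw [h4, map_zero, zero_mul] at h2
    exact sub_eq_zero.1 h2
  · obtain ⟨u, rfl⟩ := (tangentPlane n ι x).mkQ_surjective y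
    obtain ⟨r, hr⟩ := (ι x).plane.mkQ.exists_rightInverse_of_surjective (Submodule.range_mkQ _)
    set S₀ : V →L[ℝ] V := (1 - p) * LinearMap.toContinuousLinearMap
      (r ∘ₗ u ∘ₗ ((ι x).plane.orthogonalProjectionOnto : V →ₗ[ℝ] (ι x).plane)) * p with hS₀
    obtain ⟨ξ, hξ⟩ := h.exists_projDeriv_eq x
      ((opTrace (V := V)).toLinearMap ∘ₗ LinearMap.mulLeft ℝ (star S₀) ∘ₗ
        (projDeriv n ι x).toLinearMap)
    refine ⟨S₀ - projDeriv n ι x ξ * p, mem_normalSpace_iff.2 ⟨?_, fun η => ?_⟩, ?_⟩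
    · rw [mul_sub, sub_mul, h.projDeriv_mul_eq, hS₀]
      congr 1
      rw [mul_assoc, mul_assoc, starProjection_mul_self, ← mul_assoc, ← mul_assoc,
        sub_mul 1 p (1 - p), one_mul, starProjection_mul_one_sub, sub_zero]
    · rw [star_sub, sub_mul, map_sub, hξ]
      exact sub_self _
    · refine (Submodule.Quotient.eq _).2 ⟨-ξ, ?_⟩
      ext w
      have hw : p w = w := Submodule.starProjection_eq_self_iff.2 w.2
      have hw' : (ι x).plane.orthogonalProjectionOnto w = w :=
        Submodule.orthogonalProjectionOnto_mem_subspace_eq_self w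
      have h1 : (S₀ - projDeriv n ι x ξ * p) w =
          r (u w) - p (r (u w)) - projDeriv n ι x ξ w := by
        simp only [hS₀, sub_apply, mul_apply_eq_comp, hw,
          LinearMap.coe_toContinuousLinearMap', LinearMap.comp_apply,
          ContinuousLinearMap.coe_coe, hw']
        rfl
      have h2 : (ι x).plane.mkQ (r (u w)) = u w := LinearMap.congr_fun hr (u w)
      have h3 : (ι x).plane.mkQ (p (r (u w))) = 0 :=
        (Submodule.Quotient.mk_eq_zero _).2 (Submodule.starProjection_apply_mem _ _)
      rw [LinearMap.sub_apply, velocity_apply h.mdifferentiable_starProj]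
      show _ = (ι x).plane.mkQ ((S₀ - projDeriv n ι x ξ * p) w) - u w
      rw [h1, map_sub, map_sub, h2, h3, map_neg, neg_apply, map_neg]
      abel

end IsFibration

end Normal
end GreatCircle

/-! ### Smooth local frames of the normal bundle -/

namespace GreatCircle

/-- With such a `Q`, the operator `1 - Q L` is a projection onto the kernel of `L`. -/
theorem exists_generalized_inverse {E W : Type*} [AddCommGroup E] [Module ℝ E] [AddCommGroup W]
    [Module ℝ W] (L : E →ₗ[ℝ] W) : ∃ Q : W →ₗ[ℝ] E, ∀ v, L (Q (L v)) = L v := by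
  obtain ⟨r, hr⟩ := L.rangeRestrict.exists_rightInverse_of_surjective L.range_rangeRestrict
  obtain ⟨Q, hQ⟩ := LinearMap.exists_extend r
  refine ⟨Q, fun v => ?_⟩
  have h1 := LinearMap.congr_fun hQ (L.rangeRestrict v)
  have h2 := LinearMap.congr_fun hr (L.rangeRestrict v)
  have h3 : Q (L v) = r (L.rangeRestrict v) := h1
  rw [h3]
  exact congrArg Subtype.val h2

theorem contDiffAt_inverse_of_isUnit {E : Type*} [NormedAddCommGroup E] [NormedSpace ℝ E]
    [CompleteSpace E] {T : E →L[ℝ] E} (hT : IsUnit T) :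
    ContDiffAt ℝ ∞ (Ring.inverse : (E →L[ℝ] E) → E →L[ℝ] E) T := by
  obtain ⟨U, rfl⟩ := hT
  exact contDiffAt_ringInverse ℝ U

/-- The bilinear map which sends `D` and `S` to the functional `η ↦ tr (S† D η)`. -/
noncomputable def tracePairing (V : Type v) [NormedAddCommGroup V] [InnerProductSpace ℝ V]
    [FiniteDimensional ℝ V] (E : Type*) [NormedAddCommGroup E] [NormedSpace ℝ E] :
    (E →L[ℝ] (V →L[ℝ] V)) →L[ℝ] (V →L[ℝ] V) →L[ℝ] (E →L[ℝ] ℝ) :=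
  ((ContinuousLinearMap.compL ℝ E (V →L[ℝ] V) ℝ) ∘L
    ((ContinuousLinearMap.compL ℝ (V →L[ℝ] V) (V →L[ℝ] V) ℝ opTrace) ∘L
      (ContinuousLinearMap.mul ℝ (V →L[ℝ] V)) ∘L
        (starL' ℝ : (V →L[ℝ] V) ≃L[ℝ] (V →L[ℝ] V)).toContinuousLinearMap)).flip

theorem tracePairing_apply {V : Type v} [NormedAddCommGroup V] [InnerProductSpace ℝ V]
    [FiniteDimensional ℝ V] {E : Type*} [NormedAddCommGroup E] [NormedSpace ℝ E]
    (D : E →L[ℝ] (V →L[ℝ] V)) (S : V →L[ℝ] V) (η : E) :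
    tracePairing V E D S η = opTrace (star S * D η) := rfl

theorem contDiff_tracePairing {V : Type v} [NormedAddCommGroup V] [InnerProductSpace ℝ V]
    [FiniteDimensional ℝ V] {E : Type*} [NormedAddCommGroup E] [NormedSpace ℝ E]
    {k : WithTop ℕ∞} : ContDiff ℝ k (tracePairing V E) := by
  fun_prop

/-- The kernel of a smooth family of linear maps of constant rank has smooth local frames. -/
theorem exists_frame_ker {M₀ E W : Type*} [NormedAddCommGroup M₀] [NormedSpace ℝ M₀]
    [NormedAddCommGroup E] [NormedSpace ℝ E] [FiniteDimensional ℝ E]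
    [NormedAddCommGroup W] [NormedSpace ℝ W] [FiniteDimensional ℝ W] {Y : Set M₀} (hY : IsOpen Y)
    {L : M₀ → E →L[ℝ] W} (hL : ContDiffOn ℝ ∞ L Y) {K : M₀ → Submodule ℝ E}
    (hK : ∀ y ∈ Y, ∀ v, v ∈ K y ↔ L y v = 0) {d : ℕ}
    (hd : ∀ y ∈ Y, Module.finrank ℝ (K y) = d) {y₀ : M₀} (hy₀ : y₀ ∈ Y) :
    ∃ Y' ⊆ Y, IsOpen Y' ∧ y₀ ∈ Y' ∧ ∃ e : Fin d → M₀ → E, (∀ i, ContDiffOn ℝ ∞ (e i) Y') ∧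
      ∀ y ∈ Y', LinearIndependent ℝ (fun i => e i y) ∧
        Submodule.span ℝ (Set.range fun i => e i y) = K y := by
  have : CompleteSpace E := FiniteDimensional.complete ℝ E
  obtain ⟨Q', hQ'⟩ := exists_generalized_inverse (L y₀ : E →ₗ[ℝ] W)
  set Q : W →L[ℝ] E := LinearMap.toContinuousLinearMap Q'
  have hQ : ∀ v, L y₀ (Q (L y₀ v)) = L y₀ v := hQ'
  -- If `L y v = 0`, then `Ψ y v = v - Q (L y₀ v)` lies in the kernel at `y₀`. Near `y₀` the
  -- operator `Ψ y` is invertible, and equality of dimensions makes it an isomorphism of kernels;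
  -- its inverse transports a fixed basis.
  obtain ⟨Ψ, hΨ⟩ : ∃ Ψ : M₀ → E →L[ℝ] E, Ψ = fun y => 1 + Q ∘L (L y - L y₀) := ⟨_, rfl⟩
  have hΨs : ContDiffOn ℝ ∞ Ψ Y := by
    rw [hΨ]
    exact contDiffOn_const.add (contDiffOn_const.clm_comp (hL.sub contDiffOn_const))
  have hΨ0 : Ψ y₀ = 1 := by simp [hΨ]
  set Y' := Y ∩ Ψ ⁻¹' {A | IsUnit A} with hY'
  have hY'o : IsOpen Y' := hΨs.continuousOn.isOpen_inter_preimage hY Units.isOpen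
  have hmaps : ∀ y v, L y v = 0 → L y₀ (Ψ y v) = 0 := fun y v hv => by
    simp [hΨ, hv, hQ]
  set b := Module.finBasisOfFinrankEq ℝ (K y₀) (hd y₀ hy₀)
  have hinv : ∀ y ∈ Y', ∀ v, Ring.inverse (Ψ y) (Ψ y v) = v ∧ Ψ y (Ring.inverse (Ψ y) v) = v :=
    fun y hy v =>
      have hu : IsUnit (Ψ y) := hy.2
      ⟨DFunLike.congr_fun (Ring.inverse_mul_cancel _ hu) v,
        DFunLike.congr_fun (Ring.mul_inverse_cancel _ hu) v⟩
  refine ⟨Y', Set.inter_subset_left, hY'o, ⟨hy₀, by simp [hΨ0]⟩,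
    fun i y => Ring.inverse (Ψ y) (b i), fun i => ?_, fun y hy => ?_⟩
  · intro y hy
    have h1 := contDiffAt_inverse_of_isUnit (T := Ψ y) hy.2
    exact (h1.comp_contDiffWithinAt y (hΨs.mono Set.inter_subset_left y hy)).clm_apply
      contDiffWithinAt_const
  · have hli : LinearIndependent ℝ (fun i => Ring.inverse (Ψ y) (b i : E)) := by
      have h1 : LinearIndependent ℝ (fun i => (b i : E)) :=
        b.linearIndependent.map' (K y₀).subtype (K y₀).ker_subtype
      refine h1.map' (Ring.inverse (Ψ y)).toLinearMap (LinearMap.ker_eq_bot.2 fun v w hvw => ?_)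
      have := congrArg (Ψ y) hvw
      simpa only [ContinuousLinearMap.coe_coe, (hinv y hy _).2] using this
    refine ⟨hli, Submodule.eq_of_le_of_finrank_eq ?_ ?_⟩
    · rw [Submodule.span_le]
      rintro _ ⟨i, rfl⟩
      let R : K y →ₗ[ℝ] K y₀ :=
        (Ψ y).toLinearMap.restrict fun v hv =>
          (hK y₀ hy₀ _).2 (hmaps y v ((hK y hy.1 v).1 hv))
      have hR : Function.Injective R := fun v w hvw => by
        have h2 : Ψ y v = Ψ y w := congrArg Subtype.val hvw
        have h3 := congrArg (fun z => (Ring.inverse (Ψ y) : E →L[ℝ] E) z) h2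
        rw [(hinv y hy _).1, (hinv y hy _).1] at h3
        exact Subtype.ext h3
      obtain ⟨v, hv⟩ := (LinearMap.injective_iff_surjective_of_finrank_eq_finrank
        ((hd y hy.1).trans (hd y₀ hy₀).symm)).1 hR (b i)
      have h2 : Ψ y v = b i := congrArg Subtype.val hv
      show (Ring.inverse (Ψ y) : E →L[ℝ] E) (b i : E) ∈ K y
      rw [← h2, (hinv y hy _).1]
      exact v.2
    · rw [finrank_span_eq_card hli, Fintype.card_fin, hd y hy.1]

section Charts

variable {n : ℕ} {V : Type v} [NormedAddCommGroup V] [InnerProductSpace ℝ V]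
  [FiniteDimensional ℝ V] [Fact (Module.finrank ℝ V = (2 * n + 1) + 1)]
  {X : Type u} [TopologicalSpace X] [ChartedSpace (EuclideanSpace ℝ (Fin (2 * n))) X]
  [IsManifold (𝓡 (2 * n)) ∞ X]
  {π : Metric.sphere (0 : V) 1 → X} {ι : X → OrientedPlane V}

/-- The family of planes `ι`, as operators, in the chart at `x₀`. -/
noncomputable def chartRot (n : ℕ) {V : Type v} [NormedAddCommGroup V] [InnerProductSpace ℝ V]
    [FiniteDimensional ℝ V] {X : Type u} [TopologicalSpace X]
    [ChartedSpace (EuclideanSpace ℝ (Fin (2 * n))) X]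
    (ι : X → OrientedPlane V) (x₀ : X) (y : EuclideanSpace ℝ (Fin (2 * n))) : V →L[ℝ] V :=
  rot (ι ((extChartAt (𝓡 (2 * n)) x₀).symm y))

/-- The orthogonal projections to the planes `ι`, in the chart at `x₀`. -/
noncomputable def chartProj (n : ℕ) {V : Type v} [NormedAddCommGroup V] [InnerProductSpace ℝ V]
    [FiniteDimensional ℝ V] {X : Type u} [TopologicalSpace X]
    [ChartedSpace (EuclideanSpace ℝ (Fin (2 * n))) X]
    (ι : X → OrientedPlane V) (x₀ : X) (y : EuclideanSpace ℝ (Fin (2 * n))) : V →L[ℝ] V :=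
  (ι ((extChartAt (𝓡 (2 * n)) x₀).symm y)).plane.starProjection

namespace IsFibration

variable (h : IsFibration n ∞ π ι) (x₀ : X)
include h

theorem contDiffOn_chartRot : ContDiffOn ℝ ∞ (chartRot n ι x₀) (extChartAt (𝓡 (2 * n)) x₀).target :=
  contMDiffOn_iff_contDiffOn.1
    (h.contMDiff_rot.comp_contMDiffOn (contMDiffOn_extChartAt_symm x₀))

theorem contDiffOn_chartProj :
    ContDiffOn ℝ ∞ (chartProj n ι x₀) (extChartAt (𝓡 (2 * n)) x₀).target :=
  contMDiffOn_iff_contDiffOn.1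
    (h.contMDiff_starProj.comp_contMDiffOn (contMDiffOn_extChartAt_symm x₀))

theorem contDiffOn_fderiv_chartProj :
    ContDiffOn ℝ ∞ (fderiv ℝ (chartProj n ι x₀)) (extChartAt (𝓡 (2 * n)) x₀).target :=
  (h.contDiffOn_chartProj x₀).fderiv_of_isOpen (isOpen_extChartAt_target x₀) (by norm_num)

/-- `projDeriv` at `x` is computed in the preferred chart at `x`, which need not vary continuously.
Orthogonality depends only on its range, and that can be computed in the fixed chart at `x₀`. -/
theorem range_projDeriv {x : X} (hx : x ∈ (chartAt (EuclideanSpace ℝ (Fin (2 * n))) x₀).source) :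
    Set.range (projDeriv n ι x) =
      Set.range (fderiv ℝ (chartProj n ι x₀) (extChartAt (𝓡 (2 * n)) x₀ x)) := by
  set φ := extChartAt (𝓡 (2 * n)) x₀ with hφ
  have hxs : x ∈ φ.source := by rwa [hφ, extChartAt_source]
  have hxt : φ x ∈ φ.target := φ.map_source hxs
  have hto : φ.target ∈ 𝓝 (φ x) := (isOpen_extChartAt_target x₀).mem_nhds hxt
  have hq := h.mdifferentiable_starProj
  have hq' : DifferentiableAt ℝ (chartProj n ι x₀) (φ x) :=
    ((h.contDiffOn_chartProj x₀).contDiffAt hto).differentiableAt (by norm_num)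
  have hφd : MDifferentiableAt (𝓡 (2 * n)) 𝓘(ℝ, EuclideanSpace ℝ (Fin (2 * n))) φ x :=
    mdifferentiableAt_extChartAt hx
  have hφs : MDifferentiableAt 𝓘(ℝ, EuclideanSpace ℝ (Fin (2 * n))) (𝓡 (2 * n)) φ.symm (φ x) :=
    ((contMDiffOn_extChartAt_symm (n := ∞) x₀).contMDiffAt hto).mdifferentiableAt (by norm_num)
  have hxx : φ.symm (φ x) = x := φ.left_inv hxs
  apply Set.Subset.antisymm
  · rintro _ ⟨ξ, rfl⟩
    have h1 := hq'.hasFDerivAt.hasMFDerivAt.comp x hφd.hasMFDerivAt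
    have h2 : (chartProj n ι x₀ ∘ φ) =ᶠ[𝓝 x] fun x => (ι x).plane.starProjection := by
      filter_upwards [extChartAt_source_mem_nhds' (I := 𝓡 (2 * n)) (x := x₀) hxs] with z hz
      exact congrArg (fun z => (ι z).plane.starProjection) (φ.left_inv hz)
    have h3 := h2.mfderiv_eq.symm.trans h1.mfderiv
    exact ⟨_, (DFunLike.congr_fun h3 ξ).symm⟩
  · rintro _ ⟨η, rfl⟩
    have hq2 := (hq (φ.symm (φ x))).hasMFDerivAt.comp (φ x) hφs.hasMFDerivAt
    have h2 := DFunLike.congr_fun (mfderiv_eq_fderiv.symm.trans hq2.mfderiv) η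
    rw [hxx] at h2
    exact ⟨_, h2.symm⟩

theorem mem_normalSpace_iff_chart {x : X}
    (hx : x ∈ (chartAt (EuclideanSpace ℝ (Fin (2 * n))) x₀).source) {S : V →L[ℝ] V} :
    S ∈ normalSpace n ι x ↔
      (1 - (ι x).plane.starProjection) * S * (ι x).plane.starProjection = S ∧
      ∀ η, opTrace (star S * fderiv ℝ (chartProj n ι x₀) (extChartAt (𝓡 (2 * n)) x₀ x) η) = 0 := by
  rw [mem_normalSpace_iff]
  refine and_congr_right fun _ => ?_
  have h1 := h.range_projDeriv x₀ hx
  constructor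
  · intro h2 η
    obtain ⟨ξ, hξ⟩ : fderiv ℝ (chartProj n ι x₀) (extChartAt (𝓡 (2 * n)) x₀ x) η ∈
      Set.range (projDeriv n ι x) := by rw [h1]; exact ⟨η, rfl⟩
    rw [← hξ]
    exact h2 ξ
  · intro h2 ξ
    obtain ⟨η, hη⟩ : projDeriv n ι x ξ ∈ Set.range
      (fderiv ℝ (chartProj n ι x₀) (extChartAt (𝓡 (2 * n)) x₀ x)) := by rw [← h1]; exact ⟨ξ, rfl⟩
    rw [← hη]
    exact h2 η

theorem finrank_normalSpace (x : X) : Module.finrank ℝ (normalSpace n ι x) = 2 * n := by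
  have h1 := h.bijOn_normalClass x
  let F : normalSpace n ι x →ₗ[ℝ] NormalFiber n ι x :=
    { toFun := fun S => normalClass n ι x S
      map_add' := fun S T => by
        simp only [normalClass, ← map_add]
        congr 1
      map_smul' := fun c S => by
        simp only [normalClass, RingHom.id_apply, ← map_smul]
        congr 1 }
  have hF : Function.Bijective F :=
    ⟨fun S T hST => Subtype.ext (h1.injOn S.2 T.2 hST), fun y => by
      obtain ⟨S, hS, hSy⟩ := h1.surjOn (Set.mem_univ y)
      exact ⟨⟨S, hS⟩, hSy⟩⟩
  rw [(LinearEquiv.ofBijective F hF).finrank_eq, h.finrank_normalFiber]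

/-- In a chart the normal spaces are the kernels of `S ↦ (S - (1 - p) S p, tr (S† D ·))`, a smooth
family of linear maps whose kernels all have dimension `2n`. -/
theorem exists_frame : ∃ W : Set X, IsOpen W ∧ x₀ ∈ W ∧ ∃ e : Fin (2 * n) → X → V →L[ℝ] V,
      (∀ i, ContMDiffOn (𝓡 (2 * n)) 𝓘(ℝ, V →L[ℝ] V) ∞ (e i) W) ∧
      ∀ x ∈ W, LinearIndependent ℝ (fun i => e i x) ∧
        Submodule.span ℝ (Set.range fun i => e i x) = normalSpace n ι x := by
  set φ := extChartAt (𝓡 (2 * n)) x₀ with hφ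
  let L₁ : (V →L[ℝ] V) → (V →L[ℝ] V) →L[ℝ] (V →L[ℝ] V) := fun p =>
    ContinuousLinearMap.id ℝ _ - ContinuousLinearMap.mul ℝ (V →L[ℝ] V) (1 - p) ∘L
      (ContinuousLinearMap.mul ℝ (V →L[ℝ] V)).flip p
  have hL₁ : ∀ p S, L₁ p S = S - (1 - p) * S * p := fun p S => by
    simp [L₁, mul_assoc]
    rw [sub_mul, one_mul]
  let L : EuclideanSpace ℝ (Fin (2 * n)) →
      (V →L[ℝ] V) →L[ℝ] (V →L[ℝ] V) × (EuclideanSpace ℝ (Fin (2 * n)) →L[ℝ] ℝ) := fun y =>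
    ContinuousLinearMap.inl ℝ _ _ ∘L L₁ (chartProj n ι x₀ y) +
      ContinuousLinearMap.inr ℝ _ _ ∘L tracePairing V _ (fderiv ℝ (chartProj n ι x₀) y)
  have hker : ∀ y ∈ φ.target, ∀ S, S ∈ normalSpace n ι (φ.symm y) ↔ L y S = 0 := fun y hy S => by
    have hs : φ.symm y ∈ (chartAt (EuclideanSpace ℝ (Fin (2 * n))) x₀).source := by
      rw [← extChartAt_source (𝓡 (2 * n))]
      exact φ.map_target hy
    rw [h.mem_normalSpace_iff_chart x₀ hs, φ.right_inv hy]
    have h1 : L y S = (S - (1 - chartProj n ι x₀ y) * S * chartProj n ι x₀ y,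
      tracePairing V _ (fderiv ℝ (chartProj n ι x₀) y) S) := by rw [← hL₁]; simp [L]
    rw [h1, Prod.mk_eq_zero, sub_eq_zero, eq_comm]
    refine and_congr Iff.rfl ?_
    rw [ContinuousLinearMap.ext_iff]
    rfl
  have hLs : ContDiffOn ℝ ∞ L φ.target := by
    have h1 := h.contDiffOn_chartProj x₀
    refine ContDiffOn.add (contDiffOn_const.clm_comp ?_) (contDiffOn_const.clm_comp
      (contDiff_tracePairing.comp_contDiffOn (h.contDiffOn_fderiv_chartProj x₀)))
    have h2 : ContDiff ℝ ∞ (ContinuousLinearMap.mul ℝ (V →L[ℝ] V)) := by fun_prop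
    have h3 : ContDiff ℝ ∞ (ContinuousLinearMap.mul ℝ (V →L[ℝ] V)).flip := by fun_prop
    exact contDiffOn_const.sub ((h2.comp_contDiffOn (contDiffOn_const.sub h1)).clm_comp
      (h3.comp_contDiffOn h1))
  obtain ⟨Y', hY't, hY'o, hY'0, e, he, heY⟩ := exists_frame_ker (isOpen_extChartAt_target x₀) hLs
    hker (d := 2 * n) (fun y _ => h.finrank_normalSpace _)
    (mem_extChartAt_target (I := 𝓡 (2 * n)) x₀)
  have hso : IsOpen φ.source := isOpen_extChartAt_source x₀
  have hφc : ContMDiffOn (𝓡 (2 * n)) 𝓘(ℝ, (EuclideanSpace ℝ (Fin (2 * n)))) ∞ φ φ.source := by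
    rw [hφ, extChartAt_source]
    exact contMDiffOn_extChartAt
  refine ⟨φ.source ∩ φ ⁻¹' Y', hφc.continuousOn.isOpen_inter_preimage hso hY'o,
    ⟨mem_extChartAt_source x₀, hY'0⟩, fun i x => e i (φ x), fun i => ?_, fun x hx => ?_⟩
  · exact (he i).contMDiffOn.comp (hφc.mono Set.inter_subset_left) Set.inter_subset_right
  · have h1 := heY (φ x) hx.2
    rwa [φ.left_inv hx.1] at h1

end IsFibration

end Charts

end GreatCircle

namespace GreatCircle

/-! ### The `C¹` topology, and `C¹` estimates on compact subsets of a vector space -/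

section COneNhds

variable {EM : Type*} [NormedAddCommGroup EM] [NormedSpace ℝ EM]
  {HM : Type*} [TopologicalSpace HM] {I : ModelWithCorners ℝ EM HM}
  {M : Type*} [TopologicalSpace M] [ChartedSpace HM M] [IsManifold I 1 M]
  {E : Type*} [NormedAddCommGroup E] [NormedSpace ℝ E]

theorem C1Close.mem_c1Nhds {K : Set (TangentBundle I M)} (hK : IsCompact K) {ε : ℝ} (hε : 0 < ε)
    (f : M → E) : {g | C1Close I K ε f g} ∈ c1Nhds I f :=
  Filter.mem_iInf_of_mem K <| Filter.mem_iInf_of_mem hK <| Filter.mem_iInf_of_mem ε <|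
    Filter.mem_iInf_of_mem hε (Filter.mem_principal_self _)

/-- Unions of compact sets and minima of tolerances show that the sets containing some `C1Close`
ball already form a filter, so finite intersections need not be considered. -/
theorem exists_C1Close_subset {f : M → E} {𝒪 : Set (M → E)} (h : 𝒪 ∈ c1Nhds I f) :
    ∃ K : Set (TangentBundle I M), IsCompact K ∧ ∃ ε > 0, ∀ g, C1Close I K ε f g → g ∈ 𝒪 := by
  let F : Filter (M → E) :=
    { sets := {s | ∃ K : Set (TangentBundle I M), IsCompact K ∧ ∃ ε > 0,
        ∀ g, C1Close I K ε f g → g ∈ s}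
      univ_sets := ⟨∅, isCompact_empty, 1, one_pos, fun _ _ => trivial⟩
      sets_of_superset := by
        rintro s t ⟨K, hK, ε, hε, hs⟩ hst
        exact ⟨K, hK, ε, hε, fun g hg => hst (hs g hg)⟩
      inter_sets := by
        rintro s t ⟨K, hK, ε, hε, hs⟩ ⟨K', hK', ε', hε', ht⟩
        refine ⟨K ∪ K', hK.union hK', min ε ε', lt_min hε hε', fun g hg => ⟨hs g ?_, ht g ?_⟩⟩
        · intro ξ hξ
          have := hg ξ (Or.inl hξ)
          exact ⟨this.1.trans_le (min_le_left _ _), this.2.trans_le (min_le_left _ _)⟩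
        · intro ξ hξ
          have := hg ξ (Or.inr hξ)
          exact ⟨this.1.trans_le (min_le_right _ _), this.2.trans_le (min_le_right _ _)⟩ }
  have h1 : F ≤ c1Nhds I f :=
    le_iInf fun K => le_iInf fun hK => le_iInf fun ε => le_iInf fun hε =>
      Filter.le_principal_iff.2 ⟨K, hK, ε, hε, fun g hg => hg⟩
  exact h1 h

theorem continuous_derivAlong {f : M → E} (hf : ContMDiff I 𝓘(ℝ, E) 1 f) :
    Continuous (derivAlong I f) := by
  have h1 := hf.continuous_tangentMap le_rfl
  exact ((contMDiff_snd_tangentBundle_modelSpace E 𝓘(ℝ, E) (n := 1)).continuous.comp h1 :)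

end COneNhds

section COneOn

variable {V W W' : Type*} [NormedAddCommGroup V] [NormedSpace ℝ V]
  [NormedAddCommGroup W] [NormedSpace ℝ W] [NormedAddCommGroup W'] [NormedSpace ℝ W']

/-- `F` and `G` are `δ`-close on `C`, together with their derivatives. -/
def C1On (C : Set V) (δ : ℝ) (F G : V → W) : Prop :=
  ∀ v ∈ C, ‖G v - F v‖ < δ ∧ ‖fderiv ℝ G v - fderiv ℝ F v‖ < δ

theorem C1On.mono {C C' : Set V} {δ δ' : ℝ} {F G : V → W} (h : C1On C δ F G) (hC : C' ⊆ C)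
    (hδ : δ ≤ δ') : C1On C' δ' F G := fun v hv =>
  ⟨(h v (hC hv)).1.trans_le hδ, (h v (hC hv)).2.trans_le hδ⟩

theorem C1On.congr {C : Set V} {δ : ℝ} {F G F' G' : V → W} (h : C1On C δ F G)
    (hF : ∀ v ∈ C, F =ᶠ[𝓝 v] F') (hG : ∀ v ∈ C, G =ᶠ[𝓝 v] G') : C1On C δ F' G' := fun v hv => by
  rw [← (hF v hv).eq_of_nhds, ← (hG v hv).eq_of_nhds, ← (hF v hv).fderiv_eq, ← (hG v hv).fderiv_eq]
  exact h v hv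

theorem C1On.prodMk {C : Set V} {δ : ℝ} {F G : V → W} {F' G' : V → W'} (h : C1On C δ F G)
    (h' : C1On C δ F' G') (hF : ∀ v ∈ C, DifferentiableAt ℝ F v)
    (hG : ∀ v ∈ C, DifferentiableAt ℝ G v) (hF' : ∀ v ∈ C, DifferentiableAt ℝ F' v)
    (hG' : ∀ v ∈ C, DifferentiableAt ℝ G' v) :
    C1On C δ (fun v => (F v, F' v)) (fun v => (G v, G' v)) := fun v hv => by
  refine ⟨max_lt (h v hv).1 (h' v hv).1, ?_⟩
  rw [(hF v hv).fderiv_prodMk (hF' v hv), (hG v hv).fderiv_prodMk (hG' v hv)]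
  have h1 : (fderiv ℝ G v).prod (fderiv ℝ G' v) - (fderiv ℝ F v).prod (fderiv ℝ F' v) =
      (fderiv ℝ G v - fderiv ℝ F v).prod (fderiv ℝ G' v - fderiv ℝ F' v) := by
    ext <;> rfl
  rw [h1, ContinuousLinearMap.opNorm_prod]
  exact max_lt (h v hv).2 (h' v hv).2

/-- Uniform continuity near the compact image of `F`, with the second point allowed to leave that
image. -/
theorem exists_forall_dist_lt {S : Type*} [TopologicalSpace S] {Y Z : Type*}
    [PseudoMetricSpace Y] [PseudoMetricSpace Z] {C : Set S} (hC : IsCompact C) {F : S → Y}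
    (hF : ContinuousOn F C) {J : Y → Z} (hJ : ∀ v ∈ C, ContinuousAt J (F v)) {ε : ℝ}
    (hε : 0 < ε) : ∃ δ > 0, ∀ v ∈ C, ∀ y, dist y (F v) < δ → dist (J y) (J (F v)) < ε := by
  have h1 := (hC.image_of_continuousOn hF).uniformContinuousAt_of_continuousAt J
    (by rintro _ ⟨v, hv, rfl⟩; exact hJ v hv) (Metric.dist_mem_uniformity hε)
  obtain ⟨δ, hδ, h2⟩ := Metric.mem_uniformity_dist.1 h1
  refine ⟨δ, hδ, fun v hv y hy => ?_⟩
  rw [dist_comm]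
  rw [dist_comm] at hy
  exact h2 hy ⟨v, hv, rfl⟩

theorem continuousOn_fderiv_of_contDiffAt {C : Set V} {F : V → W}
    (hF : ∀ v ∈ C, ContDiffAt ℝ 1 F v) : ContinuousOn (fderiv ℝ F) C := fun v hv =>
  ((hF v hv).fderiv_right (m := 0) le_rfl).continuousAt.continuousWithinAt

/-- Composition with a fixed `C¹` map is continuous for the `C¹` topology. -/
theorem exists_C1On_comp {C : Set V} (hC : IsCompact C) {F : V → W}
    (hF : ∀ v ∈ C, ContDiffAt ℝ 1 F v) {U : Set W} (hU : IsOpen U) (hFU : ∀ v ∈ C, F v ∈ U)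
    {H : W → W'} (hH : ContDiffOn ℝ 1 H U) {ε : ℝ} (hε : 0 < ε) :
    ∃ δ > 0, ∀ G : V → W, (∀ v ∈ C, DifferentiableAt ℝ G v) → C1On C δ F G →
      (∀ v ∈ C, G v ∈ U) ∧ C1On C ε (H ∘ F) (H ∘ G) := by
  have hFc : ContinuousOn F C := fun v hv => (hF v hv).continuousAt.continuousWithinAt
  have hHa : ∀ w ∈ U, ContDiffAt ℝ 1 H w := fun w hw => hH.contDiffAt (hU.mem_nhds hw)
  -- By the chain rule the one-jet of `H ∘ G` is this continuous function of the one-jet of `G`.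
  let J : W × (V →L[ℝ] W) → W' × (V →L[ℝ] W') := fun y => (H y.1, fderiv ℝ H y.1 ∘L y.2)
  obtain ⟨δ₁, hδ₁, h1⟩ := exists_forall_dist_lt hC
    (hFc.prodMk (continuousOn_fderiv_of_contDiffAt hF)) (J := J) (fun v hv => by
      have h2 := hHa _ (hFU v hv)
      have h3 : ContinuousAt (fderiv ℝ H) (F v) :=
        (h2.fderiv_right (m := 0) le_rfl).continuousAt
      have h4 : ContinuousAt (fun y : W × (V →L[ℝ] W) => fderiv ℝ H y.1) (F v, fderiv ℝ F v) :=
        ContinuousAt.comp (f := Prod.fst) h3 continuousAt_fst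
      have h5 : ContinuousAt (fun y : W × (V →L[ℝ] W) => H y.1) (F v, fderiv ℝ F v) :=
        ContinuousAt.comp (f := Prod.fst) h2.continuousAt continuousAt_fst
      exact h5.prodMk (h4.clm_comp continuousAt_snd)) hε
  obtain ⟨δ₂, hδ₂, h2⟩ := (hC.image_of_continuousOn hFc).exists_thickening_subset_open hU
    (by rintro _ ⟨v, hv, rfl⟩; exact hFU v hv)
  refine ⟨min δ₁ δ₂, lt_min hδ₁ hδ₂, fun G hG hFG => ?_⟩
  have hGU : ∀ v ∈ C, G v ∈ U := fun v hv => h2 (Metric.mem_thickening_iff.2 ⟨F v, ⟨v, hv, rfl⟩, by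
    rw [dist_eq_norm]; exact (hFG v hv).1.trans_le (min_le_right _ _)⟩)
  refine ⟨hGU, fun v hv => ?_⟩
  have h3 := h1 v hv (G v, fderiv ℝ G v) (by
    rw [Prod.dist_eq, dist_eq_norm, dist_eq_norm]
    exact max_lt ((hFG v hv).1.trans_le (min_le_left _ _))
      ((hFG v hv).2.trans_le (min_le_left _ _)))
  rw [Prod.dist_eq, max_lt_iff, dist_eq_norm, dist_eq_norm] at h3
  rw [fderiv_comp v ((hHa _ (hGU v hv)).differentiableAt one_ne_zero) (hG v hv),
    fderiv_comp v ((hHa _ (hFU v hv)).differentiableAt one_ne_zero)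
      ((hF v hv).differentiableAt one_ne_zero)]
  exact h3

/-- Composition with the inverse of a homeomorphism which is `C¹`-close to the identity. -/
theorem exists_C1On_comp_symm [CompleteSpace V] {C S : Set V} (hC : IsCompact C) (hSC : S ⊆ C)
    {a₀ : V → W} (ha₀ : ∀ v ∈ C, ContDiffAt ℝ 1 a₀ v) {ε : ℝ} (hε : 0 < ε) :
    ∃ δ > 0, ∀ (a : V → W) (Φ : V ≃ₜ V), (∀ v ∈ C, DifferentiableAt ℝ a v) →
      (∀ v ∈ S, Φ.symm v ∈ C) →
      (∀ v ∈ S, HasFDerivAt Φ.symm (Ring.inverse (fderiv ℝ Φ (Φ.symm v))) v) →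
      C1On C δ a₀ a → C1On C δ id Φ → C1On S ε a₀ (a ∘ Φ.symm) := by
  have hac : ContinuousOn a₀ C := fun v hv => (ha₀ v hv).continuousAt.continuousWithinAt
  have hac' := continuousOn_fderiv_of_contDiffAt ha₀
  let J : (W × (V →L[ℝ] W)) × (V →L[ℝ] V) → W × (V →L[ℝ] W) :=
    fun y => (y.1.1, y.1.2 ∘L Ring.inverse y.2)
  obtain ⟨δ₁, hδ₁, h1⟩ := exists_forall_dist_lt hC
    ((hac.prodMk hac').prodMk (continuousOn_const (c := (1 : V →L[ℝ] V)))) (J := J) (fun v hv => by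
      have h2 : ContinuousAt (Ring.inverse : (V →L[ℝ] V) → V →L[ℝ] V) 1 :=
        (contDiffAt_inverse_of_isUnit isUnit_one).continuousAt
      have h3 : ContinuousAt (fun y : (W × (V →L[ℝ] W)) × (V →L[ℝ] V) => Ring.inverse y.2)
          ((a₀ v, fderiv ℝ a₀ v), 1) :=
        ContinuousAt.comp (g := (Ring.inverse : (V →L[ℝ] V) → V →L[ℝ] V)) (f := Prod.snd) h2
          continuousAt_snd
      exact (continuousAt_fst.comp continuousAt_fst).prodMk
        ((continuousAt_snd.comp continuousAt_fst).clm_comp h3)) (half_pos hε)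
  have hu : UniformContinuousOn (fun v => (a₀ v, fderiv ℝ a₀ v)) C :=
    hC.uniformContinuousOn_of_continuous (hac.prodMk hac')
  obtain ⟨δ₂, hδ₂, h2⟩ := Metric.uniformContinuousOn_iff.1 hu (ε / 2) (half_pos hε)
  refine ⟨min δ₁ δ₂, lt_min hδ₁ hδ₂, fun a Φ ha hΦC hΦ haa hid v hv => ?_⟩
  have hw := hΦC v hv
  obtain ⟨w, hwv⟩ : ∃ w, w = Φ.symm v := ⟨_, rfl⟩
  have hD := hΦ v hv
  rw [← hwv] at hw hD
  have hvw : v = Φ w := by rw [hwv, Φ.apply_symm_apply]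
  have h3 := h1 w hw ((a w, fderiv ℝ a w), fderiv ℝ Φ w) (by
    have h4 := (hid w hw).2
    rw [fderiv_id] at h4
    rw [Prod.dist_eq, Prod.dist_eq, dist_eq_norm, dist_eq_norm, dist_eq_norm]
    exact max_lt (max_lt ((haa w hw).1.trans_le (min_le_left _ _))
      ((haa w hw).2.trans_le (min_le_left _ _))) (h4.trans_le (min_le_left _ _)))
  -- The jet of `a ∘ Φ⁻¹` at `v` is first compared with the jet of `a₀` at `w = Φ⁻¹ v`, and then
  -- that jet with the jet of `a₀` at `v` by uniform continuity.
  have h4 := h2 w hw v (hSC hv) (by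
    rw [dist_comm, dist_eq_norm, hvw]
    exact (hid w hw).1.trans_le (min_le_right _ _))
  have h5 : fderiv ℝ (a ∘ Φ.symm) v = fderiv ℝ a w ∘L Ring.inverse (fderiv ℝ Φ w) := by
    have h6 : HasFDerivAt a (fderiv ℝ a w) (Φ.symm v) := by
      rw [← hwv]; exact (ha w hw).hasFDerivAt
    exact (h6.comp v hD).fderiv
  have h7 : (a ∘ Φ.symm) v = a w := congrArg a hwv.symm
  have h8 : J ((a₀ w, fderiv ℝ a₀ w), 1) = (a₀ w, fderiv ℝ a₀ w) := by
    simp only [J, Ring.inverse_one]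
    rfl
  rw [h8] at h3
  have h9 := (dist_triangle _ _ _).trans_lt (add_lt_add h3 h4)
  rw [add_halves, Prod.dist_eq, max_lt_iff, dist_eq_norm, dist_eq_norm] at h9
  rw [h5, h7]
  exact h9

end COneOn

section Pullback

variable {EM : Type*} [NormedAddCommGroup EM] [NormedSpace ℝ EM]
  {HM : Type*} [TopologicalSpace HM] {I : ModelWithCorners ℝ EM HM}
  {M : Type*} [TopologicalSpace M] [ChartedSpace HM M] [IsManifold I 1 M]
  {E : Type*} [NormedAddCommGroup E] [NormedSpace ℝ E]
  {V : Type*} [NormedAddCommGroup V] [NormedSpace ℝ V] {r : V → M}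

theorem fderiv_comp_eq_derivAlong {f : M → E} {v : V} (hf : MDifferentiableAt I 𝓘(ℝ, E) f (r v))
    (hr : MDifferentiableAt 𝓘(ℝ, V) I r v) (w : V) :
    fderiv ℝ (f ∘ r) v w = derivAlong I f ⟨r v, mfderiv 𝓘(ℝ, V) I r v w⟩ := by
  rw [← mfderiv_eq_fderiv, mfderiv_comp v hf hr]
  rfl

/-- The test set is the compact image, under the tangent map of `r`, of `C` times the closed unit
ball; it controls the operator norm of the pulled-back derivative. -/
theorem C1On_comp_mem_c1Nhds [FiniteDimensional ℝ V] {U C : Set V} (hU : IsOpen U)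
    (hr : ContMDiffOn 𝓘(ℝ, V) I 1 r U) (hC : IsCompact C) (hCU : C ⊆ U) {f : M → E}
    (hf : MDifferentiable I 𝓘(ℝ, E) f) {δ : ℝ} (hδ : 0 < δ) :
    {g | MDifferentiable I 𝓘(ℝ, E) g → C1On C δ (f ∘ r) (g ∘ r)} ∈ c1Nhds I f := by
  have h1 := hr.continuousOn_tangentMapWithin le_rfl hU.uniqueMDiffOn
  have h2 : Continuous fun y : V × V => (⟨y.1, y.2⟩ : TangentBundle 𝓘(ℝ, V) V) :=
    (tangentBundleModelSpaceHomeomorph 𝓘(ℝ, V)).symm.continuous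
  have h3 : ContinuousOn (fun y : V × V => tangentMapWithin 𝓘(ℝ, V) I r U ⟨y.1, y.2⟩)
      (C ×ˢ Metric.closedBall 0 1) :=
    h1.comp h2.continuousOn fun y hy => hCU hy.1
  have hK := (hC.prod (isCompact_closedBall (0 : V) 1)).image_of_continuousOn h3
  refine Filter.mem_of_superset (C1Close.mem_c1Nhds hK (half_pos hδ) f) fun g hg hgd v hv => ?_
  have hrd : MDifferentiableAt 𝓘(ℝ, V) I r v :=
    (hr.contMDiffAt (hU.mem_nhds (hCU hv))).mdifferentiableAt one_ne_zero
  have h4 : ∀ w : V, ‖w‖ ≤ 1 → tangentMapWithin 𝓘(ℝ, V) I r U ⟨v, w⟩ ∈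
      (fun y : V × V => tangentMapWithin 𝓘(ℝ, V) I r U ⟨y.1, y.2⟩) ''
        (C ×ˢ Metric.closedBall 0 1) := fun w hw =>
    ⟨(v, w), ⟨hv, mem_closedBall_zero_iff.2 hw⟩, rfl⟩
  refine ⟨(hg _ (h4 0 (by simp))).1.trans (half_lt_self hδ), ?_⟩
  refine lt_of_le_of_lt (ContinuousLinearMap.opNorm_le_of_unit_norm (half_pos hδ).le
    fun w hw => ?_) (half_lt_self hδ)
  have h5 := (hg _ (h4 w hw.le)).2
  rw [sub_apply, fderiv_comp_eq_derivAlong (hgd _) hrd, fderiv_comp_eq_derivAlong (hf _) hrd]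
  have h6 : tangentMapWithin 𝓘(ℝ, V) I r U ⟨v, w⟩ =
      ⟨r v, mfderiv 𝓘(ℝ, V) I r v w⟩ := by
    rw [← mfderivWithin_of_isOpen hU (hCU hv)]
    rfl
  rw [h6] at h5
  exact h5.le

/-- Estimates for the pullback descend to `M` once compact sets of tangent vectors lift to vectors
of bounded length over `C`. -/
theorem exists_C1On_of_mem_c1Nhds {C : Set V} (hr : ∀ v ∈ C, MDifferentiableAt 𝓘(ℝ, V) I r v)
    {f : M → E} (hf : MDifferentiable I 𝓘(ℝ, E) f)
    (hlift : ∀ K : Set (TangentBundle I M), IsCompact K → ∃ R : ℝ, ∀ ξ ∈ K, ∃ v ∈ C, ∃ w : V,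
      ‖w‖ ≤ R ∧ (⟨r v, mfderiv 𝓘(ℝ, V) I r v w⟩ : TangentBundle I M) = ξ)
    {𝒪 : Set (M → E)} (h𝒪 : 𝒪 ∈ c1Nhds I f) :
    ∃ δ > 0, ∀ g, MDifferentiable I 𝓘(ℝ, E) g → C1On C δ (f ∘ r) (g ∘ r) → g ∈ 𝒪 := by
  obtain ⟨K, hK, ε, hε, hKε⟩ := exists_C1Close_subset h𝒪
  obtain ⟨R, hR⟩ := hlift K hK
  refine ⟨ε / (|R| + 1), by positivity, fun g hg hfg => hKε g fun ξ hξ => ?_⟩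
  obtain ⟨v, hv, w, hw, rfl⟩ := hR ξ hξ
  have h1 := hfg v hv
  have hle : ε / (|R| + 1) ≤ ε := div_le_self hε.le (by linarith [abs_nonneg R])
  refine ⟨h1.1.trans_le hle, ?_⟩
  rw [← fderiv_comp_eq_derivAlong (hg _) (hr v hv), ← fderiv_comp_eq_derivAlong (hf _) (hr v hv),
    ← sub_apply]
  have h2 : ‖(fderiv ℝ (g ∘ r) v - fderiv ℝ (f ∘ r) v) w‖ ≤ ε / (|R| + 1) * |R| :=
    (ContinuousLinearMap.le_opNorm _ _).trans (mul_le_mul h1.2.le (hw.trans (le_abs_self R))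
      (norm_nonneg _) (by positivity))
  refine h2.trans_lt ?_
  rw [div_mul_eq_mul_div, div_lt_iff₀ (by positivity)]
  nlinarith [abs_nonneg R]

end Pullback

end GreatCircle

namespace GreatCircle

/-! ### Homogeneous maps of degree one near the identity -/

section Homogeneous

variable {V W : Type*} [NormedAddCommGroup V] [NormedSpace ℝ V]
  [NormedAddCommGroup W] [NormedSpace ℝ W]

theorem fderiv_smul_eq_of_homogeneous {g : V → W}
    (hg : ∀ c : ℝ, 0 < c → ∀ v, g (c • v) = c • g v) {c : ℝ} (hc : 0 < c) (v : V) :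
    fderiv ℝ g (c • v) = fderiv ℝ g v := by
  have h1 := fderiv_comp_smul (𝕜 := ℝ) (f := g) (x := v) c
  have h2 : (fun x => g (c • x)) = c • g := funext fun x => hg c hc x
  rw [h2, fderiv_const_smul_field] at h1
  exact (smul_right_injective _ hc.ne' h1).symm

theorem norm_fderiv_le_of_homogeneous {g : V → W}
    (hg : ∀ c : ℝ, 0 < c → ∀ v, g (c • v) = c • g v) {b : ℝ}
    (hb : ∀ v, ‖v‖ = 1 → ‖fderiv ℝ g v‖ ≤ b) {v : V} (hv : v ≠ 0) : ‖fderiv ℝ g v‖ ≤ b := by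
  have hn : 0 < ‖v‖ := norm_pos_iff.2 hv
  have h1 := fderiv_smul_eq_of_homogeneous hg (inv_pos.2 hn) v
  rw [← h1]
  exact hb _ (by rw [norm_smul, norm_inv, norm_norm, inv_mul_cancel₀ hn.ne'])

/-- Euler's identity `g v = Dg(v) v`; the derivative is homogeneous of degree zero, so its bound on
the sphere holds at all nonzero vectors. -/
theorem norm_le_of_homogeneous {g : V → W} (hd : ∀ v ≠ 0, DifferentiableAt ℝ g v)
    (hg : ∀ c : ℝ, 0 < c → ∀ v, g (c • v) = c • g v) {b : ℝ}
    (hb : ∀ v, ‖v‖ = 1 → ‖fderiv ℝ g v‖ ≤ b) (v : V) : ‖g v‖ ≤ b * ‖v‖ := by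
  by_cases hv : v = 0
  · have h1 := hg 2 two_pos 0
    rw [smul_zero, two_smul] at h1
    have h2 : g 0 = 0 := by simpa using h1.symm
    simp [hv, h2]
  · have h1 : HasDerivAt (fun c : ℝ => c • v) v 1 := by
      simpa using (hasDerivAt_id (1 : ℝ)).smul_const v
    have h0 : HasFDerivAt g (fderiv ℝ g v) ((1 : ℝ) • v) := by
      rw [one_smul]; exact (hd v hv).hasFDerivAt
    have h2 := h0.comp_hasDerivAt (1 : ℝ) h1
    have h3 : HasDerivAt (fun c : ℝ => c • g v) (g v) 1 := by
      simpa using (hasDerivAt_id (1 : ℝ)).smul_const (g v)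
    have h4 : (g ∘ fun c : ℝ => c • v) =ᶠ[𝓝 1] fun c => c • g v := by
      filter_upwards [lt_mem_nhds (zero_lt_one' ℝ)] with c hc
      exact hg c hc v
    rw [(h3.congr_of_eventuallyEq h4).unique h2]
    exact ((fderiv ℝ g v).le_opNorm v).trans
      (mul_le_mul_of_nonneg_right (norm_fderiv_le_of_homogeneous hg hb hv) (norm_nonneg v))

/-- A homogeneous map with small derivative on the unit sphere is Lipschitz. -/
theorem norm_sub_le_of_homogeneous {g : V → W} (hd : ∀ v ≠ 0, DifferentiableAt ℝ g v)
    (hg : ∀ c : ℝ, 0 < c → ∀ v, g (c • v) = c • g v) {b : ℝ}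
    (hb : ∀ v, ‖v‖ = 1 → ‖fderiv ℝ g v‖ ≤ b) (x y : V) : ‖g x - g y‖ ≤ b * ‖x - y‖ := by
  -- The mean value inequality needs a segment avoiding `0`, where `g` may fail to be
  -- differentiable. On a segment through `0`, the lengths of `x` and `y` add up to the distance.
  by_cases h0 : (0 : V) ∈ segment ℝ y x
  · have h1 := dist_add_dist_of_mem_segment h0
    rw [dist_zero_right, dist_zero_left, dist_eq_norm, norm_sub_rev] at h1
    rw [← h1, mul_add, add_comm]
    exact (norm_sub_le _ _).trans
      (add_le_add (norm_le_of_homogeneous hd hg hb x) (norm_le_of_homogeneous hd hg hb y))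
  · have h1 : ∀ z ∈ segment ℝ y x, z ≠ 0 := fun z hz hz0 => h0 (hz0 ▸ hz)
    exact Convex.norm_image_sub_le_of_norm_fderiv_le (𝕜 := ℝ) (fun z hz => hd z (h1 z hz))
      (fun z hz => norm_fderiv_le_of_homogeneous hg hb (h1 z hz)) (convex_segment _ _)
      (left_mem_segment ℝ _ _) (right_mem_segment ℝ _ _)

/-- A homogeneous map which is `C¹`-close to the identity on the unit sphere is a homeomorphism,
and a diffeomorphism away from the origin. -/
theorem exists_homeomorph_of_homogeneous [CompleteSpace V] {Ψ : V → V}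
    (hd : ∀ v ≠ 0, DifferentiableAt ℝ Ψ v) (hΨ : ∀ c : ℝ, 0 < c → ∀ v, Ψ (c • v) = c • Ψ v)
    (hb : ∀ v, ‖v‖ = 1 → ‖fderiv ℝ Ψ v - 1‖ ≤ 1 / 2) :
    ∃ Φ : V ≃ₜ V, ⇑Φ = Ψ ∧ (∀ v, ‖Φ v - v‖ ≤ 1 / 2 * ‖v‖) ∧
      (∀ v ≠ 0, HasFDerivAt Φ.symm (Ring.inverse (fderiv ℝ Φ (Φ.symm v))) v) ∧
      ∀ (k : WithTop ℕ∞), (∀ v ≠ 0, ContDiffAt ℝ k Φ v) → ∀ v ≠ 0, ContDiffAt ℝ k Φ.symm v := by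
  have hdg : ∀ v ≠ 0, DifferentiableAt ℝ (fun v => Ψ v - v) v := fun v hv =>
    (hd v hv).sub differentiableAt_id
  have hg : ∀ c : ℝ, 0 < c → ∀ v, (fun v => Ψ v - v) (c • v) = c • (fun v => Ψ v - v) v :=
    fun c hc v => by simp only [hΨ c hc, smul_sub]
  have hfd : ∀ v ≠ 0, fderiv ℝ (fun v => Ψ v - v) v = fderiv ℝ Ψ v - 1 := fun v hv => by
    exact ((hd v hv).hasFDerivAt.sub (hasFDerivAt_id v)).fderiv
  have hbg : ∀ v, ‖v‖ = 1 → ‖fderiv ℝ (fun v => Ψ v - v) v‖ ≤ 1 / 2 := fun v hv => by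
    rw [hfd v (norm_ne_zero_iff.1 (by rw [hv]; exact one_ne_zero))]
    exact hb v hv
  -- The difference `Ψ - id` is Lipschitz with constant `1/2 < 1`, which makes `Ψ` a homeomorphism
  -- of all of `V`, even though `0` may be singular.
  have h1 : ApproximatesLinearOn Ψ (ContinuousLinearEquiv.refl ℝ V : V →L[ℝ] V) Set.univ
      (1 / 2 : NNReal) := fun x _ y _ => by
    have h2 := norm_sub_le_of_homogeneous hdg hg hbg x y
    have h3 : Ψ x - Ψ y - (ContinuousLinearEquiv.refl ℝ V : V →L[ℝ] V) (x - y) =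
      Ψ x - x - (Ψ y - y) := by simp; abel
    rw [h3]
    simpa using h2
  have h2 : Subsingleton V ∨
      (1 / 2 : NNReal) < ‖((ContinuousLinearEquiv.refl ℝ V).symm : V →L[ℝ] V)‖₊⁻¹ := by
    rcases subsingleton_or_nontrivial V with h | h
    · exact Or.inl h
    · refine Or.inr ?_
      have h3 : ‖((ContinuousLinearEquiv.refl ℝ V).symm : V →L[ℝ] V)‖₊ = 1 :=
        NNReal.eq (ContinuousLinearMap.norm_id (𝕜 := ℝ) (E := V))
      rw [h3, inv_one]
      exact NNReal.half_lt_self one_ne_zero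
  obtain ⟨Φ, hΦ⟩ : ∃ Φ : V ≃ₜ V, ⇑Φ = Ψ := ⟨h1.toHomeomorph Ψ h2, rfl⟩
  have hn : ∀ v, ‖Φ v - v‖ ≤ 1 / 2 * ‖v‖ := fun v => by
    rw [hΦ]; exact norm_le_of_homogeneous hdg hg hbg v
  have hs : ∀ v ≠ 0, Φ.symm v ≠ 0 := fun v hv h0 => by
    have h3 := hn (Φ.symm v)
    rw [h0] at h3
    rw [← h0, Φ.apply_symm_apply, h0] at h3
    simp only [sub_zero, norm_zero, mul_zero, norm_le_zero_iff] at h3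
    exact hv h3
  have hu : ∀ v ≠ 0, IsUnit (fderiv ℝ Φ v) := fun v hv => by
    have h3 : ‖1 - fderiv ℝ Φ v‖ < 1 := by
      rw [norm_sub_rev, hΦ, ← hfd v hv]
      exact (norm_fderiv_le_of_homogeneous hg hbg hv).trans_lt (by norm_num)
    simpa using isUnit_one_sub_of_norm_lt_one h3
  refine ⟨Φ, hΦ, hn, fun v hv => ?_, fun k hk v hv => ?_⟩
  · obtain ⟨u, hu⟩ := hu _ (hs v hv)
    rw [← hu, Ring.inverse_unit]
    refine Φ.toOpenPartialHomeomorph.hasFDerivAt_symm (f' := ContinuousLinearEquiv.ofUnit u)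
      (Set.mem_univ v) ?_
    have h3 : DifferentiableAt ℝ Φ (Φ.symm v) := by rw [hΦ]; exact hd _ (hs v hv)
    have h4 := h3.hasFDerivAt
    rw [← hu] at h4
    exact h4
  · obtain ⟨u, hu⟩ := hu _ (hs v hv)
    refine Φ.toOpenPartialHomeomorph.contDiffAt_symm (f₀' := ContinuousLinearEquiv.ofUnit u)
      (Set.mem_univ v) ?_ (hk _ (hs v hv))
    have h3 : DifferentiableAt ℝ Φ (Φ.symm v) := by rw [hΦ]; exact hd _ (hs v hv)
    have h4 := h3.hasFDerivAt
    rw [← hu] at h4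
    exact h4

end Homogeneous

/-! ### Transporting a fibration to nearby planes -/

section Diffeo

variable {n : ℕ} {V : Type v} [NormedAddCommGroup V] [InnerProductSpace ℝ V]
  [FiniteDimensional ℝ V] [Fact (Module.finrank ℝ V = (2 * n + 1) + 1)] [Nontrivial V]
  {X : Type u} [TopologicalSpace X] [ChartedSpace (EuclideanSpace ℝ (Fin (2 * n))) X]
  {π : Metric.sphere (0 : V) 1 → X} {ι : X → OrientedPlane V} {k : WithTop ℕ∞}

theorem surjective_mfderiv_of_radial {p : Metric.sphere (0 : V) 1}
    (hπ : MDifferentiableAt (𝓡 (2 * n + 1)) (𝓡 (2 * n)) π p)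
    (h : Function.Surjective (mfderiv 𝓘(ℝ, V) (𝓡 (2 * n)) (fun w => π (unitVec w)) (p : V))) :
    Function.Surjective (mfderiv (𝓡 (2 * n + 1)) (𝓡 (2 * n)) π p) := by
  have h0 : (p : V) ≠ 0 := sphere_coe_ne_zero p
  have hu : MDifferentiableAt 𝓘(ℝ, V) (𝓡 (2 * n + 1)) unitVec (p : V) :=
    (contMDiffAt_unitVec (k := 1) h0).mdifferentiableAt one_ne_zero
  have hπ' : MDifferentiableAt (𝓡 (2 * n + 1)) (𝓡 (2 * n)) π (unitVec (p : V)) := by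
    rwa [unitVec_coe]
  have h1 := mfderiv_comp (p : V) hπ' hu
  have h3 : ∀ q, q = p → Function.Surjective
      (mfderiv (𝓡 (2 * n + 1)) (𝓡 (2 * n)) π q) →
      Function.Surjective (mfderiv (𝓡 (2 * n + 1)) (𝓡 (2 * n)) π p) := by
    rintro q rfl; exact id
  refine h3 _ (unitVec_coe p) fun ξ => ?_
  obtain ⟨w, hw⟩ := h ξ
  exact ⟨_, (DFunLike.congr_fun h1 w).symm.trans hw⟩

/-- Surjectivity and submersivity are automatic: planes contain nonzero vectors, and their
velocities lift every tangent vector. -/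
theorem IsFibration.isGreatCircleFibration (h : IsFibration n k π ι) :
    IsGreatCircleFibration n k π ι where
  contMDiff_proj := h.contMDiff_proj
  surjective x := by
    obtain ⟨v, hv, hv0⟩ := (ι x).exists_ne_zero
    exact ⟨unitVec v, (h.fibred.radial_eq_iff hv0).2 hv⟩
  submersion p := by
    refine surjective_mfderiv_of_radial (h.contMDiff_proj.mdifferentiable h.ne_zero p) fun ξ => ?_
    have h1 : (p : V) ∈ (ι (π (unitVec (p : V)))).plane :=
      (h.fibred.radial_eq_iff (sphere_coe_ne_zero p)).1 rfl
    exact ⟨_, h.mfderiv_radial_projDeriv (sphere_coe_ne_zero p) h1 ξ⟩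
  fiber := h.fibred
  contMDiff_plane := h.contMDiff_rot

theorem IsFibration.contDiffAt_comp_radial (h : IsFibration n k π ι) {E : Type*}
    [NormedAddCommGroup E] [NormedSpace ℝ E] {f : X → E}
    (hf : ContMDiff (𝓡 (2 * n)) 𝓘(ℝ, E) k f) {v : V} (hv : v ≠ 0) :
    ContDiffAt ℝ k (fun w => f (π (unitVec w))) v :=
  contMDiffAt_iff_contDiffAt.1 ((hf _).comp v (contMDiffAt_radial h.contMDiff_proj hv))

/-- If the map which projects each fibre of a fibration to a nearby plane is `C¹`-close to the
identity, then the nearby planes are the fibres of a fibration. -/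
theorem IsFibration.exists_fibration [IsManifold (𝓡 (2 * n)) 1 X]
    (h : IsFibration n k π ι) {f : X → OrientedPlane V}
    (hf : ContMDiff (𝓡 (2 * n)) 𝓘(ℝ, V →L[ℝ] V) k (fun x => rot (f x)))
    (hb : ∀ v : V, ‖v‖ = 1 →
      ‖fderiv ℝ (fun w => (f (π (unitVec w))).plane.starProjection w) v - 1‖ ≤ 1 / 2) :
    ∃ (Φ : V ≃ₜ V) (π' : Metric.sphere (0 : V) 1 → X), IsFibration n k π' f ∧
      (∀ v, Φ v = (f (π (unitVec v))).plane.starProjection v) ∧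
      (∀ v ≠ 0, π' (unitVec v) = π (unitVec (Φ.symm v))) ∧
      (∀ v, ‖Φ v - v‖ ≤ 1 / 2 * ‖v‖) ∧
      (∀ v ≠ 0, HasFDerivAt Φ.symm (Ring.inverse (fderiv ℝ Φ (Φ.symm v))) v) := by
  obtain ⟨Ψ, hΨ⟩ : ∃ Ψ : V → V, Ψ = fun w => (f (π (unitVec w))).plane.starProjection w :=
    ⟨_, rfl⟩
  have hΨk : ∀ v ≠ 0, ContDiffAt ℝ k Ψ v := fun v hv => by
    have h1 : ContDiff ℝ k (planeProj : (V →L[ℝ] V) → V →L[ℝ] V) :=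
      (contDiff_id.mul contDiff_id).neg
    have h2 := h1.contDiffAt.comp v (h.contDiffAt_comp_radial hf hv)
    simp only [Function.comp_def, planeProj_rot] at h2
    rw [hΨ]
    exact h2.clm_apply contDiffAt_id
  rw [← hΨ] at hb
  have hhom : ∀ c : ℝ, 0 < c → ∀ v, Ψ (c • v) = c • Ψ v := fun c hc v => by
    by_cases hv : v = 0
    · simp [hv, hΨ]
    · simp only [hΨ, unitVec_smul hc hv, map_smul]
  obtain ⟨Φ, hΦ, hn, hD, hC⟩ := exists_homeomorph_of_homogeneous
    (fun v hv => (hΨk v hv).differentiableAt h.ne_zero) hhom hb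
  have hΦv : ∀ v, Φ v = (f (π (unitVec v))).plane.starProjection v := fun v => by
    rw [hΦ, hΨ]
  have hΦ0 : Φ 0 = 0 := by simp [hΦv]
  have hs : ∀ v ≠ 0, Φ.symm v ≠ 0 := fun v hv h0 => hv (by
    rw [← Φ.apply_symm_apply v, h0, hΦ0])
  -- Although `Φ` is nonlinear, on each single plane `ι x` it is the linear projection to `f x`.
  have hΦplane : ∀ x, ∀ v ∈ (ι x).plane, Φ v = (f x).plane.starProjection v := fun x v hv => by
    by_cases hv0 : v = 0
    · simp [hv0, hΦ0]
    · rw [hΦv, (h.fibred.radial_eq_iff hv0).2 hv]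
  have hfib : ∀ v ≠ 0, ∀ x, π (unitVec (Φ.symm v)) = x ↔ v ∈ (f x).plane := fun v hv x => by
    constructor
    · rintro rfl
      have h1 := hΦv (Φ.symm v)
      rw [Φ.apply_symm_apply] at h1
      have h2 := Submodule.starProjection_apply_mem (f (π (unitVec (Φ.symm v)))).plane (Φ.symm v)
      rwa [← h1] at h2
    · intro hvx
      -- This linear map inherits injectivity from `Φ`, and between planes it is then onto; so `Φ`
      -- carries `ι x` onto `f x`.
      let T : (ι x).plane →ₗ[ℝ] (f x).plane :=
        ((f x).plane.orthogonalProjectionOnto : V →ₗ[ℝ] (f x).plane) ∘ₗ (ι x).plane.subtype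
      have hT : ∀ w : (ι x).plane, (T w : V) = Φ w := fun w => (hΦplane x w w.2).symm
      have hTi : Function.Injective T := fun w z hwz =>
        Subtype.ext (Φ.injective (by rw [← hT, ← hT, hwz]))
      obtain ⟨w, hw⟩ := (LinearMap.injective_iff_surjective_of_finrank_eq_finrank
        ((ι x).finrank_plane.trans (f x).finrank_plane.symm)).1 hTi ⟨v, hvx⟩
      have h1 : Φ w = v := by rw [← hT, hw]
      have h2 : Φ.symm v = w := by rw [← h1, Φ.symm_apply_apply]
      rw [h.fibred.radial_eq_iff (hs v hv), h2]
      exact w.2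
  refine ⟨Φ, fun p => π (unitVec (Φ.symm p)), ⟨h.one_le, fun p x => hfib p (sphere_coe_ne_zero p) x,
    fun p => ?_, hf⟩, hΦv, fun v hv => ?_, hn, hD⟩
  · have h0 := sphere_coe_ne_zero p
    have h1 : ContMDiffAt 𝓘(ℝ, V) 𝓘(ℝ, V) k Φ.symm (p : V) :=
      (hC k (by rw [hΦ]; exact hΨk) p h0).contMDiffAt
    have h2 := (contMDiffAt_radial h.contMDiff_proj (hs p h0)).comp (p : V) h1
    exact h2.comp p (contMDiff_coe_sphere (n := 2 * n + 1)).contMDiffAt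
  · exact (hfib _ (sphere_coe_ne_zero (unitVec v)) _).2
      ((unitVec_mem hv).2 ((hfib v hv _).1 rfl))

end Diffeo

end GreatCircle

namespace GreatCircle

/-! ### Smoothness of the graph coordinates -/

section Smooth

variable {V : Type v} [NormedAddCommGroup V] [InnerProductSpace ℝ V] [FiniteDimensional ℝ V]

/-- The pairs `(A, S)` at which `graphRot` is given by a smooth formula. -/
def graphRotDomain (V : Type v) [NormedAddCommGroup V] [InnerProductSpace ℝ V]
    [FiniteDimensional ℝ V] : Set ((V →L[ℝ] V) × (V →L[ℝ] V)) :=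
  {y | 0 < -(1 / 2) * opTrace (graphSkew y.1 y.2 * graphSkew y.1 y.2)}

theorem contDiff_planeProj {k : WithTop ℕ∞} :
    ContDiff ℝ k (planeProj : (V →L[ℝ] V) → V →L[ℝ] V) :=
  (contDiff_id.mul contDiff_id).neg

theorem contDiff_graphSkew {k : WithTop ℕ∞} :
    ContDiff ℝ k (fun y : (V →L[ℝ] V) × (V →L[ℝ] V) => graphSkew y.1 y.2) := by
  have h1 : ContDiff ℝ k (fun y : (V →L[ℝ] V) × (V →L[ℝ] V) => planeProj y.1) :=
    contDiff_planeProj.comp contDiff_fst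
  have h2 : ContDiff ℝ k (fun y : (V →L[ℝ] V) × (V →L[ℝ] V) => graphOp y.1 y.2) :=
    h1.add (((contDiff_const.sub h1).mul contDiff_snd).mul h1)
  have h3 : ContDiff ℝ k (fun T : V →L[ℝ] V => star T) :=
    (starL' ℝ : (V →L[ℝ] V) ≃L[ℝ] (V →L[ℝ] V)).contDiff
  exact (h2.mul contDiff_fst).mul (h3.comp h2)

theorem contDiff_opTrace_graphSkew {k : WithTop ℕ∞} :
    ContDiff ℝ k (fun y : (V →L[ℝ] V) × (V →L[ℝ] V) =>
      -(1 / 2) * opTrace (graphSkew y.1 y.2 * graphSkew y.1 y.2)) :=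
  contDiff_const.mul ((opTrace : (V →L[ℝ] V) →L[ℝ] ℝ).contDiff.comp
    (contDiff_graphSkew.mul contDiff_graphSkew))

theorem isOpen_graphRotDomain : IsOpen (graphRotDomain V) :=
  isOpen_lt continuous_const (contDiff_opTrace_graphSkew (k := 0)).continuous

theorem contDiffOn_graphRot {k : WithTop ℕ∞} :
    ContDiffOn ℝ k (fun y : (V →L[ℝ] V) × (V →L[ℝ] V) => graphRot y.1 y.2)
      (graphRotDomain V) := by
  intro y hy
  have h1 := (contDiff_opTrace_graphSkew (V := V) (k := k)).contDiffAt (x := y)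
  exact (((h1.sqrt hy.ne').inv (Real.sqrt_pos.2 hy).ne').smul
    contDiff_graphSkew.contDiffAt).contDiffWithinAt

/-- Otherwise the square root is `0`, its inverse is `0` by convention, and `graphRot` would vanish,
against the trace `-2` of its square. -/
theorem mem_graphRotDomain (P : OrientedPlane V) (S : V →L[ℝ] V) :
    (rot P, S) ∈ graphRotDomain V := by
  by_contra h0
  have h1 : √(-(1 / 2) * opTrace (graphSkew (rot P) S * graphSkew (rot P) S)) = 0 :=
    Real.sqrt_eq_zero_of_nonpos (not_lt.1 h0)
  have h2 := opTrace_rot_mul_rot (graph P S)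
  rw [rot_graph, graphRot, h1] at h2
  simp at h2

/-- The pairs `(A, A')` at which `graphCoord` is given by a smooth formula and represents `A'`. -/
def graphCoordDomain (V : Type v) [NormedAddCommGroup V] [InnerProductSpace ℝ V]
    [FiniteDimensional ℝ V] : Set ((V →L[ℝ] V) × (V →L[ℝ] V)) :=
  {y | opTrace (y.2 * y.1) < 0}

theorem contDiff_opTrace_mul {k : WithTop ℕ∞} :
    ContDiff ℝ k (fun y : (V →L[ℝ] V) × (V →L[ℝ] V) => opTrace (y.2 * y.1)) :=
  (opTrace : (V →L[ℝ] V) →L[ℝ] ℝ).contDiff.comp (contDiff_snd.mul contDiff_fst)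

theorem isOpen_graphCoordDomain : IsOpen (graphCoordDomain V) :=
  isOpen_lt (contDiff_opTrace_mul (k := 0)).continuous continuous_const

theorem contDiffOn_graphCoord {k : WithTop ℕ∞} :
    ContDiffOn ℝ k (fun y : (V →L[ℝ] V) × (V →L[ℝ] V) => graphCoord y.1 y.2)
      (graphCoordDomain V) := by
  intro y hy
  have h1 : ContDiff ℝ k (fun y : (V →L[ℝ] V) × (V →L[ℝ] V) => planeProj y.1) :=
    contDiff_planeProj.comp contDiff_fst
  exact ((contDiffAt_const.div (contDiff_opTrace_mul (V := V) (k := k)).contDiffAt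
    (ne_of_lt hy)).smul (((contDiff_const.sub h1).mul contDiff_snd).mul
      contDiff_fst).contDiffAt).contDiffWithinAt

theorem mem_graphCoordDomain (P : OrientedPlane V) : (rot P, rot P) ∈ graphCoordDomain V := by
  show opTrace (rot P * rot P) < 0
  rw [opTrace_rot_mul_rot]
  norm_num

end Smooth

/-- A compact neighbourhood of the unit sphere which does not contain the origin. -/
def annulus (V : Type v) [NormedAddCommGroup V] : Set V :=
  Metric.closedBall 0 2 \ Metric.ball 0 (1 / 2)

section Annulus

variable {V : Type v} [NormedAddCommGroup V] [InnerProductSpace ℝ V] [FiniteDimensional ℝ V]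

theorem mem_annulus {v : V} : v ∈ annulus V ↔ ‖v‖ ≤ 2 ∧ 1 / 2 ≤ ‖v‖ := by
  rw [annulus, Set.mem_sdiff, mem_closedBall_zero_iff, mem_ball_zero_iff, not_lt]

theorem isCompact_annulus : IsCompact (annulus V) :=
  (isCompact_closedBall 0 2).diff Metric.isOpen_ball

theorem ne_zero_of_mem_annulus {v : V} (hv : v ∈ annulus V) : v ≠ 0 := by
  rintro rfl
  have := (mem_annulus.1 hv).2
  rw [norm_zero] at this
  norm_num at this

theorem sphere_subset_annulus : Metric.sphere (0 : V) 1 ⊆ annulus V := fun v hv => by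
  have h : ‖v‖ = 1 := mem_sphere_zero_iff_norm.1 hv
  rw [mem_annulus, h]
  norm_num

theorem symm_mem_annulus {Φ : V ≃ₜ V} (h : ∀ v, ‖Φ v - v‖ ≤ 1 / 2 * ‖v‖) {v : V}
    (hv : v ∈ Metric.sphere (0 : V) 1) : Φ.symm v ∈ annulus V := by
  have hv1 : ‖v‖ = 1 := mem_sphere_zero_iff_norm.1 hv
  have h1 := h (Φ.symm v)
  rw [Φ.apply_symm_apply] at h1
  have h2 := norm_sub_norm_le v (Φ.symm v)
  have h3 := norm_sub_norm_le (Φ.symm v) v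
  rw [norm_sub_rev] at h3
  rw [mem_annulus]
  constructor <;> linarith

end Annulus

/-! ### Small motions of the base -/

section SmallMotion

variable {n : ℕ} {V : Type v} [NormedAddCommGroup V] [InnerProductSpace ℝ V]
  [FiniteDimensional ℝ V] [Fact (Module.finrank ℝ V = (2 * n + 1) + 1)] [Nontrivial V]
  {X : Type u} [TopologicalSpace X] [ChartedSpace (EuclideanSpace ℝ (Fin (2 * n))) X]
  [IsManifold (𝓡 (2 * n)) ∞ X]
  {π : Metric.sphere (0 : V) 1 → X} {ι : X → OrientedPlane V} {k : WithTop ℕ∞}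

/-- The family of planes of a fibration, as operators, along the fibres of the fibration. -/
noncomputable def radialRot (π : Metric.sphere (0 : V) 1 → X) (ι : X → OrientedPlane V) (v : V) :
    V →L[ℝ] V :=
  rot (ι (π (unitVec v)))

theorem contMDiffOn_unitVec : ContMDiffOn 𝓘(ℝ, V) (𝓡 (2 * n + 1)) k
    (unitVec : V → Metric.sphere (0 : V) 1) {0}ᶜ :=
  fun _ hv => (contMDiffAt_unitVec hv).contMDiffWithinAt

/-- Tangent vectors of the sphere lift to `V` through the inclusion, because `unitVec` retracts `V ∖
0` to the sphere; over a compact set the lifts are bounded. -/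
theorem exists_C1On_sphere_of_mem_c1Nhds {E : Type*} [NormedAddCommGroup E] [NormedSpace ℝ E]
    {f : Metric.sphere (0 : V) 1 → E} (hf : MDifferentiable (𝓡 (2 * n + 1)) 𝓘(ℝ, E) f)
    {𝒪 : Set (Metric.sphere (0 : V) 1 → E)} (h𝒪 : 𝒪 ∈ c1Nhds (𝓡 (2 * n + 1)) f) :
    ∃ δ > 0, ∀ g, MDifferentiable (𝓡 (2 * n + 1)) 𝓘(ℝ, E) g →
      C1On (Metric.sphere (0 : V) 1) δ (f ∘ unitVec) (g ∘ unitVec) → g ∈ 𝒪 := by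
  have hu : ∀ v ∈ Metric.sphere (0 : V) 1, MDifferentiableAt 𝓘(ℝ, V) (𝓡 (2 * n + 1)) unitVec v :=
    fun v hv => (contMDiffAt_unitVec (k := 1) (ne_zero_of_mem_annulus
      (sphere_subset_annulus hv))).mdifferentiableAt one_ne_zero
  refine exists_C1On_of_mem_c1Nhds hu hf (fun K hK => ?_) h𝒪
  have hc : ContMDiff (𝓡 (2 * n + 1)) 𝓘(ℝ, V) 1 ((↑) : Metric.sphere (0 : V) 1 → V) :=
    contMDiff_coe_sphere
  obtain ⟨R, hR⟩ := hK.exists_bound_of_continuousOn (continuous_derivAlong hc).continuousOn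
  refine ⟨R, fun ξ hξ => ⟨ξ.proj, ξ.proj.2, derivAlong (𝓡 (2 * n + 1)) (↑) ξ, hR ξ hξ, ?_⟩⟩
  have h1 : tangentMap (𝓡 (2 * n + 1)) (𝓡 (2 * n + 1))
      (unitVec ∘ ((↑) : Metric.sphere (0 : V) 1 → V)) ξ = ξ := by
    have h2 : unitVec ∘ ((↑) : Metric.sphere (0 : V) 1 → V) = id := funext unitVec_coe
    rw [h2, tangentMap_id]
    rfl
  rw [tangentMap_comp_at _ (hu _ ξ.proj.2) (hc.mdifferentiable one_ne_zero _)] at h1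
  exact h1

namespace IsFibration

theorem of_le {l : WithTop ℕ∞} (h : IsFibration n k π ι) (hl : 1 ≤ l) (hlk : l ≤ k) :
    IsFibration n l π ι :=
  ⟨hl, h.fibred, h.contMDiff_proj.of_le hlk, h.contMDiff_rot.of_le hlk⟩

variable (h : IsFibration n k π ι)
include h

theorem contMDiffOn_radial : ContMDiffOn 𝓘(ℝ, V) (𝓡 (2 * n)) k (fun w => π (unitVec w)) {0}ᶜ :=
  fun _ hv => (contMDiffAt_radial h.contMDiff_proj hv).contMDiffWithinAt

theorem contDiffAt_radialRot {v : V} (hv : v ≠ 0) : ContDiffAt ℝ k (radialRot π ι) v :=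
  h.contDiffAt_comp_radial h.contMDiff_rot hv

theorem planeProj_radialRot {v : V} (hv : v ≠ 0) : planeProj (radialRot π ι v) v = v := by
  rw [radialRot, planeProj_rot]
  exact Submodule.starProjection_eq_self_iff.2 ((h.fibred.radial_eq_iff hv).1 rfl)

/-- For `G = radialRot π ι` the map is the identity off the origin, since `v` lies in the plane of
its own fibre; the rest is continuity of composition. -/
theorem exists_C1On_planeProj {C : Set V} (hC : IsCompact C) (hC0 : ∀ v ∈ C, v ≠ 0) {ε : ℝ}
    (hε : 0 < ε) : ∃ δ > 0, ∀ G : V → V →L[ℝ] V, (∀ v ∈ C, DifferentiableAt ℝ G v) →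
      C1On C δ (radialRot π ι) G → C1On C ε id (fun v => planeProj (G v) v) := by
  have hd : ∀ v ∈ C, ContDiffAt ℝ 1 (radialRot π ι) v := fun v hv =>
    (h.contDiffAt_radialRot (hC0 v hv)).of_le h.one_le
  have hH : ContDiff ℝ 1 (fun y : (V →L[ℝ] V) × V => planeProj y.1 y.2) :=
    (contDiff_planeProj.comp contDiff_fst).clm_apply contDiff_snd
  obtain ⟨δ, hδ, h1⟩ := exists_C1On_comp hC (F := fun v => (radialRot π ι v, v))
    (fun v hv => (hd v hv).prodMk contDiffAt_id) isOpen_univ (fun _ _ => trivial) hH.contDiffOn hε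
  refine ⟨δ, hδ, fun G hG hGC => ?_⟩
  have h2 := (h1 (fun v => (G v, v)) (fun v hv => (hG v hv).prodMk differentiableAt_id)
    (hGC.prodMk (fun v _ => by simpa using hδ)
      (fun v hv => (hd v hv).differentiableAt one_ne_zero) hG
      (fun v _ => differentiableAt_id) (fun v _ => differentiableAt_id))).2
  refine h2.congr (fun v hv => ?_) (fun v _ => Filter.EventuallyEq.rfl)
  filter_upwards [continuousAt_id.eventually_ne (hC0 v hv)] with w hw
  exact h.planeProj_radialRot hw

/-- Here a tangent vector of `X` is lifted to a unit vector in its fibre by the velocity of the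
planes, which the operator norm of `derivAlong` bounds. -/
theorem exists_C1On_of_mem_c1Nhds {E : Type*} [NormedAddCommGroup E] [NormedSpace ℝ E]
    {f : X → E} (hf : MDifferentiable (𝓡 (2 * n)) 𝓘(ℝ, E) f)
    {𝒪 : Set (X → E)} (h𝒪 : 𝒪 ∈ c1Nhds (𝓡 (2 * n)) f) :
    ∃ δ > 0, ∀ g, MDifferentiable (𝓡 (2 * n)) 𝓘(ℝ, E) g →
      C1On (Metric.sphere (0 : V) 1) δ (fun v => f (π (unitVec v))) (fun v => g (π (unitVec v))) →
        g ∈ 𝒪 := by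
  refine GreatCircle.exists_C1On_of_mem_c1Nhds (r := fun v => π (unitVec v))
    (fun v hv => h.mdifferentiableAt_radial (ne_zero_of_mem_annulus
      (sphere_subset_annulus hv))) hf (fun K hK => ?_) h𝒪
  obtain ⟨R, hR⟩ := hK.exists_bound_of_continuousOn
    (continuous_derivAlong (h.contMDiff_starProj.of_le h.one_le)).continuousOn
  refine ⟨R, fun ξ hξ => ?_⟩
  have hb := hR ξ hξ
  obtain ⟨x, ξ⟩ := ξ
  obtain ⟨v₀, hv₀, hv₀0⟩ := (ι x).exists_ne_zero
  have hv0 := sphere_coe_ne_zero (unitVec v₀)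
  have hv : (unitVec v₀ : V) ∈ (ι x).plane := (unitVec_mem hv₀0).2 hv₀
  have hn : ‖(unitVec v₀ : V)‖ = 1 := mem_sphere_zero_iff_norm.1 (unitVec v₀).2
  refine ⟨unitVec v₀, (unitVec v₀).2, projDeriv n ι x ξ (unitVec v₀ : V), ?_, ?_⟩
  · have h1 := (projDeriv n ι x ξ).le_opNorm (unitVec v₀ : V)
    rw [hn, mul_one] at h1
    exact h1.trans hb
  · have h1 := h.mfderiv_radial_projDeriv hv0 hv ξ
    obtain rfl := (h.fibred.radial_eq_iff hv0).2 hv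
    exact congrArg (Bundle.TotalSpace.mk _) h1

/-- A `C¹`-small motion of the base of a fibration is the base of a fibration. -/
theorem exists_nhds_isGreatCircleFibration :
    ∃ 𝒪 ∈ c1Nhds (𝓡 (2 * n)) (fun x => rot (ι x)),
      ∀ f : X → OrientedPlane V, (fun x => rot (f x)) ∈ 𝒪 →
        ∀ l, 1 ≤ l → l ≤ k →
          ContMDiff (𝓡 (2 * n)) 𝓘(ℝ, V →L[ℝ] V) l (fun x => rot (f x)) →
            ∃ π' : Metric.sphere (0 : V) 1 → X, IsGreatCircleFibration n l π' f := by
  obtain ⟨δ, hδ, h1⟩ := h.exists_C1On_planeProj (isCompact_sphere (0 : V) 1)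
    (fun v hv => ne_zero_of_mem_annulus (sphere_subset_annulus hv)) (ε := 1 / 2) (by norm_num)
  refine ⟨_, C1On_comp_mem_c1Nhds isOpen_compl_singleton (h.contMDiffOn_radial.of_le h.one_le)
    (isCompact_sphere (0 : V) 1)
    (fun v hv => ne_zero_of_mem_annulus (sphere_subset_annulus hv))
    (h.contMDiff_rot.mdifferentiable h.ne_zero) hδ, fun f hf l hl hlk hfl => ?_⟩
  -- The neighbourhood was fixed before `l`; only first derivatives entered, so it serves every
  -- class.
  have hl' := h.of_le hl hlk
  have hfd := hfl.mdifferentiable hl'.ne_zero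
  have h2 := h1 (fun v => rot (f (π (unitVec v)))) (fun v hv =>
    (hl'.contDiffAt_comp_radial hfl (ne_zero_of_mem_annulus
      (sphere_subset_annulus hv))).differentiableAt hl'.ne_zero) (hf hfd)
  obtain ⟨Φ, π', hπ', -⟩ := hl'.exists_fibration hfl (fun v hv => by
    have h3 := (h2 v (mem_sphere_zero_iff_norm.2 hv)).2.le
    simp only [planeProj_rot, fderiv_id] at h3
    exact h3)
  exact ⟨π', hπ'.isGreatCircleFibration⟩

end IsFibration

end SmallMotion

end GreatCircle

namespace GreatCircle

/-! ### From small normal sections to fibrations -/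

section SmallSection

variable {n : ℕ} {V : Type v} [NormedAddCommGroup V] [InnerProductSpace ℝ V]
  [FiniteDimensional ℝ V] [Fact (Module.finrank ℝ V = (2 * n + 1) + 1)] [Nontrivial V]
  {X : Type u} [TopologicalSpace X] [ChartedSpace (EuclideanSpace ℝ (Fin (2 * n))) X]
  [IsManifold (𝓡 (2 * n)) ∞ X]
  {π : Metric.sphere (0 : V) 1 → X} {ι : X → OrientedPlane V} {k : WithTop ℕ∞}

theorem contMDiff_rot_graph (hι : ContMDiff (𝓡 (2 * n)) 𝓘(ℝ, V →L[ℝ] V) k (fun x => rot (ι x)))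
    {σ : X → V →L[ℝ] V} (hσ : ContMDiff (𝓡 (2 * n)) 𝓘(ℝ, V →L[ℝ] V) k σ) :
    ContMDiff (𝓡 (2 * n)) 𝓘(ℝ, V →L[ℝ] V) k (fun x => rot (graph (ι x) (σ x))) := fun x => by
  have h1 := (contDiffOn_graphRot (V := V) (k := k)).contDiffAt
    (isOpen_graphRotDomain.mem_nhds (mem_graphRotDomain (ι x) (σ x)))
  have h2 := h1.contMDiffAt.comp x ((hι x).prodMk_space (hσ x))
  simpa only [Function.comp_def, ← rot_graph] using h2

namespace IsFibration

variable (h : IsFibration n k π ι)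
include h

theorem exists_C1On_graphRot {C : Set V} (hC : IsCompact C) (hC0 : ∀ v ∈ C, v ≠ 0) {ε : ℝ}
    (hε : 0 < ε) : ∃ δ > 0, ∀ S : V → V →L[ℝ] V, (∀ v ∈ C, DifferentiableAt ℝ S v) →
      C1On C δ (fun _ => 0) S →
        C1On C ε (radialRot π ι) (fun v => graphRot (radialRot π ι v) (S v)) := by
  have hd : ∀ v ∈ C, ContDiffAt ℝ 1 (radialRot π ι) v := fun v hv =>
    (h.contDiffAt_radialRot (hC0 v hv)).of_le h.one_le
  have hd' := fun v hv => (hd v hv).differentiableAt one_ne_zero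
  obtain ⟨δ, hδ, h1⟩ := exists_C1On_comp hC
    (F := fun v => (radialRot π ι v, (0 : V →L[ℝ] V)))
    (fun v hv => (hd v hv).prodMk contDiffAt_const) isOpen_graphRotDomain
    (fun v _ => mem_graphRotDomain _ _) contDiffOn_graphRot hε
  refine ⟨δ, hδ, fun S hS hSC => ?_⟩
  have h2 := (h1 (fun v => (radialRot π ι v, S v)) (fun v hv => (hd' v hv).prodMk (hS v hv))
    (C1On.prodMk (fun v _ => by simpa using hδ) hSC hd' hd'
      (fun v _ => differentiableAt_const _) hS)).2
  exact h2.congr (fun v _ => Filter.Eventually.of_forall fun w => graphRot_zero _)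
    (fun v _ => Filter.EventuallyEq.rfl)

theorem exists_C1On_graphCoord {C : Set V} (hC : IsCompact C) (hC0 : ∀ v ∈ C, v ≠ 0) {ε : ℝ}
    (hε : 0 < ε) : ∃ δ > 0, ∀ A : V → V →L[ℝ] V, (∀ v ∈ C, DifferentiableAt ℝ A v) →
      C1On C δ (radialRot π ι) A →
        C1On C ε (fun _ => 0) (fun v => graphCoord (radialRot π ι v) (A v)) := by
  have hd : ∀ v ∈ C, ContDiffAt ℝ 1 (radialRot π ι) v := fun v hv =>
    (h.contDiffAt_radialRot (hC0 v hv)).of_le h.one_le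
  have hd' := fun v hv => (hd v hv).differentiableAt one_ne_zero
  obtain ⟨δ, hδ, h1⟩ := exists_C1On_comp hC
    (F := fun v => (radialRot π ι v, radialRot π ι v))
    (fun v hv => (hd v hv).prodMk (hd v hv)) isOpen_graphCoordDomain
    (fun v _ => mem_graphCoordDomain _) contDiffOn_graphCoord hε
  refine ⟨δ, hδ, fun A hA hAC => ?_⟩
  have h2 := (h1 (fun v => (radialRot π ι v, A v)) (fun v hv => (hd' v hv).prodMk (hA v hv))
    (C1On.prodMk (fun v _ => by simpa using hδ) hAC hd' hd' hd' hA)).2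
  exact h2.congr (fun v _ => Filter.Eventually.of_forall fun w => graphCoord_rot_self _)
    (fun v _ => Filter.EventuallyEq.rfl)

/-- Small sections of the normal bundle give fibrations near the given one. -/
theorem exists_nhds_graph
    {𝒪 : Set (Metric.sphere (0 : V) 1 → V →L[ℝ] V)}
    (h𝒪 : 𝒪 ∈ c1Nhds (𝓡 (2 * n + 1)) (fun p => rot (ι (π p)))) :
    ∃ 𝒩 ∈ c1Nhds (𝓡 (2 * n)) (fun _ : X => (0 : V →L[ℝ] V)),
      ∀ σ ∈ 𝒩, ContMDiff (𝓡 (2 * n)) 𝓘(ℝ, V →L[ℝ] V) k σ →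
        ∃ π' : Metric.sphere (0 : V) 1 → X,
          IsGreatCircleFibration n k π' (fun x => graph (ι x) (σ x)) ∧
          (fun p => rot (graph (ι (π' p)) (σ (π' p)))) ∈ 𝒪 := by
  have hA : ∀ v ∈ annulus V, ContDiffAt ℝ 1 (radialRot π ι) v := fun v hv =>
    (h.contDiffAt_radialRot (ne_zero_of_mem_annulus hv)).of_le h.one_le
  -- The tolerances are chosen backwards from the conclusion. The new planes along the new fibres
  -- are the planes along the old fibres composed with `Φ⁻¹`, which moves the sphere inside the
  -- annulus; hence the estimates on the annulus.
  obtain ⟨δ₁, hδ₁, h1⟩ := exists_C1On_sphere_of_mem_c1Nhds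
    ((h.contMDiff_rot.comp h.contMDiff_proj).mdifferentiable h.ne_zero) h𝒪
  obtain ⟨δ₂, hδ₂, h2⟩ := exists_C1On_comp_symm isCompact_annulus sphere_subset_annulus hA hδ₁
  obtain ⟨δ₃, hδ₃, h3⟩ := h.exists_C1On_planeProj isCompact_annulus
    (fun v => ne_zero_of_mem_annulus) (ε := min δ₂ (1 / 2)) (lt_min hδ₂ (by norm_num))
  obtain ⟨δ₄, hδ₄, h4⟩ := h.exists_C1On_graphRot isCompact_annulus
    (fun v => ne_zero_of_mem_annulus) (ε := min δ₂ δ₃) (lt_min hδ₂ hδ₃)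
  refine ⟨_, C1On_comp_mem_c1Nhds isOpen_compl_singleton (h.contMDiffOn_radial.of_le h.one_le)
    isCompact_annulus (fun v hv => ne_zero_of_mem_annulus hv)
    mdifferentiable_const hδ₄, fun σ hσ hσk => ?_⟩
  have hf := contMDiff_rot_graph h.contMDiff_rot hσk
  have hfd : ∀ v ∈ annulus V, DifferentiableAt ℝ
      (fun v => rot (graph (ι (π (unitVec v))) (σ (π (unitVec v))))) v := fun v hv =>
    (h.contDiffAt_comp_radial hf (ne_zero_of_mem_annulus hv)).differentiableAt h.ne_zero
  have h5 := h4 (fun v => σ (π (unitVec v))) (fun v hv => (h.contDiffAt_comp_radial hσk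
    (ne_zero_of_mem_annulus hv)).differentiableAt h.ne_zero)
    (hσ (hσk.mdifferentiable h.ne_zero))
  simp only [radialRot, ← rot_graph] at h5
  have h6 := h3 _ hfd (h5.mono subset_rfl (min_le_right _ _))
  simp only [planeProj_rot] at h6
  obtain ⟨Φ, π', hπ', hΦ, hπΦ, hn, hD⟩ := h.exists_fibration hf (fun v hv => by
    have h7 := (h6 v (sphere_subset_annulus (mem_sphere_zero_iff_norm.2 hv))).2.le
    rw [fderiv_id] at h7
    exact h7.trans (min_le_right _ _))
  have hΦ' : ⇑Φ = fun v => (graph (ι (π (unitVec v))) (σ (π (unitVec v)))).plane.starProjection v :=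
    funext hΦ
  refine ⟨π', hπ'.isGreatCircleFibration, h1 _
    ((hf.comp hπ'.contMDiff_proj).mdifferentiable h.ne_zero) ?_⟩
  refine (h2 _ Φ hfd (fun v hv => symm_mem_annulus hn hv) (fun v hv => hD v
    (ne_zero_of_mem_annulus (sphere_subset_annulus hv))) (h5.mono subset_rfl (min_le_left _ _))
    (by rw [hΦ']; exact h6.mono subset_rfl (min_le_left _ _))).congr
    (fun v _ => Filter.EventuallyEq.rfl) (fun v hv => ?_)
  filter_upwards [continuousAt_id.eventually_ne
    (ne_zero_of_mem_annulus (sphere_subset_annulus hv))] with w hw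
  exact congrArg (fun x => rot (graph (ι x) (σ x))) (hπΦ w hw).symm

end IsFibration

end SmallSection

end GreatCircle

namespace GreatCircle

/-! ### An implicit function smooth on a neighbourhood -/

section Implicit

variable {E₁ E₂ F : Type*} [NormedAddCommGroup E₁] [NormedSpace ℝ E₁] [CompleteSpace E₁]
  [NormedAddCommGroup E₂] [NormedSpace ℝ E₂] [CompleteSpace E₂]
  [NormedAddCommGroup F] [NormedSpace ℝ F] [CompleteSpace F]

/-- The implicit function theorem, with smoothness in a neighbourhood. -/
theorem exists_smooth_implicit {f : E₁ × E₂ → F} {Ω : Set (E₁ × E₂)} (hΩ : IsOpen Ω)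
    (hf : ContDiffOn ℝ ∞ f Ω) {u : E₁ × E₂} (hu : u ∈ Ω) (hfu : f u = 0)
    (hi : (fderiv ℝ f u ∘L .inr ℝ E₁ E₂).IsInvertible) :
    ∃ (U : Set E₁) (W : Set E₂) (ψ : E₁ → E₂), IsOpen U ∧ IsOpen W ∧ u.1 ∈ U ∧ u.2 ∈ W ∧
      U ×ˢ W ⊆ Ω ∧ ContDiffOn ℝ ∞ ψ U ∧
      ∀ a ∈ U, ψ a ∈ W ∧ f (a, ψ a) = 0 ∧ ∀ y ∈ W, f (a, y) = 0 → y = ψ a := by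
  have hn : (∞ : WithTop ℕ∞) ≠ 0 := by decide
  have hfa : ∀ v ∈ Ω, ContDiffAt ℝ ∞ f v := fun v hv => hf.contDiffAt (hΩ.mem_nhds hv)
  obtain ⟨ψ, hψ⟩ : ∃ ψ, ψ = (hfa u hu).implicitFunction hn hi := ⟨_, rfl⟩
  have h0 : ψ u.1 = u.2 := by rw [hψ]; exact (hfa u hu).implicitFunction_apply_self hn hi
  have h1 : ∀ᶠ a in 𝓝 u.1, f (a, ψ a) = 0 := by
    rw [hψ, ← hfu]; exact (hfa u hu).eventually_apply_implicitFunction hn hi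
  have h2 : ∀ᶠ v in 𝓝 u, f v = 0 ↔ ψ v.1 = v.2 := by
    rw [hψ, ← hfu]; exact (hfa u hu).eventually_apply_eq_iff_implicitFunction hn hi
  have h3 : ContDiffAt ℝ 1 ψ u.1 := by
    rw [hψ]; exact ((hfa u hu).contDiffAt_implicitFunction hn hi).of_le (by norm_num)
  have h4 : ∀ᶠ a in 𝓝 u.1, ContDiffAt ℝ 1 ψ a := h3.eventually (by simp)
  have hG : Filter.Tendsto (fun a => (a, ψ a)) (𝓝 u.1) (𝓝 u) := by
    have h5 : ContinuousAt (fun a => (a, ψ a)) u.1 := continuousAt_id.prodMk h3.continuousAt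
    rw [ContinuousAt, h0] at h5
    exact h5
  have h6 : ∀ᶠ v in 𝓝 u, (fderiv ℝ f v ∘L .inr ℝ E₁ E₂).IsInvertible := by
    have h7 : ContinuousAt (fun v => fderiv ℝ f v ∘L .inr ℝ E₁ E₂) u :=
      ((hfa u hu).fderiv_right (m := 0) (by norm_num)).continuousAt.clm_comp continuousAt_const
    exact h7.eventually (ContinuousLinearEquiv.isOpen.mem_nhds hi)
  -- Smoothness of order `∞` at one point does not spread to a neighbourhood by itself. The implicit
  -- function theorem is applied again at each nearby solution, and local uniqueness identifies the
  -- new function with `ψ`.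
  have h8 : ∀ᶠ a in 𝓝 u.1, ContDiffAt ℝ ∞ ψ a := by
    filter_upwards [h1, h4, hG.eventually h6, hG.eventually h2.eventually_nhds,
      hG.eventually (hΩ.mem_nhds hu)] with a ha1 ha4 ha6 ha2 haΩ
    have hc := (hfa _ haΩ).contDiffAt_implicitFunction hn ha6
    refine hc.congr_of_eventuallyEq ?_
    have h9 := (hfa _ haΩ).eventually_apply_implicitFunction hn ha6
    have h10 : Filter.Tendsto (fun a' => (a', (hfa _ haΩ).implicitFunction hn ha6 a')) (𝓝 a)
        (𝓝 (a, ψ a)) := by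
      have h5 := continuousAt_id.prodMk hc.continuousAt
      have h11 := (hfa _ haΩ).implicitFunction_apply_self hn ha6
      rw [ContinuousAt] at h5
      simp only [id] at h5
      rw [h11] at h5
      exact h5
    filter_upwards [h9, h10.eventually ha2] with a' h12 h13
    exact h13.1 (h12.trans ha1)
  obtain ⟨s, hs, t, ht, hst⟩ := mem_nhds_prod_iff.1 (Filter.inter_mem h2 (hΩ.mem_nhds hu))
  obtain ⟨W, hWt, hWo, huW⟩ := mem_nhds_iff.1 ht
  have h14 : ∀ᶠ a in 𝓝 u.1, ψ a ∈ W := by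
    refine h3.continuousAt.eventually (hWo.mem_nhds ?_)
    rwa [h0]
  obtain ⟨U, hU, hUo, huU⟩ := mem_nhds_iff.1 (Filter.inter_mem hs (h1.and (h8.and h14)))
  refine ⟨U, W, ψ, hUo, hWo, huU, huW, fun v hv => (hst ⟨(hU hv.1).1, hWt hv.2⟩).2,
    fun a ha => (hU ha).2.2.1.contDiffWithinAt, fun a ha => ⟨(hU ha).2.2.2, (hU ha).2.1,
      fun y hy hay => ((hst (a := (a, y)) ⟨(hU ha).1, hWt hy⟩).1.1 hay).symm⟩⟩

end Implicit

theorem isInvertible_of_injective_dual {E : Type*} [NormedAddCommGroup E] [NormedSpace ℝ E]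
    [FiniteDimensional ℝ E] {B : E →L[ℝ] (E →L[ℝ] ℝ)} (hB : ∀ η, B η η = 0 → η = 0) :
    B.IsInvertible := by
  have h1 : Function.Injective B.toLinearMap := (injective_iff_map_eq_zero _).2 fun η hη =>
    hB η (by rw [show B η = 0 from hη]; rfl)
  have h2 : Module.finrank ℝ E = Module.finrank ℝ (E →L[ℝ] ℝ) := by
    rw [← (LinearMap.toContinuousLinearMap (𝕜 := ℝ) (E := E) (F' := ℝ)).finrank_eq]
    exact (Subspace.dual_finrank_eq (K := ℝ) (V := E)).symm
  refine ⟨(LinearEquiv.ofInjectiveOfFinrankEq B.toLinearMap h1 h2).toContinuousLinearEquiv, ?_⟩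
  ext η ζ
  rfl

end GreatCircle

/-! ### Foot points near a point of the base -/

namespace GreatCircle

theorem hasFDerivAt_smul_mul_mul {E 𝔸 : Type*} [NormedAddCommGroup E] [NormedSpace ℝ E]
    [NormedRing 𝔸] [NormedAlgebra ℝ 𝔸] {c : E → ℝ} {R A : E → 𝔸} {R' A' : E →L[ℝ] 𝔸} {y : E}
    (hc : DifferentiableAt ℝ c y) (hR : HasFDerivAt R R' y) (B : 𝔸) (hA : HasFDerivAt A A' y)
    (h0 : R y * B = 0) : ∃ S' : E →L[ℝ] 𝔸, HasFDerivAt (fun y => c y • (R y * B * A y)) S' y ∧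
      ∀ η, S' η = c y • (R' η * B * A y) :=
  ⟨_, hc.hasFDerivAt.fun_smul ((hR.mul_const' B).fun_mul' hA), fun η => by simp [h0]⟩

section Foot

variable {n : ℕ} {V : Type v} [NormedAddCommGroup V] [InnerProductSpace ℝ V]
  [FiniteDimensional ℝ V] [Fact (Module.finrank ℝ V = (2 * n + 1) + 1)]
  {X : Type u} [TopologicalSpace X] [ChartedSpace (EuclideanSpace ℝ (Fin (2 * n))) X]
  [IsManifold (𝓡 (2 * n)) ∞ X]
  {π : Metric.sphere (0 : V) 1 → X} {ι : X → OrientedPlane V}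

theorem one_sub_mul_graphCoord_mul (P : OrientedPlane V) (A' : V →L[ℝ] V) :
    (1 - P.plane.starProjection) * graphCoord (rot P) A' * P.plane.starProjection =
      graphCoord (rot P) A' := by
  have h1 : (1 - P.plane.starProjection) * (1 - P.plane.starProjection) =
      1 - P.plane.starProjection := by
    rw [sub_mul 1 P.plane.starProjection, one_mul, starProjection_mul_one_sub, sub_zero]
  rw [graphCoord, planeProj_rot, mul_smul_comm, smul_mul_assoc, mul_assoc, mul_assoc, mul_assoc,
    rot_mul_starProjection, ← mul_assoc (1 - P.plane.starProjection)
      (1 - P.plane.starProjection), h1, mul_assoc]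

/-- The function whose zeros `(A', y)` are the pairs for which the plane `A'` lies in the normal
direction over the point with coordinate `y` in the chart at `x₀`. -/
noncomputable def footMap (n : ℕ) {V : Type v} [NormedAddCommGroup V] [InnerProductSpace ℝ V]
    [FiniteDimensional ℝ V] {X : Type u} [TopologicalSpace X]
    [ChartedSpace (EuclideanSpace ℝ (Fin (2 * n))) X] (ι : X → OrientedPlane V) (x₀ : X)
    (z : (V →L[ℝ] V) × EuclideanSpace ℝ (Fin (2 * n))) :
    EuclideanSpace ℝ (Fin (2 * n)) →L[ℝ] ℝ :=
  tracePairing V _ (fderiv ℝ (chartProj n ι x₀) z.2) (graphCoord (chartRot n ι x₀ z.2) z.1)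

/-- The domain on which `footMap` is smooth. -/
def footDomain (n : ℕ) {V : Type v} [NormedAddCommGroup V] [InnerProductSpace ℝ V]
    [FiniteDimensional ℝ V] {X : Type u} [TopologicalSpace X]
    [ChartedSpace (EuclideanSpace ℝ (Fin (2 * n))) X] (ι : X → OrientedPlane V) (x₀ : X) :
    Set ((V →L[ℝ] V) × EuclideanSpace ℝ (Fin (2 * n))) :=
  (Prod.snd ⁻¹' (extChartAt (𝓡 (2 * n)) x₀).target) ∩
    (fun z => (chartRot n ι x₀ z.2, z.1)) ⁻¹' graphCoordDomain V

theorem planeProj_chartRot (x₀ : X) (y : EuclideanSpace ℝ (Fin (2 * n))) :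
    planeProj (chartRot n ι x₀ y) = chartProj n ι x₀ y := planeProj_rot _

namespace IsFibration

variable (h : IsFibration n ∞ π ι) (x₀ : X)
include h

theorem contDiffOn_chartRot_snd :
    ContDiffOn ℝ ∞ (fun z : (V →L[ℝ] V) × EuclideanSpace ℝ (Fin (2 * n)) =>
      (chartRot n ι x₀ z.2, z.1)) (Prod.snd ⁻¹' (extChartAt (𝓡 (2 * n)) x₀).target) :=
  ((h.contDiffOn_chartRot x₀).comp contDiffOn_snd fun _ hz => hz).prodMk contDiffOn_fst

theorem isOpen_footDomain : IsOpen (footDomain n ι x₀) :=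
  (h.contDiffOn_chartRot_snd x₀).continuousOn.isOpen_inter_preimage
    ((isOpen_extChartAt_target x₀).preimage continuous_snd) isOpen_graphCoordDomain

theorem contDiffOn_footMap : ContDiffOn ℝ ∞ (footMap n ι x₀) (footDomain n ι x₀) := by
  have h1 : ContDiffOn ℝ ∞ (fun z : (V →L[ℝ] V) × EuclideanSpace ℝ (Fin (2 * n)) =>
      fderiv ℝ (chartProj n ι x₀) z.2) (footDomain n ι x₀) :=
    (h.contDiffOn_fderiv_chartProj x₀).comp contDiffOn_snd fun _ hz => hz.1
  have h2 := (contDiffOn_graphCoord (V := V) (k := ∞)).comp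
    ((h.contDiffOn_chartRot_snd x₀).mono Set.inter_subset_left)
    (fun z (hz : z ∈ footDomain n ι x₀) => hz.2)
  exact ((contDiff_tracePairing (V := V)).comp_contDiffOn h1).clm_apply h2

theorem graphCoord_mem_normalSpace_iff {y : EuclideanSpace ℝ (Fin (2 * n))}
    (hy : y ∈ (extChartAt (𝓡 (2 * n)) x₀).target) (A' : V →L[ℝ] V) :
    graphCoord (rot (ι ((extChartAt (𝓡 (2 * n)) x₀).symm y))) A' ∈
      normalSpace n ι ((extChartAt (𝓡 (2 * n)) x₀).symm y) ↔ footMap n ι x₀ (A', y) = 0 := by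
  have hs : (extChartAt (𝓡 (2 * n)) x₀).symm y ∈
      (chartAt (EuclideanSpace ℝ (Fin (2 * n))) x₀).source := by
    rw [← extChartAt_source (𝓡 (2 * n))]
    exact (extChartAt (𝓡 (2 * n)) x₀).map_target hy
  rw [h.mem_normalSpace_iff_chart x₀ hs, (extChartAt (𝓡 (2 * n)) x₀).right_inv hy,
    ContinuousLinearMap.ext_iff (f := footMap n ι x₀ (A', y))]
  exact and_iff_right
    (one_sub_mul_graphCoord_mul (ι ((extChartAt (𝓡 (2 * n)) x₀).symm y)) A')

/-- At the base point `(1 - p) A = 0`, so the product rule leaves only the derivative of `1 - p`;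
the remaining factors are the scalar `-1` and `A² = -p`. -/
theorem hasFDerivAt_graphCoord_chartRot (η : EuclideanSpace ℝ (Fin (2 * n))) :
    ∃ S' : EuclideanSpace ℝ (Fin (2 * n)) →L[ℝ] (V →L[ℝ] V),
      HasFDerivAt (fun y => graphCoord (chartRot n ι x₀ y) (rot (ι x₀))) S'
        (extChartAt (𝓡 (2 * n)) x₀ x₀) ∧
      S' η = -(fderiv ℝ (chartProj n ι x₀) (extChartAt (𝓡 (2 * n)) x₀ x₀) η *
        (ι x₀).plane.starProjection) := by
  set y₀ := extChartAt (𝓡 (2 * n)) x₀ x₀ with hy₀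
  have ht : (extChartAt (𝓡 (2 * n)) x₀).target ∈ 𝓝 y₀ := extChartAt_target_mem_nhds x₀
  have hx : (extChartAt (𝓡 (2 * n)) x₀).symm y₀ = x₀ := extChartAt_to_inv x₀
  have hA : chartRot n ι x₀ y₀ = rot (ι x₀) := congrArg (fun x => rot (ι x)) hx
  have hp : chartProj n ι x₀ y₀ = (ι x₀).plane.starProjection :=
    congrArg (fun x => (ι x).plane.starProjection) hx
  have hAd : HasFDerivAt (chartRot n ι x₀) _ y₀ :=
    (((h.contDiffOn_chartRot x₀).contDiffAt ht).differentiableAt (by norm_num)).hasFDerivAt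
  have hpd : HasFDerivAt (chartProj n ι x₀) _ y₀ :=
    (((h.contDiffOn_chartProj x₀).contDiffAt ht).differentiableAt (by norm_num)).hasFDerivAt
  have h2 : DifferentiableAt ℝ (fun y => 2 / opTrace (rot (ι x₀) * chartRot n ι x₀ y)) y₀ := by
    have h3 : DifferentiableAt ℝ (fun y => opTrace (rot (ι x₀) * chartRot n ι x₀ y)) y₀ :=
      (opTrace : (V →L[ℝ] V) →L[ℝ] ℝ).differentiableAt.comp y₀
        ((differentiableAt_const _).mul hAd.differentiableAt)
    simp only [div_eq_mul_inv]
    refine (h3.inv ?_).const_mul 2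
    rw [hA, opTrace_rot_mul_rot]
    norm_num
  have h5 : (1 - (ι x₀).plane.starProjection) * rot (ι x₀) = 0 := by
    rw [sub_mul, one_mul, starProjection_mul_rot, sub_self]
  have h6 : rot (ι x₀) * rot (ι x₀) = -(ι x₀).plane.starProjection := by
    rw [← planeProj_rot, planeProj, neg_neg]
  obtain ⟨S', hS', hS'η⟩ := hasFDerivAt_smul_mul_mul h2 (hpd.const_sub 1) (rot (ι x₀)) hAd
    (by rw [hp, h5])
  simp only [graphCoord, planeProj_chartRot]
  refine ⟨S', hS', ?_⟩
  rw [hS'η, hA, opTrace_rot_mul_rot, mul_assoc, h6, mul_neg, neg_apply, neg_mul, neg_neg]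
  norm_num

theorem footMap_self : footMap n ι x₀ (rot (ι x₀), extChartAt (𝓡 (2 * n)) x₀ x₀) = 0 := by
  have hA : chartRot n ι x₀ (extChartAt (𝓡 (2 * n)) x₀ x₀) = rot (ι x₀) :=
    congrArg (fun x => rot (ι x)) (extChartAt_to_inv x₀)
  rw [footMap]
  simp only [hA, graphCoord_rot_self, map_zero]

theorem mem_footDomain : (rot (ι x₀), extChartAt (𝓡 (2 * n)) x₀ x₀) ∈ footDomain n ι x₀ := by
  refine ⟨mem_extChartAt_target x₀, ?_⟩
  have hA : chartRot n ι x₀ (extChartAt (𝓡 (2 * n)) x₀ x₀) = rot (ι x₀) :=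
    congrArg (fun x => rot (ι x)) (extChartAt_to_inv x₀)
  rw [Set.mem_preimage, hA]
  exact mem_graphCoordDomain _

/-- At the base point the graph coordinate vanishes, so only its derivative contributes. As a
bilinear form the derivative in `y` is minus the metric of `X`, which is definite. -/
theorem isInvertible_fderiv_footMap :
    (fderiv ℝ (footMap n ι x₀) (rot (ι x₀), extChartAt (𝓡 (2 * n)) x₀ x₀) ∘L
      .inr ℝ (V →L[ℝ] V) (EuclideanSpace ℝ (Fin (2 * n)))).IsInvertible := by
  set y₀ := extChartAt (𝓡 (2 * n)) x₀ x₀ with hy₀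
  have ht : (extChartAt (𝓡 (2 * n)) x₀).target ∈ 𝓝 y₀ := extChartAt_target_mem_nhds x₀
  have hd : HasFDerivAt (footMap n ι x₀) _ (rot (ι x₀), y₀) :=
    (((h.contDiffOn_footMap x₀).contDiffAt ((h.isOpen_footDomain x₀).mem_nhds
      (h.mem_footDomain x₀))).differentiableAt (by norm_num)).hasFDerivAt
  have h1 := hd.comp y₀ (hasFDerivAt_prodMk_right (rot (ι x₀)) y₀)
  refine isInvertible_of_injective_dual fun η hη => ?_
  obtain ⟨S', hS', hS'η⟩ := h.hasFDerivAt_graphCoord_chartRot x₀ η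
  have hD : DifferentiableAt ℝ (fun y => tracePairing V _ (fderiv ℝ (chartProj n ι x₀) y)) y₀ :=
    ((contDiff_tracePairing (k := 1)).contDiffAt.comp y₀
      (((h.contDiffOn_fderiv_chartProj x₀).contDiffAt ht).of_le (by norm_num))).differentiableAt
      one_ne_zero
  have h2 := hD.hasFDerivAt.clm_apply hS'
  have hA : chartRot n ι x₀ y₀ = rot (ι x₀) :=
    congrArg (fun x => rot (ι x)) (extChartAt_to_inv x₀)
  have h3 := DFunLike.congr_fun (DFunLike.congr_fun (h1.unique h2) η) η
  rw [hη] at h3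
  have h4 : opTrace (star (S' η) * fderiv ℝ (chartProj n ι x₀) y₀ η) = 0 := by
    rw [hA, graphCoord_rot_self] at h3
    simpa [tracePairing_apply] using h3.symm
  rw [hS'η, star_neg, neg_mul, map_neg, neg_eq_zero] at h4
  have h5 := projDeriv_eq_fderiv h.mdifferentiable_starProj x₀
  refine h.eq_zero_of_opTrace_projDeriv (x := x₀) (ξ := η) ?_
  rw [h5]
  exact h4

/-- Near a point of the base, the operators near the base have a unique foot point, which depends
smoothly on them. -/
theorem exists_local_foot : ∃ (U : Set (V →L[ℝ] V)) (W : Set X) (φ : (V →L[ℝ] V) → X),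
    IsOpen U ∧ IsOpen W ∧ rot (ι x₀) ∈ U ∧ x₀ ∈ W ∧ ContMDiffOn 𝓘(ℝ, V →L[ℝ] V) (𝓡 (2 * n)) ∞ φ U ∧
    ∀ A' ∈ U, φ A' ∈ W ∧ opTrace (A' * rot (ι (φ A'))) < 0 ∧
      graphCoord (rot (ι (φ A'))) A' ∈ normalSpace n ι (φ A') ∧
      ∀ x ∈ W, graphCoord (rot (ι x)) A' ∈ normalSpace n ι x → x = φ A' := by
  set e := extChartAt (𝓡 (2 * n)) x₀ with he
  obtain ⟨U, W, ψ, hUo, hWo, hU, hW, hUW, hψ, hψU⟩ := exists_smooth_implicit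
    (h.isOpen_footDomain x₀) (h.contDiffOn_footMap x₀) (h.mem_footDomain x₀) (h.footMap_self x₀)
    (h.isInvertible_fderiv_footMap x₀)
  have hdom : ∀ A' ∈ U, ∀ y ∈ W, (A', y) ∈ footDomain n ι x₀ := fun A' hA' y hy =>
    hUW ⟨hA', hy⟩
  refine ⟨U, e.source ∩ e ⁻¹' W, e.symm ∘ ψ, hUo,
    (continuousOn_extChartAt x₀).isOpen_inter_preimage (isOpen_extChartAt_source x₀) hWo, hU,
    ⟨mem_extChartAt_source x₀, hW⟩,
    (contMDiffOn_extChartAt_symm x₀).comp hψ.contMDiffOn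
      (fun A' hA' => (hdom A' hA' _ (hψU A' hA').1).1), fun A' hA' => ?_⟩
  obtain ⟨h1, h2, h3⟩ := hψU A' hA'
  have h4 := hdom A' hA' _ h1
  refine ⟨⟨e.map_target h4.1, ?_⟩, h4.2, (h.graphCoord_mem_normalSpace_iff x₀ h4.1 A').2 h2,
    fun x hx hxA => ?_⟩
  · show e (e.symm (ψ A')) ∈ W
    rwa [e.right_inv h4.1]
  · have h5 := h.graphCoord_mem_normalSpace_iff x₀ (e.map_source hx.1) A'
    rw [← he, e.left_inv hx.1] at h5
    rw [Function.comp_apply, ← h3 _ hx.2 (h5.1 hxA), e.left_inv hx.1]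

end IsFibration

end Foot

end GreatCircle

namespace GreatCircle

/-! ### The tubular neighbourhood and uniqueness of the section -/

section Tubular

variable {n : ℕ} {V : Type v} [NormedAddCommGroup V] [InnerProductSpace ℝ V]
  [FiniteDimensional ℝ V] [Fact (Module.finrank ℝ V = (2 * n + 1) + 1)]
  {X : Type u} [TopologicalSpace X] [ChartedSpace (EuclideanSpace ℝ (Fin (2 * n))) X]
  {π : Metric.sphere (0 : V) 1 → X} {ι : X → OrientedPlane V}

namespace IsFibration

theorem surjective {k : WithTop ℕ∞} (h : IsFibration n k π ι) : Function.Surjective π := fun x => by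
  have : Nontrivial V := nontrivial_of_finrank_eq (Fact.out : Module.finrank ℝ V = (2 * n + 1) + 1)
  obtain ⟨v, hv, hv0⟩ := (ι x).exists_ne_zero
  exact ⟨unitVec v, (h.fibred.radial_eq_iff hv0).2 hv⟩

theorem compactSpace {k : WithTop ℕ∞} (h : IsFibration n k π ι) : CompactSpace X :=
  h.surjective.compactSpace h.contMDiff_proj.continuous

/-- The base is compact and `rot ∘ ι` is injective. This converts closeness of operators into
closeness of points of `X`. -/
theorem isEmbedding_rot {k : WithTop ℕ∞} (h : IsFibration n k π ι) :
    Topology.IsEmbedding (fun x => rot (ι x)) := by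
  have := h.compactSpace
  have : Nontrivial V := nontrivial_of_finrank_eq (Fact.out : Module.finrank ℝ V = (2 * n + 1) + 1)
  exact (h.contMDiff_rot.continuous.isClosedEmbedding
    (rot_injective.comp h.fibred.injective)).isEmbedding

variable [IsManifold (𝓡 (2 * n)) ∞ X]

variable (h : IsFibration n ∞ π ι)
include h

theorem self_mem_normalSpace (x : X) :
    graphCoord (rot (ι x)) (rot (ι x)) ∈ normalSpace n ι x := by
  rw [graphCoord_rot_self]
  exact Submodule.zero_mem _

/-- The tubular neighbourhood theorem: an operator near the base has a unique foot point near it,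
which depends smoothly on the operator. -/
theorem exists_foot : ∃ ε > 0,
    (∀ (A' : V →L[ℝ] V) (x y : X), dist A' (rot (ι x)) < ε → dist A' (rot (ι y)) < ε →
      graphCoord (rot (ι x)) A' ∈ normalSpace n ι x →
      graphCoord (rot (ι y)) A' ∈ normalSpace n ι y → x = y) ∧
    ∃ (𝒲 : Set (V →L[ℝ] V)) (ρ : (V →L[ℝ] V) → X), IsOpen 𝒲 ∧ (∀ x, rot (ι x) ∈ 𝒲) ∧
      (∀ x, ρ (rot (ι x)) = x) ∧ ContMDiffOn 𝓘(ℝ, V →L[ℝ] V) (𝓡 (2 * n)) ∞ ρ 𝒲 ∧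
      ∀ A' ∈ 𝒲, opTrace (A' * rot (ι (ρ A'))) < 0 ∧
        graphCoord (rot (ι (ρ A'))) A' ∈ normalSpace n ι (ρ A') := by
  have := h.compactSpace
  have hV : Nontrivial V :=
    nontrivial_of_finrank_eq (Fact.out : Module.finrank ℝ V = (2 * n + 1) + 1)
  have hX : Nonempty X := ⟨π (unitVec 0)⟩
  have hAc : Continuous (fun x => rot (ι x)) := h.contMDiff_rot.continuous
  choose U W φ hUo hWo hU hW hφ hφU using h.exists_local_foot
  have hr : ∀ x₀, ∃ r > 0, Metric.ball (rot (ι x₀)) r ⊆ U x₀ ∧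
      ∀ x, rot (ι x) ∈ Metric.ball (rot (ι x₀)) r → x ∈ W x₀ := fun x₀ => by
    obtain ⟨r₁, hr₁, h1⟩ := Metric.isOpen_iff.1 (hUo x₀) _ (hU x₀)
    have h2 : W x₀ ∈ 𝓝 x₀ := (hWo x₀).mem_nhds (hW x₀)
    rw [h.isEmbedding_rot.nhds_eq_comap, Filter.mem_comap] at h2
    obtain ⟨t, ht, htW⟩ := h2
    obtain ⟨r₂, hr₂, h3⟩ := Metric.mem_nhds_iff.1 ht
    refine ⟨min r₁ r₂, lt_min hr₁ hr₂, (Metric.ball_subset_ball (min_le_left _ _)).trans h1,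
      fun x hx => htW (h3 (Metric.ball_subset_ball (min_le_right _ _) hx))⟩
  choose r hr0 hrU hrW using hr
  obtain ⟨δ, hδ, hL⟩ := lebesgue_number_lemma_of_metric (isCompact_range hAc)
    (c := fun x₀ => Metric.ball (rot (ι x₀)) (r x₀)) (fun _ => Metric.isOpen_ball) (by
      rintro _ ⟨x, rfl⟩
      exact Set.mem_iUnion.2 ⟨x, Metric.mem_ball_self (hr0 x)⟩)
  -- A single local foot map serves all operators and points near `A'`. Three distances below `δ /
  -- 4` add up to less than the Lebesgue number `δ`.
  have hloc : ∀ (A' : V →L[ℝ] V) (x : X), dist A' (rot (ι x)) < δ / 4 → ∃ x₀, A' ∈ U x₀ ∧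
      x ∈ W x₀ ∧ ∀ (A'' : V →L[ℝ] V) (y : X), dist A'' A' < δ / 4 →
        dist A'' (rot (ι y)) < δ / 4 → A'' ∈ U x₀ ∧ y ∈ W x₀ := by
    intro A' x hx
    obtain ⟨x₀, hx₀⟩ := hL _ ⟨x, rfl⟩
    refine ⟨x₀, hrU x₀ (hx₀ ?_), hrW x₀ x (hx₀ (Metric.mem_ball_self hδ)),
      fun A'' y h1 h2 => ⟨hrU x₀ (hx₀ ?_), hrW x₀ y (hx₀ ?_)⟩⟩
    · rw [Metric.mem_ball]; linarith
    · rw [Metric.mem_ball]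
      linarith [dist_triangle A'' A' (rot (ι x))]
    · rw [Metric.mem_ball]
      have h3 := dist_triangle (rot (ι y)) A'' (rot (ι x))
      show dist (rot (ι y)) (rot (ι x)) < δ
      have h4 := dist_triangle A'' A' (rot (ι x))
      rw [dist_comm (rot (ι y)) A''] at h3
      linarith
  have hu : ∀ (A' : V →L[ℝ] V) (x y : X), dist A' (rot (ι x)) < δ / 4 →
      dist A' (rot (ι y)) < δ / 4 → graphCoord (rot (ι x)) A' ∈ normalSpace n ι x →
      graphCoord (rot (ι y)) A' ∈ normalSpace n ι y → x = y := by
    intro A' x y hx hy hNx hNy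
    obtain ⟨x₀, hA'U, hxW, h1⟩ := hloc A' x hx
    obtain ⟨-, hyW⟩ := h1 A' y (by rw [dist_self]; positivity) hy
    rw [(hφU x₀ A' hA'U).2.2.2 x hxW hNx, (hφU x₀ A' hA'U).2.2.2 y hyW hNy]
  let Q : (V →L[ℝ] V) → X → Prop := fun A' x => dist A' (rot (ι x)) < δ / 4 ∧
    graphCoord (rot (ι x)) A' ∈ normalSpace n ι x
  -- An arbitrary choice of foot point within `δ / 4`; local uniqueness makes it agree near each
  -- operator with one of the smooth maps `φ x₀`.
  let ρ : (V →L[ℝ] V) → X := fun A' => Classical.epsilon (Q A')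
  have hself : ∀ x, Q (rot (ι x)) x := fun x =>
    ⟨by rw [dist_self]; positivity, h.self_mem_normalSpace x⟩
  have hρ : ∀ A' ∈ interior {A' | ∃ x, Q A' x}, Q A' (ρ A') := fun A' hA' =>
    Classical.epsilon_spec (p := Q A') (interior_subset hA' : A' ∈ {A' | ∃ x, Q A' x})
  have hmem : ∀ x, rot (ι x) ∈ interior {A' | ∃ x, Q A' x} := fun x => by
    rw [mem_interior_iff_mem_nhds]
    have hUn : U x ∈ 𝓝 (rot (ι x)) := (hUo x).mem_nhds (hU x)
    have h1 : φ x (rot (ι x)) = x :=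
      ((hφU x _ (hU x)).2.2.2 x (hW x) (h.self_mem_normalSpace x)).symm
    have h2 : ContinuousAt (fun A' => rot (ι (φ x A'))) (rot (ι x)) :=
      hAc.continuousAt.comp ((hφ x).continuousOn.continuousAt hUn)
    have h3 : ContinuousAt (fun A' => dist A' (rot (ι (φ x A')))) (rot (ι x)) :=
      continuousAt_id.dist h2
    have h4 : dist (rot (ι x)) (rot (ι (φ x (rot (ι x))))) < δ / 4 := by
      rw [h1, dist_self]; positivity
    filter_upwards [hUn, h3.eventually_lt_const h4] with A' hA' hlt
    exact ⟨φ x A', hlt, (hφU x A' hA').2.2.1⟩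
  have hρeq : ∀ A' ∈ interior {A' | ∃ x, Q A' x}, ∃ x₀, A' ∈ U x₀ ∧ ρ =ᶠ[𝓝 A'] φ x₀ := by
    intro A' hA'
    obtain ⟨x₀, hA'U, -, h1⟩ := hloc A' (ρ A') (hρ A' hA').1
    refine ⟨x₀, hA'U, ?_⟩
    filter_upwards [isOpen_interior.mem_nhds hA', Metric.ball_mem_nhds A' (by positivity :
      0 < δ / 4)] with A'' h2 h3
    obtain ⟨h4, h5⟩ := h1 A'' (ρ A'') h3 (hρ A'' h2).1
    exact (hφU x₀ A'' h4).2.2.2 _ h5 (hρ A'' h2).2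
  refine ⟨δ / 4, by positivity, hu, interior {A' | ∃ x, Q A' x}, ρ, isOpen_interior, hmem,
    fun x => ?_, fun A' hA' => ?_, fun A' hA' => ⟨?_, (hρ A' hA').2⟩⟩
  · exact hu _ _ _ (hρ _ (hmem x)).1 (hself x).1 (hρ _ (hmem x)).2 (hself x).2
  · obtain ⟨x₀, hA'U, heq⟩ := hρeq A' hA'
    exact (((hφ x₀).contMDiffAt ((hUo x₀).mem_nhds hA'U)).congr_of_eventuallyEq
      heq).contMDiffWithinAt
  · obtain ⟨x₀, hA'U, heq⟩ := hρeq A' hA'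
    rw [heq.eq_of_nhds]
    exact (hφU x₀ A' hA'U).2.1

theorem graphCoord_rot_graph_of_mem {x : X} {S : V →L[ℝ] V} (hS : S ∈ normalSpace n ι x) :
    graphCoord (rot (ι x)) (rot (graph (ι x) S)) = S := by
  rw [graphCoord_rot_graph]
  exact (mem_normalSpace_iff.1 hS).1

variable [Nontrivial V]

/-- Different small sections of the normal bundle give different fibrations. -/
theorem exists_nhds_eq_of_range_eq : ∃ 𝒩 ∈ c1Nhds (𝓡 (2 * n)) (fun _ : X => (0 : V →L[ℝ] V)),
    ∀ σ ∈ 𝒩, ∀ τ ∈ 𝒩, IsNormalSection n ι σ → IsNormalSection n ι τ →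
      Set.range (fun x => graph (ι x) (σ x)) = Set.range (fun x => graph (ι x) (τ x)) → σ = τ := by
  obtain ⟨ε, hε, hu, -⟩ := h.exists_foot
  have h0 : ∀ v ∈ Metric.sphere (0 : V) 1, v ≠ 0 :=
    fun v hv => ne_zero_of_mem_annulus (sphere_subset_annulus hv)
  obtain ⟨δ, hδ, h1⟩ := h.exists_C1On_graphRot (isCompact_sphere (0 : V) 1) h0 hε
  refine ⟨_, C1On_comp_mem_c1Nhds isOpen_compl_singleton (h.contMDiffOn_radial.of_le h.one_le)
    (isCompact_sphere (0 : V) 1) h0 mdifferentiable_const hδ, fun σ hσ τ hτ hσn hτn hr => ?_⟩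
  have hd : ∀ σ : X → V →L[ℝ] V, IsNormalSection n ι σ →
      (MDifferentiable (𝓡 (2 * n)) 𝓘(ℝ, V →L[ℝ] V) σ → C1On (Metric.sphere (0 : V) 1) δ
        (fun _ => 0) (fun v => σ (π (unitVec v)))) →
      ∀ x, dist (rot (graph (ι x) (σ x))) (rot (ι x)) < ε := by
    intro σ hσn hσ x
    obtain ⟨p, rfl⟩ := h.surjective x
    have h2 := (h1 (fun v => σ (π (unitVec v))) (fun v hv =>
      (h.contDiffAt_comp_radial hσn.1 (h0 v hv)).differentiableAt h.ne_zero)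
      (hσ (hσn.1.mdifferentiable h.ne_zero)) p p.2).1
    simp only [radialRot, unitVec_coe, ← rot_graph, ← dist_eq_norm] at h2
    exact h2
  funext x
  obtain ⟨y, hy⟩ : graph (ι x) (σ x) ∈ Set.range (fun x => graph (ι x) (τ x)) := hr ▸ ⟨x, rfl⟩
  have hy : graph (ι y) (τ y) = graph (ι x) (σ x) := hy
  have h2 := h.graphCoord_rot_graph_of_mem (hσn.2 x)
  have h3 := h.graphCoord_rot_graph_of_mem (hτn.2 y)
  have h4 := hd τ hτn hτ y
  rw [hy] at h3 h4
  -- The common plane has both `x` and `y` as nearby foot points, so they coincide; the section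
  -- values are then the same graph coordinate.
  obtain rfl := hu _ x y (hd σ hσn hσ x) h4 (by rw [h2]; exact hσn.2 x) (by rw [h3]; exact hτn.2 y)
  rw [← h2, h3]

end IsFibration

end Tubular

end GreatCircle

namespace GreatCircle

/-! ### Nearby fibrations come from normal sections -/

section Nearby

variable {n : ℕ} {V : Type v} [NormedAddCommGroup V] [InnerProductSpace ℝ V]
  [FiniteDimensional ℝ V] [Fact (Module.finrank ℝ V = (2 * n + 1) + 1)] [Nontrivial V]
  {X : Type u} [TopologicalSpace X] [ChartedSpace (EuclideanSpace ℝ (Fin (2 * n))) X]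
  [IsManifold (𝓡 (2 * n)) ∞ X]
  {π : Metric.sphere (0 : V) 1 → X} {ι : X → OrientedPlane V}
  {X' : Type u} [TopologicalSpace X'] [ChartedSpace (EuclideanSpace ℝ (Fin (2 * n))) X']
  [IsManifold (𝓡 (2 * n)) ∞ X']
  {π' : Metric.sphere (0 : V) 1 → X'} {ι' : X' → OrientedPlane V}

namespace IsFibration

variable (h : IsFibration n ∞ π ι)
include h

/-- A map out of the base of a fibration is smooth if its composition with the projection is. -/
theorem contMDiff_of_comp_proj {τ : X → X'} {q : Metric.sphere (0 : V) 1 → X'}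
    (hq : ContMDiff (𝓡 (2 * n + 1)) (𝓡 (2 * n)) ∞ q) (hτ : ∀ p, τ (π p) = q p) :
    ContMDiff (𝓡 (2 * n)) (𝓡 (2 * n)) ∞ τ := fun x => by
  obtain ⟨v, hv, hv0⟩ := (ι x).exists_ne_zero
  have h1 : (ι x).plane.starProjection v = v := Submodule.starProjection_eq_self_iff.2 hv
  have h2 : ContMDiffAt 𝓘(ℝ, V) (𝓡 (2 * n)) ∞ (fun w => q (unitVec w))
      ((ι x).plane.starProjection v) := by
    rw [h1]; exact contMDiffAt_radial hq hv0
  have h3 : ContMDiffAt (𝓡 (2 * n)) 𝓘(ℝ, V) ∞ (fun y => (ι y).plane.starProjection v) x :=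
    (ContinuousLinearMap.apply ℝ V v).contDiff.contMDiff.contMDiffAt.comp x
      (h.contMDiff_starProj x)
  -- Near `x`, the map is `q` composed with the local section of `π` obtained by projecting `v` to
  -- the planes.
  refine (h2.comp x h3).congr_of_eventuallyEq ?_
  filter_upwards [h.fibred.eventually_radial_starProjection h.contMDiff_starProj.continuous hv0 hv]
    with y hy
  rw [Function.comp_apply, ← hτ, hy.2]

/-- No identification of `X'` with `X` is given. The foot-point map `ψ` provides one: moving the
fibres of `π'` to the planes `ι (ψ x')` reproduces the fibres of `π`. -/
theorem exists_normalSection {𝒲 : Set (V →L[ℝ] V)} {ρ : (V →L[ℝ] V) → X}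
    (hρ : ContMDiffOn 𝓘(ℝ, V →L[ℝ] V) (𝓡 (2 * n)) ∞ ρ 𝒲)
    (hρN : ∀ A' ∈ 𝒲, opTrace (A' * rot (ι (ρ A'))) < 0 ∧
      graphCoord (rot (ι (ρ A'))) A' ∈ normalSpace n ι (ρ A'))
    (h' : IsFibration n ∞ π' ι') (h𝒲 : ∀ x', rot (ι' x') ∈ 𝒲)
    (hb : ∀ v : V, ‖v‖ = 1 →
      ‖fderiv ℝ (fun w => planeProj (rot (ι (ρ (radialRot π' ι' w)))) w) v - 1‖ ≤ 1 / 2) :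
    ∃ (σ : X → V →L[ℝ] V) (Φ : V ≃ₜ V), IsNormalSection n ι σ ∧
      Set.range (fun x => graph (ι x) (σ x)) = Set.range ι' ∧
      (∀ v ≠ 0, σ (π (unitVec v)) =
        graphCoord (radialRot π ι v) (radialRot π' ι' (Φ.symm v))) ∧
      (∀ v, Φ v = planeProj (rot (ι (ρ (radialRot π' ι' v)))) v) ∧
      (∀ v, ‖Φ v - v‖ ≤ 1 / 2 * ‖v‖) ∧
      (∀ v ≠ 0, HasFDerivAt Φ.symm (Ring.inverse (fderiv ℝ Φ (Φ.symm v))) v) := by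
  obtain ⟨ψ, hψ⟩ : ∃ ψ : X' → X, ψ = fun x' => ρ (rot (ι' x')) := ⟨_, rfl⟩
  have hψs : ContMDiff (𝓡 (2 * n)) (𝓡 (2 * n)) ∞ ψ := by
    rw [hψ]; exact hρ.comp_contMDiff h'.contMDiff_rot h𝒲
  have hf : ContMDiff (𝓡 (2 * n)) 𝓘(ℝ, V →L[ℝ] V) ∞ (fun x' => rot (ι (ψ x'))) :=
    h.contMDiff_rot.comp hψs
  obtain ⟨Φ, q, hq, hΦ, hqΦ, hn, hD⟩ := h'.exists_fibration (f := fun x' => ι (ψ x')) hf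
    (fun v hv => by
      have h1 := hb v hv
      simp only [planeProj_rot] at h1
      rw [hψ]
      exact h1)
  have hψq : ∀ p, ψ (q p) = π p := fun p => ((h.fibred p _).2 ((hq.fibred p _).1 rfl)).symm
  have hψi : Function.Injective ψ := fun x y hxy => hq.fibred.injective (congrArg ι hxy)
  choose s hs using h.surjective
  -- Since `ψ ∘ q = π` and `ψ` is injective, `q` is constant on the fibres of `π` and descends to
  -- the inverse of `ψ`.
  obtain ⟨τ, hτ⟩ : ∃ τ : X → X', ∀ p, τ (π p) = q p :=
    ⟨fun x => q (s x), fun p => hψi (by rw [hψq, hψq, hs])⟩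
  have hτs := h.contMDiff_of_comp_proj hq.contMDiff_proj hτ
  have hψτ : ∀ x, ψ (τ x) = x := fun x => by rw [← hs x, hτ, hψq]
  have hN : ∀ x, opTrace (rot (ι' (τ x)) * rot (ι x)) < 0 ∧
      graphCoord (rot (ι x)) (rot (ι' (τ x))) ∈ normalSpace n ι x := fun x => by
    have h1 := hρN _ (h𝒲 (τ x))
    have h2 : ρ (rot (ι' (τ x))) = x := (congrFun hψ (τ x)).symm.trans (hψτ x)
    rwa [h2] at h1
  have hg : ∀ x, graph (ι x) (graphCoord (rot (ι x)) (rot (ι' (τ x)))) = ι' (τ x) := fun x =>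
    graph_graphCoord _ _ (hN x).1
  refine ⟨fun x => graphCoord (rot (ι x)) (rot (ι' (τ x))), Φ, ⟨fun x => ?_, fun x => (hN x).2⟩,
    ?_, fun v hv => ?_, fun v => ?_, hn, hD⟩
  · have h1 := (contDiffOn_graphCoord (V := V) (k := ∞)).contDiffAt
      (isOpen_graphCoordDomain.mem_nhds (show (rot (ι x), rot (ι' (τ x))) ∈ graphCoordDomain V
        from (hN x).1))
    exact h1.contMDiffAt.comp x ((h.contMDiff_rot x).prodMk_space ((h'.contMDiff_rot.comp hτs) x))
  · simp only [hg]
    have h1 : Function.Surjective τ := fun x' => ⟨ψ x', hψi (hψτ _)⟩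
    exact h1.range_comp ι'
  · simp only [hτ, hqΦ v hv]
    rfl
  · rw [hΦ, ← planeProj_rot, hψ]
    rfl

/-- Every fibration near the given one arises from a small section of the normal bundle. -/
theorem exists_nhds_eq_graph {𝒩 : Set (X → V →L[ℝ] V)}
    (h𝒩 : 𝒩 ∈ c1Nhds (𝓡 (2 * n)) (fun _ : X => (0 : V →L[ℝ] V))) :
    ∃ 𝒪 ∈ c1Nhds (𝓡 (2 * n + 1)) (fun p : Metric.sphere (0 : V) 1 => rot (ι (π p))),
      ∀ (X' : Type u) [TopologicalSpace X'] [ChartedSpace (EuclideanSpace ℝ (Fin (2 * n))) X']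
        [IsManifold (𝓡 (2 * n)) ∞ X']
        (π' : Metric.sphere (0 : V) 1 → X') (ι' : X' → OrientedPlane V),
        IsFibration n ∞ π' ι' → (fun p => rot (ι' (π' p))) ∈ 𝒪 →
          ∃ σ ∈ 𝒩, IsNormalSection n ι σ ∧
            Set.range (fun x => graph (ι x) (σ x)) = Set.range ι' := by
  obtain ⟨-, -, -, 𝒲, ρ, h𝒲o, hA𝒲, hρA, hρ, hρN⟩ := h.exists_foot
  have hS0 : ∀ v ∈ Metric.sphere (0 : V) 1, v ≠ 0 :=
    fun v hv => ne_zero_of_mem_annulus (sphere_subset_annulus hv)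
  have hA : ∀ v ∈ annulus V, ContDiffAt ℝ 1 (radialRot π ι) v := fun v hv =>
    (h.contDiffAt_radialRot (ne_zero_of_mem_annulus hv)).of_le h.one_le
  obtain ⟨δ₁, hδ₁, h1⟩ := h.exists_C1On_of_mem_c1Nhds mdifferentiable_const h𝒩
  obtain ⟨δ₂, hδ₂, h2⟩ := h.exists_C1On_graphCoord (isCompact_sphere (0 : V) 1) hS0 hδ₁
  obtain ⟨δ₃, hδ₃, h3⟩ := exists_C1On_comp_symm isCompact_annulus sphere_subset_annulus hA hδ₂
  obtain ⟨δ₄, hδ₄, h4⟩ := h.exists_C1On_planeProj isCompact_annulus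
    (fun v => ne_zero_of_mem_annulus) (ε := min δ₃ (1 / 2)) (lt_min hδ₃ (by norm_num))
  have hH : ContDiffOn ℝ 1 (fun A' => rot (ι (ρ A'))) 𝒲 :=
    (contMDiffOn_iff_contDiffOn.1 (h.contMDiff_rot.comp_contMDiffOn hρ)).of_le h.one_le
  obtain ⟨δ₅, hδ₅, h5⟩ := exists_C1On_comp isCompact_annulus hA h𝒲o (fun v _ => hA𝒲 _) hH hδ₄
  refine ⟨_, C1On_comp_mem_c1Nhds isOpen_compl_singleton (contMDiffOn_unitVec (n := n))
    isCompact_annulus (fun v hv => ne_zero_of_mem_annulus hv)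
    ((h.contMDiff_rot.comp h.contMDiff_proj).mdifferentiable h.ne_zero)
    (δ := min δ₃ δ₅) (lt_min hδ₃ hδ₅), fun X' _ _ _ π' ι' h' hO => ?_⟩
  have hO' : C1On (annulus V) (min δ₃ δ₅) (radialRot π ι) (radialRot π' ι') :=
    hO ((h'.contMDiff_rot.comp h'.contMDiff_proj).mdifferentiable h'.ne_zero)
  have hd : ∀ v ∈ annulus V, DifferentiableAt ℝ (radialRot π' ι') v := fun v hv =>
    (h'.contDiffAt_radialRot (ne_zero_of_mem_annulus hv)).differentiableAt h'.ne_zero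
  obtain ⟨h6, h7⟩ := h5 _ hd (hO'.mono subset_rfl (min_le_right _ _))
  -- The retraction `ρ` fixes the base, so for the unperturbed fibration its composition with the
  -- planes is `radialRot π ι` again.
  have h7 : C1On (annulus V) δ₄ (radialRot π ι) (fun v => rot (ι (ρ (radialRot π' ι' v)))) :=
    h7.congr (fun v _ => Filter.Eventually.of_forall fun w => by
      simp only [Function.comp_apply, radialRot, hρA]) fun v _ => Filter.EventuallyEq.rfl
  have h8 := h4 _ (fun v hv => ((hH.contDiffAt (h𝒲o.mem_nhds (h6 v hv))).differentiableAt
    one_ne_zero).comp v (hd v hv)) h7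
  have h𝒲' : ∀ x', rot (ι' x') ∈ 𝒲 := fun x' => by
    obtain ⟨p, rfl⟩ := h'.surjective x'
    have h9 := h6 p (sphere_subset_annulus p.2)
    rwa [radialRot, unitVec_coe] at h9
  obtain ⟨σ, Φ, hσ, hr, hσΦ, hΦ, hn, hD⟩ := h.exists_normalSection hρ hρN h' h𝒲' (fun v hv => by
    have h9 := (h8 v (sphere_subset_annulus (mem_sphere_zero_iff_norm.2 hv))).2.le
    rw [fderiv_id] at h9
    exact h9.trans (min_le_right _ _))
  have hΦ' : ⇑Φ = fun v => planeProj (rot (ι (ρ (radialRot π' ι' v)))) v := funext hΦ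
  have h10 := h3 _ Φ hd (fun v hv => symm_mem_annulus hn hv) (fun v hv => hD v (hS0 v hv))
    (hO'.mono subset_rfl (min_le_left _ _))
    (by rw [hΦ']; exact h8.mono subset_rfl (min_le_left _ _))
  have h11 := h2 _ (fun v hv => (hd _ (symm_mem_annulus hn hv)).comp v
    (hD v (hS0 v hv)).differentiableAt) h10
  refine ⟨σ, h1 σ (hσ.1.mdifferentiable h.ne_zero) (h11.congr
    (fun v _ => Filter.EventuallyEq.rfl) fun v hv => ?_), hσ, hr⟩
  filter_upwards [continuousAt_id.eventually_ne (hS0 v hv)] with w hw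
  exact (hσΦ w hw).symm

end IsFibration

end Nearby

end GreatCircle

theorem mainTheorem10 (n : ℕ)
    {V : Type v} [NormedAddCommGroup V] [InnerProductSpace ℝ V] [FiniteDimensional ℝ V]
    [Fact (Module.finrank ℝ V = (2 * n + 1) + 1)]
    {X : Type u} [TopologicalSpace X] [ChartedSpace (EuclideanSpace ℝ (Fin (2 * n))) X]
    [IsManifold (𝓡 (2 * n)) ∞ X]
    (π : Metric.sphere (0 : V) 1 → X) (ι : X → OrientedPlane V)
    (hπ : IsGreatCircleFibration n ∞ π ι) :
    -- every `C¹`-small motion of the base is the base of a great circle fibration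
    (∃ 𝒪 ∈ c1Nhds (𝓡 (2 * n)) (fun x => rot (ι x)),
      ∀ f : X → OrientedPlane V, (fun x => rot (f x)) ∈ 𝒪 →
        ∀ k : ℕ∞, 1 ≤ k →
          ContMDiff (𝓡 (2 * n)) 𝓘(ℝ, V →L[ℝ] V) k (fun x => rot (f x)) →
            ∃ π' : Metric.sphere (0 : V) 1 → X, IsGreatCircleFibration n k π' f) ∧
    -- the fibres of the normal bundle
    (∀ x : X,
      (∃ j J, IsOsculating (ι x).orientation (tangentPlane n ι x) j J) ∧
      ∀ j J, IsOsculating (ι x).orientation (tangentPlane n ι x) j J →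
        Set.BijOn (fun u => (1 / 2 : ℝ) • (u - J ∘ₗ u ∘ₗ j))
          (tangentPlane n ι x) (complexLinear j J) ∧
        Function.Bijective
          (fun u : conjLinear j J => ((tangentPlane n ι x).mkQ u : NormalFiber n ι x))) ∧
    -- the normal bundle has rank `2n` over the `2n`-dimensional base, and its sections are
    -- locally `2n` arbitrary smooth functions
    (∀ x : X, Module.finrank ℝ (NormalFiber n ι x) = 2 * n ∧
      Set.BijOn (normalClass n ι x) (normalSpace n ι x) Set.univ) ∧
    (∀ x₀ : X, ∃ W : Set X, IsOpen W ∧ x₀ ∈ W ∧ ∃ e : Fin (2 * n) → X → V →L[ℝ] V,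
      (∀ i, ContMDiffOn (𝓡 (2 * n)) 𝓘(ℝ, V →L[ℝ] V) ∞ (e i) W) ∧
      ∀ x ∈ W, LinearIndependent ℝ (fun i => e i x) ∧
        Submodule.span ℝ (Set.range fun i => e i x) = normalSpace n ι x) ∧
    -- the great circle fibrations near the given one are parametrized by the small sections of
    -- the normal bundle: small sections give great circle fibrations near the given one,
    (∀ 𝒪 ∈ c1Nhds (𝓡 (2 * n + 1)) (fun p : Metric.sphere (0 : V) 1 => rot (ι (π p))),
      ∃ 𝒩 ∈ c1Nhds (𝓡 (2 * n)) (fun _ : X => (0 : V →L[ℝ] V)),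
        ∀ σ ∈ 𝒩, IsNormalSection n ι σ →
          ∃ π' : Metric.sphere (0 : V) 1 → X,
            IsGreatCircleFibration n ∞ π' (fun x => graph (ι x) (σ x)) ∧
            (fun p => rot (graph (ι (π' p)) (σ (π' p)))) ∈ 𝒪) ∧
    -- different small sections give different fibrations,
    (∃ 𝒩 ∈ c1Nhds (𝓡 (2 * n)) (fun _ : X => (0 : V →L[ℝ] V)),
      ∀ σ ∈ 𝒩, ∀ τ ∈ 𝒩, IsNormalSection n ι σ → IsNormalSection n ι τ →
        Set.range (fun x => graph (ι x) (σ x)) = Set.range (fun x => graph (ι x) (τ x)) →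
          σ = τ) ∧
    -- and every great circle fibration near the given one arises from a small section
    (∀ 𝒩 ∈ c1Nhds (𝓡 (2 * n)) (fun _ : X => (0 : V →L[ℝ] V)),
      ∃ 𝒪 ∈ c1Nhds (𝓡 (2 * n + 1)) (fun p : Metric.sphere (0 : V) 1 => rot (ι (π p))),
        ∀ (X' : Type u) [TopologicalSpace X'] [ChartedSpace (EuclideanSpace ℝ (Fin (2 * n))) X']
          [IsManifold (𝓡 (2 * n)) ∞ X']
          (π' : Metric.sphere (0 : V) 1 → X') (ι' : X' → OrientedPlane V),
          IsGreatCircleFibration n ∞ π' ι' → (fun p => rot (ι' (π' p))) ∈ 𝒪 →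
            ∃ σ ∈ 𝒩, IsNormalSection n ι σ ∧
              Set.range (fun x => graph (ι x) (σ x)) = Set.range ι') := by
  have : Nontrivial V := nontrivial_of_finrank_eq (Fact.out : Module.finrank ℝ V = (2 * n + 1) + 1)
  have h : IsFibration n ∞ π ι := hπ.isFibration (by norm_num)
  refine ⟨?_, fun x => ⟨(h.isElliptic x).exists_isOsculating (ι x).finrank_plane _,
      fun j J hJ => ⟨hJ.bijOn_complexLinear, hJ.bijective_conjLinear⟩⟩,
    fun x => ⟨h.finrank_normalFiber x, h.bijOn_normalClass x⟩, fun x₀ => h.exists_frame x₀,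
    fun 𝒪 h𝒪 => ?_, h.exists_nhds_eq_of_range_eq, fun 𝒩 h𝒩 => ?_⟩
  · obtain ⟨𝒪, h𝒪, h1⟩ := h.exists_nhds_isGreatCircleFibration
    exact ⟨𝒪, h𝒪, fun f hf k hk hfk =>
      h1 f hf k (by exact_mod_cast hk) (by exact_mod_cast le_top) hfk⟩
  · obtain ⟨𝒩, h𝒩, h1⟩ := h.exists_nhds_graph h𝒪
    exact ⟨𝒩, h𝒩, fun σ hσ hσn => h1 σ hσ hσn.1⟩
  · obtain ⟨𝒪, h𝒪, h1⟩ := h.exists_nhds_eq_graph h𝒩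
    exact ⟨𝒪, h𝒪, fun X' _ _ _ π' ι' hπ' hO =>
      h1 X' π' ι' (hπ'.isFibration (by norm_num)) hO⟩
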